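/- **Setting.** Let $I\subseteq\mathbb R$ be an interval and $\bar I$ its closure in $[-\infty,\infty]$. Let $(\Omega,\mathcal F,(\mathcal F_t)_{t\ge 0},\mathbb P)$ be a filtered probability space and $Y=(Y_t)_{t\ge0}$ a continuous adapted process with values in $I$, started at a point $y$ of the interior of $I$, which is a regular, time-homogeneous diffusion with respect to $(\mathcal F_t)$. That is, there are laws $(\mathbb P^z)_{z\in I}$ on continuous paths in $I$, measurable in $z$, with $\mathbb P^z$ carried by paths started at $z$, such that the strong Markov property holds with this family, both for $Y$ with respect to $(\mathcal F_t)$ and for the coordinate process under every $\mathbb P^z$; for $z$ in the interior of $I$ and $v\in I$ the path hits $v$ with positive $\mathbb P^z$-probability; and end points of $I$ that belong to $I$ are absorbing. Suppose that there is an $\mathcal F_0$-measurable real random variable with a continuous distribution function that is independent of $Y$. Let $\mathcal T$ be the set of stopping times $\tau$ (values in $[0,\infty]$) such that $Y_\tau:=\lim_{t\to\infty}Y_{t\wedge\tau}$ exists in $\bar I$ almost surely. For $a\le y\le b$ in $\bar I$ let $\tau_{a,b}=\inf\{u\ge0:Y_u\notin(a,b)\}$. Let $\mathcal T_T$ be the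 set of pure threshold rules, i.e. of the $\tau_{a,b}$ that belong to $\mathcal T$, and let $\mathcal T_R$ be the set of randomized threshold rules, i.e. of the $\tau_{A,B}$ that belong to $\mathcal T$, where $(A,B)$ is an $\mathcal F_0$-measurable random pair, independent of $Y$, with values in $([-\infty,y]\cap\bar I)\times([y,\infty]\cap\bar I)$. For $V:\mathcal T\to[-\infty,\infty]$ and $\mathcal S\subseteq\mathcal T$ write $V_*(\mathcal S)=\sup_{\tau\in\mathcal S}V(\tau)$. Call $V$ law invariant if $V(\sigma)=V(\tau)$ whenever $\sigma,\tau\in\mathcal T$ and $Y_\sigma$, $Y_\tau$ have the same law. A utility function is a continuous strictly increasing $u:\bar I\to[-\infty,\infty]$; if $u(Y_\tau)$ is almost surely finite and integrable, let $\mathcal C_u(\tau)=u^{-1}(\mathbb E[u(Y_\tau)])\in\bar I$. The cautious stochastic choice (CSC) value for two utility functions $u_\alpha,u_\beta$ is $\mathrm{CSC}(\tau)=\min\{\mathcal C_{u_\alpha}(\tau),\mathcal C_{u_\beta}(\tau)\}$. For rules $\tau_1,\tau_2$ and an $\mathcal F_0$-measurable $\{1,2\}$-valued $Z$, the mixture of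 $\tau_1$ and $\tau_2$ by $Z$ is $\tau_Z$. **Statement.** 1. (Randomized threshold rules suffice.) For every law invariant $V$, $V_*(\mathcal T_T)\le V_*(\mathcal T_R)=V_*(\mathcal T)$. Moreover for every $\tau\in\mathcal T$ there is $\sigma\in\mathcal T_R$ with $V(\sigma)=V(\tau)$. 2. (Pure threshold rules may not suffice.) Suppose that some level $v\in I$, $v>y$, is reached by $Y$ in finite time with probability less than $1$ (equivalently, a scale function of $Y$ is bounded below on $I$). Then there are two finite utility functions $u_\alpha,u_\beta$ on $\bar I$ such that the CSC value is a law invariant $V$ with $V_*(\mathcal T_T)<V_*(\mathcal T_R)$. Indeed some mixture $\tau_Z\in\mathcal T_R$ of two pure threshold rules, with $Z$ independent of $Y$, satisfies $V_*(\mathcal T_T)<\mathrm{CSC}(\tau_Z)$. 3. (A mixture of two rules beats both.) Let $u_\alpha,u_\beta$ be utility functions and $\tau_1,\tau_2\in\mathcal T$ with $u_\gamma(Y_{\tau_j})$ almost surely finite and integrable for $\gamma\in\{\alpha,\beta\}$, $j\in\{1,2\}$, and let $\tilde y$ satisfy $$\mathcal C_{u_\alpha}(\tau_1)>\tilde y>\mathcal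 C_{u_\beta}(\tau_1),\qquad \mathcal C_{u_\alpha}(\tau_2)<\tilde y<\mathcal C_{u_\beta}(\tau_2).$$ Then there is $\theta\in(0,1)$ such that for every $\mathcal F_0$-measurable $\{1,2\}$-valued $Z$ with $\mathbb P(Z=1)=\theta$ that is independent of $Y_{\tau_1}$ and of $Y_{\tau_2}$, the mixture $\tau_Z$ belongs to $\mathcal T$ and $\mathrm{CSC}(\tau_Z)>\max\{\mathrm{CSC}(\tau_1),\mathrm{CSC}(\tau_2)\}$. If $\tau_1,\tau_2\in\mathcal T_T$, such a $Z$, independent of $Y$ and with $\tau_Z\in\mathcal T_R$, exists. -/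

import Mathlib

open MeasureTheory ProbabilityTheory Filter Topology Set
open scoped NNReal ENNReal

namespace OptStop

/-! ### Continuous paths in an interval and regular diffusions -/

/-- Continuous paths `[0, ∞) → I`, with the σ-algebra generated by the coordinate maps. -/
abbrev ContPath (I : Set ℝ) : Type := {w : ℝ≥0 → I // Continuous w}

/-- The path `t ↦ w (s + t)`. -/
def shift {I : Set ℝ} (s : ℝ≥0) (w : ContPath I) : ContPath I :=
  ⟨fun t => w.1 (s + t), w.2.comp (continuous_const.add continuous_id)⟩

theorem measurable_coord {I : Set ℝ} (t : ℝ≥0) : Measurable fun w : ContPath I => w.1 t :=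
  (measurable_pi_apply t).comp measurable_subtype_coe

/-- The filtration on path space generated by the coordinate process. -/
noncomputable def canonicalFiltration (I : Set ℝ) :
    Filtration ℝ≥0 (inferInstance : MeasurableSpace (ContPath I)) :=
  Filtration.natural (fun t (w : ContPath I) => w.1 t)
    fun t => (measurable_coord t).stronglyMeasurable

/-- The continuous process `Y` (a random path) is adapted to `𝓕`, and is a time-homogeneous strong
Markov process with respect to `𝓕` and `P`: for every `𝓕`-stopping time `τ`, on `{τ < ∞}` the
conditional law, given the σ-algebra of `τ`, of the path of `Y` after time `τ`
is `κ (Y_τ)`. -/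
def IsStrongMarkov {I : Set ℝ} {Ω : Type*} {mΩ : MeasurableSpace Ω} (𝓕 : Filtration ℝ≥0 mΩ)
    (P : Measure Ω) (Y : Ω → ContPath I) (κ : Kernel I (ContPath I)) : Prop :=
  (∀ t, Measurable[𝓕 t] fun ω => (Y ω).1 t) ∧
  ∀ (τ : Ω → WithTop ℝ≥0) (hτ : IsStoppingTime 𝓕 τ) (A : Set Ω) (B : Set (ContPath I)),
    MeasurableSet[hτ.measurableSpace] A → MeasurableSet B →
      P (A ∩ {ω | τ ω ≠ ⊤ ∧ shift (τ ω).untopA (Y ω) ∈ B}) =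
        ∫⁻ ω in A ∩ {ω | τ ω ≠ ⊤}, κ ((Y ω).1 (τ ω).untopA) B ∂P

/-- `κ z`, for `z ∈ I`, are the laws of a regular, time-homogeneous (continuous, strong Markov)
diffusion with state space the interval `I`, started at `z`; end points of `I` which belong
to `I` are absorbing. -/
structure IsRegularDiffusion (I : Set ℝ) (κ : Kernel I (ContPath I)) : Prop where
  ordConnected : I.OrdConnected
  isMarkovKernel : IsMarkovKernel κ
  start : ∀ z, ∀ᵐ w ∂(κ z), w.1 0 = z
  strongMarkov : ∀ z, IsStrongMarkov (canonicalFiltration I) (κ z) id κ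
  regular : ∀ z : I, (z : ℝ) ∈ interior I → ∀ v : I, 0 < κ z {w | ∃ t, w.1 t = v}
  absorbing : ∀ z : I, (z : ℝ) ∉ interior I → ∀ᵐ w ∂(κ z), ∀ t, w.1 t = z

/-! ### Stopping times and stopped values -/

/-- The closure of `I` in `[-∞, ∞]`. -/
def closedRange (I : Set ℝ) : Set EReal := closure ((fun r : ℝ => (r : EReal)) '' I)

/-- The process `Y_t`, with values regarded as elements of `[-∞, ∞]`. -/
def coordProcess {I : Set ℝ} {Ω : Type*} (Y : Ω → ContPath I) (t : ℝ≥0) (ω : Ω) : EReal :=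
  (((Y ω).1 t : ℝ) : EReal)

/-- `𝒯`: all stopping times `τ` such that `lim_{t → ∞} Y_{t ∧ τ}` exists almost surely
(in the closure of `I` in `[-∞, ∞]`). -/
def allRules {I : Set ℝ} {Ω : Type*} {mΩ : MeasurableSpace Ω} (𝓕 : Filtration ℝ≥0 mΩ)
    (P : Measure Ω) (Y : Ω → ContPath I) : Set (Ω → WithTop ℝ≥0) :=
  {τ | IsStoppingTime 𝓕 τ ∧
    ∀ᵐ ω ∂P, ∃ l : EReal, Tendsto (fun t => stoppedProcess (coordProcess Y) τ t ω) atTop (𝓝 l)}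

/-- `Y_τ = lim_{t → ∞} Y_{t ∧ τ}`. (The upper limit is the limit where that exists; it is
the value of `Y` at time `τ` if `τ < ∞`.) -/
noncomputable def stoppedAt {I : Set ℝ} {Ω : Type*} (Y : Ω → ContPath I) (τ : Ω → WithTop ℝ≥0)
    (ω : Ω) : EReal :=
  limsup (fun t => stoppedProcess (coordProcess Y) τ t ω) atTop

/-- `τ_{a,b} = inf {u ≥ 0 : Y_u ∉ (a, b)}`, as a function of the path. -/
noncomputable def exitTime {I : Set ℝ} (a b : EReal) (w : ContPath I) : WithTop ℝ≥0 :=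
  hittingAfter (coordProcess (id : ContPath I → ContPath I)) (Ioo a b)ᶜ 0 w

/-- `𝒟 = ([-∞, y] ∩ Ī) × ([y, ∞] ∩ Ī)`. -/
def thresholdPairs (I : Set ℝ) (y : I) : Set (EReal × EReal) :=
  (Iic ((y : ℝ) : EReal) ∩ closedRange I) ×ˢ (Ici ((y : ℝ) : EReal) ∩ closedRange I)

/-- `𝒯_T`: pure threshold rules. -/
def thresholdRules {I : Set ℝ} {Ω : Type*} {mΩ : MeasurableSpace Ω} (𝓕 : Filtration ℝ≥0 mΩ)
    (P : Measure Ω) (Y : Ω → ContPath I) (y : I) : Set (Ω → WithTop ℝ≥0) :=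
  allRules 𝓕 P Y ∩ {τ | ∃ p ∈ thresholdPairs I y, τ = fun ω => exitTime p.1 p.2 (Y ω)}

/-- `𝒯_R`: randomized threshold rules, the first exit of `Y` from a random interval with end
points `Θ = (A, B)`, where `Θ` is `𝓕 0`-measurable, `𝒟`-valued and independent of `Y`. -/
def randomizedThresholdRules {I : Set ℝ} {Ω : Type*} {mΩ : MeasurableSpace Ω}
    (𝓕 : Filtration ℝ≥0 mΩ) (P : Measure Ω) (Y : Ω → ContPath I) (y : I) :
    Set (Ω → WithTop ℝ≥0) :=
  allRules 𝓕 P Y ∩ {τ | ∃ Θ : Ω → EReal × EReal, Measurable[𝓕 0] Θ ∧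
    (∀ ω, Θ ω ∈ thresholdPairs I y) ∧ IndepFun Θ Y P ∧
    τ = fun ω => exitTime (Θ ω).1 (Θ ω).2 (Y ω)}

/-- `𝓕 0` carries a real random variable with a continuous (atomless) law, independent of `Y`. -/
def IsRich {I : Set ℝ} {Ω : Type*} {mΩ : MeasurableSpace Ω} (𝓕 : Filtration ℝ≥0 mΩ)
    (P : Measure Ω) (Y : Ω → ContPath I) : Prop :=
  ∃ U : Ω → ℝ, Measurable[𝓕 0] U ∧ (∀ c, P {ω | U ω = c} = 0) ∧ IndepFun U Y P

/-- The value `V` of a stopping rule depends only on the law of the stopped process. -/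
def LawInvariant {I : Set ℝ} {Ω : Type*} {mΩ : MeasurableSpace Ω} (𝓕 : Filtration ℝ≥0 mΩ)
    (P : Measure Ω) (Y : Ω → ContPath I) (V : (Ω → WithTop ℝ≥0) → EReal) : Prop :=
  ∀ σ ∈ allRules 𝓕 P Y, ∀ τ ∈ allRules 𝓕 P Y,
    P.map (stoppedAt Y σ) = P.map (stoppedAt Y τ) → V σ = V τ

/-- `V_*(S) = sup_{τ ∈ S} V(τ)`. -/
noncomputable def optimalValue {Ω : Type*} (V : (Ω → WithTop ℝ≥0) → EReal)
    (S : Set (Ω → WithTop ℝ≥0)) : EReal :=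
  ⨆ τ ∈ S, V τ

/-! ### Cautious stochastic choice -/

/-- A utility function on the closure of `I`: strictly increasing and continuous. As that
closure is compact and connected, the inverse on the range is strictly increasing and
continuous too. -/
def IsUtility (I : Set ℝ) (u : EReal → EReal) : Prop :=
  StrictMonoOn u (closedRange I) ∧ ContinuousOn u (closedRange I)

/-- `u(Y_τ)` is almost surely finite and integrable. -/
def HasExpectedUtility {I : Set ℝ} {Ω : Type*} {mΩ : MeasurableSpace Ω}
    (P : Measure Ω) (Y : Ω → ContPath I) (u : EReal → EReal) (τ : Ω → WithTop ℝ≥0) : Prop :=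
  (∀ᵐ ω ∂P, u (stoppedAt Y τ ω) ≠ ⊥ ∧ u (stoppedAt Y τ ω) ≠ ⊤) ∧
    Integrable (fun ω => (u (stoppedAt Y τ ω)).toReal) P

/-- The certainty equivalent `u⁻¹(E[u(Y_τ)])`, an element of the closure of `I`. -/
noncomputable def certaintyEquivalent {I : Set ℝ} {Ω : Type*} {mΩ : MeasurableSpace Ω}
    (P : Measure Ω) (Y : Ω → ContPath I) (u : EReal → EReal) (τ : Ω → WithTop ℝ≥0) : EReal :=
  Function.invFunOn u (closedRange I) ((∫ ω, (u (stoppedAt Y τ ω)).toReal ∂P : ℝ) : EReal)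

/-- The value of `τ` under cautious stochastic choice with the utilities `u i`. -/
noncomputable def cscValue {I : Set ℝ} {Ω ι : Type*} {mΩ : MeasurableSpace Ω}
    (P : Measure Ω) (Y : Ω → ContPath I) (u : ι → EReal → EReal) (τ : Ω → WithTop ℝ≥0) : EReal :=
  ⨅ i, certaintyEquivalent P Y (u i) τ

/-- The mixture `τ_Z` of the rules `τ i`, in which the rule is chosen by the random index `Z`. -/
def mixture {Ω ι : Type*} (Z : Ω → ι) (τ : ι → Ω → WithTop ℝ≥0) : Ω → WithTop ℝ≥0 :=
  fun ω => τ (Z ω) ω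

end OptStop

namespace OptStop

/-! ### First hitting times of closed sets by continuous paths -/

/-! Law invariance reduces the sufficiency of randomized threshold rules to an embedding problem:
the law `μ` of `Y_τ`, for any admissible `τ`, has to be the law at a randomized threshold exit
(`exists_randomizedThresholdRule`). Multiplicativity of hitting probabilities and the strong Markov
property give a dichotomy (`measure_hit_lt_one`): either no higher level is reached almost surely
from any point, or every higher level is reached almost surely from every point. The same holds
downwards by reflection.

Suppose that higher levels can be missed. Then paths converge to a point of `I` or an end of it, and
`s(z) = P^z(hit c)` for `z ≤ c`, with `s(z) = 1 / P^c(hit z)` for `z > c`, is a scale function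
bounded below. With no stochastic calculus, the strong Markov property yields `E[s(Y_τ)] ≤ s(y)`,
with equality when `s` is bounded (`lintegral_scaleE_le`, `lintegral_scaleE_eq`). Normalize `s(y) =
1`. A pair `(a, b)` drawn from `μ` below `y` times `μ` above `y`, with density proportional to
`(s(b) - 1) + (1 - s(a))`, leads to two-point exit laws which average to `μ` above `y` and a
multiple of `μ` below `y`. A deficit below `y` means `E[s(Y_τ)] < 1`, so `s` is unbounded; the exit
from `(a, r)`, with `r` the upper end, is then at `a` almost surely, and such pairs supply the
missing mass (`exists_mixture_of_twoPoint`, `exists_randomizedThresholdRule_of_transient`). An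
independent uniform variable samples the pair. If lower levels can be missed, the process is
reflected. If neither, every level is visited at arbitrarily late times, so `τ` is finite, and a
single level drawn from `μ` can simply be waited for.

For the strict gap, let `g` be a bounded increasing transform of `s` with `E[g(Y_τ)] ≤ g(y)`. Two
utilities `f_0 ∘ g` and `f_1 ∘ g` have `f_i ≥ id`, where `f_0` exceeds the identity only at low
values and `f_1` only at values between these and `g(y)`. A pure threshold rule has only one lower
exit level, at which one of the `f_i` is the identity, so one certainty equivalent is at most `y`. A
mixture of rules with two different lower levels benefits from both
(`exists_utility_mixture_beats_pure`).

The last claim rests on expected utilities being affine in the mixing weight: the weight is chosen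
by looking at the larger of the two low certainty equivalents (`exists_mixture_weight`). -/

theorem continuous_coordE {I : Set ℝ} (w : ContPath I) :
    Continuous fun t => ((w.1 t : ℝ) : EReal) :=
  continuous_coe_real_ereal.comp (continuous_subtype_val.comp w.2)

theorem continuous_coordR {I : Set ℝ} (w : ContPath I) : Continuous fun t => (w.1 t : ℝ) :=
  continuous_subtype_val.comp w.2

theorem shift_apply {I : Set ℝ} (s t : ℝ≥0) (w : ContPath I) : (shift s w).1 t = w.1 (s + t) := rfl

/-- The first time at which the path is in `C`. -/
noncomputable def firstHit {I : Set ℝ} (C : Set EReal) (w : ContPath I) : WithTop ℝ≥0 :=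
  hittingAfter (coordProcess (id : ContPath I → ContPath I)) C 0 w

theorem exitTime_eq_firstHit {I : Set ℝ} (a b : EReal) (w : ContPath I) :
    exitTime a b w = firstHit (Ioo a b)ᶜ w := rfl

theorem firstHit_eq_top_iff {I : Set ℝ} {C : Set EReal} {w : ContPath I} :
    firstHit C w = ⊤ ↔ ∀ t, ((w.1 t : ℝ) : EReal) ∉ C := by
  simp [firstHit, hittingAfter_eq_top_iff, coordProcess]

theorem notMem_of_lt_firstHit {I : Set ℝ} {C : Set EReal} {w : ContPath I} {t : ℝ≥0}
    (h : (t : WithTop ℝ≥0) < firstHit C w) : ((w.1 t : ℝ) : EReal) ∉ C :=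
  notMem_of_lt_hittingAfter (u := coordProcess (id : ContPath I → ContPath I)) h zero_le

theorem firstHit_le_of_mem {I : Set ℝ} {C : Set EReal} {w : ContPath I} {t : ℝ≥0}
    (h : ((w.1 t : ℝ) : EReal) ∈ C) : firstHit C w ≤ t :=
  hittingAfter_le_of_mem (u := coordProcess (id : ContPath I → ContPath I)) zero_le h

/-- The set of times spent in a closed set by a continuous path is closed, so its infimum is
attained. -/
theorem firstHit_mem {I : Set ℝ} {C : Set EReal} (hC : IsClosed C) {w : ContPath I} {s : ℝ≥0}
    (h : firstHit C w = s) : ((w.1 s : ℝ) : EReal) ∈ C := by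
  have hex : ∃ t, ((w.1 t : ℝ) : EReal) ∈ C := by
    by_contra! hn
    rw [firstHit_eq_top_iff.2 hn] at h
    exact WithTop.top_ne_coe h
  have hS : IsClosed {i : ℝ≥0 | 0 ≤ i ∧ coordProcess (id : ContPath I → ContPath I) i w ∈ C} := by
    simp only [zero_le, true_and]
    exact hC.preimage (continuous_coordE w)
  obtain ⟨t, ht⟩ := hex
  have := hS.csInf_mem ⟨t, zero_le, ht⟩ (OrderBot.bddBelow _)
  rw [firstHit, hittingAfter, if_pos ⟨t, zero_le, ht⟩] at h
  rw [WithTop.coe_inj.1 h] at this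
  exact this.2

theorem firstHit_le_iff {I : Set ℝ} {C : Set EReal} (hC : IsClosed C) {w : ContPath I} {t : ℝ≥0} :
    firstHit C w ≤ t ↔ ∃ s ≤ t, ((w.1 s : ℝ) : EReal) ∈ C := by
  constructor
  · intro h
    obtain ⟨s, hs⟩ := WithTop.ne_top_iff_exists.1 (ne_top_of_le_ne_top WithTop.coe_ne_top h)
    rw [← hs] at h
    exact ⟨s, WithTop.coe_le_coe.1 h, firstHit_mem hC hs.symm⟩
  · rintro ⟨s, hs, hm⟩
    exact (firstHit_le_of_mem hm).trans (WithTop.coe_le_coe.2 hs)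

/-- The minimum of the path up to time `t`. -/
noncomputable def runMin {I : Set ℝ} (t : ℝ≥0) (w : ContPath I) : EReal :=
  ⨅ s : Iic t, ((w.1 s : ℝ) : EReal)

/-- The maximum of the path up to time `t`. -/
noncomputable def runMax {I : Set ℝ} (t : ℝ≥0) (w : ContPath I) : EReal :=
  ⨆ s : Iic t, ((w.1 s : ℝ) : EReal)

theorem isCompact_Iic_nnreal (t : ℝ≥0) : IsCompact (Iic t) := by
  rw [← Set.Icc_bot]; exact isCompact_Icc

theorem runMin_le_iff {I : Set ℝ} {t : ℝ≥0} {w : ContPath I} {a : EReal} :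
    runMin t w ≤ a ↔ ∃ s ≤ t, ((w.1 s : ℝ) : EReal) ≤ a := by
  constructor
  · intro h
    obtain ⟨s, hs, hmin⟩ := (isCompact_Iic_nnreal t).exists_isMinOn ⟨t, le_refl t⟩
      (continuous_coordE w).continuousOn
    exact ⟨s, hs, (le_iInf fun u => hmin u.2).trans h⟩
  · rintro ⟨s, hs, h⟩
    exact (iInf_le _ (⟨s, hs⟩ : Iic t)).trans h

theorem le_runMax_iff {I : Set ℝ} {t : ℝ≥0} {w : ContPath I} {a : EReal} :
    a ≤ runMax t w ↔ ∃ s ≤ t, a ≤ ((w.1 s : ℝ) : EReal) := by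
  constructor
  · intro h
    obtain ⟨s, hs, hmax⟩ := (isCompact_Iic_nnreal t).exists_isMaxOn ⟨t, le_refl t⟩
      (continuous_coordE w).continuousOn
    exact ⟨s, hs, h.trans (iSup_le fun u => hmax u.2)⟩
  · rintro ⟨s, hs, h⟩
    exact h.trans (le_iSup (fun u : Iic t => ((w.1 u : ℝ) : EReal)) (⟨s, hs⟩ : Iic t))

/-- The running extremes are attained by continuity, so they decide whether the exit has occurred by
time `t`. This makes the event measurable jointly in thresholds and path, and turns exits from
random intervals into stopping times without right-continuity of the filtration. -/
theorem exitTime_le_iff {I : Set ℝ} {a b : EReal} {w : ContPath I} {t : ℝ≥0} :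
    exitTime a b w ≤ t ↔ runMin t w ≤ a ∨ b ≤ runMax t w := by
  rw [exitTime_eq_firstHit, firstHit_le_iff isOpen_Ioo.isClosed_compl, runMin_le_iff,
    le_runMax_iff, ← exists_or]
  refine exists_congr fun s => ?_
  rw [← and_or_left, mem_compl_iff, mem_Ioo, not_and_or, not_lt, not_lt]

theorem exists_mid_of_le {I : Set ℝ} {w : ContPath I} {v : I} {s t : ℝ≥0}
    (hs : w.1 s ≤ v) (ht : v ≤ w.1 t) : ∃ u ∈ uIcc s t, w.1 u = v :=
  intermediate_value_uIcc w.2.continuousOn (Icc_subset_uIcc ⟨hs, ht⟩)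

theorem firstHit_singleton_le_iff {I : Set ℝ} {v : I} {w : ContPath I} {t : ℝ≥0} :
    firstHit {((v : ℝ) : EReal)} w ≤ t ↔
      runMin t w ≤ ((v : ℝ) : EReal) ∧ ((v : ℝ) : EReal) ≤ runMax t w := by
  rw [firstHit_le_iff isClosed_singleton, runMin_le_iff, le_runMax_iff]
  constructor
  · rintro ⟨s, hs, h⟩
    rw [mem_singleton_iff] at h
    exact ⟨⟨s, hs, h.le⟩, ⟨s, hs, h.ge⟩⟩
  · rintro ⟨⟨s, hs, h⟩, ⟨s', hs', h'⟩⟩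
    obtain ⟨u, hu, rfl⟩ := exists_mid_of_le (w := w) (v := v) (s := s) (t := s')
      (by exact_mod_cast h) (by exact_mod_cast h')
    exact ⟨u, hu.2.trans (max_le hs hs'), rfl⟩

/-! ### Measurability -/

theorem measurable_path {I : Set ℝ} {Ω : Type*} {mΩ : MeasurableSpace Ω} {Y : Ω → ContPath I}
    (h : ∀ t, Measurable fun ω => (Y ω).1 t) : Measurable Y :=
  (measurable_pi_lambda _ h).subtype_mk

/-- By continuity a countable dense set of times up to `t` suffices, so only the path up to time `t`
enters. -/
theorem measurable_runMin {I : Set ℝ} {Ω : Type*} {m : MeasurableSpace Ω} {Y : Ω → ContPath I}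
    {t : ℝ≥0} (h : ∀ s ≤ t, Measurable fun ω => (Y ω).1 s) :
    Measurable fun ω => runMin t (Y ω) := by
  obtain ⟨D, hDc, hD⟩ := TopologicalSpace.exists_countable_dense (Iic t)
  refine measurable_of_Ici fun a => ?_
  have : (fun ω => runMin t (Y ω)) ⁻¹' Ici a =
      ⋂ s ∈ D, {ω | a ≤ (((Y ω).1 (s : Iic t) : ℝ) : EReal)} := by
    ext ω
    simp only [mem_preimage, mem_Ici, mem_iInter, mem_ofPred_eq, runMin, le_iInf_iff]
    refine ⟨fun h s _ => h s, fun h s => ?_⟩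
    have hcl : IsClosed {s : Iic t | a ≤ (((Y ω).1 s : ℝ) : EReal)} :=
      isClosed_Ici.preimage ((continuous_coordE (Y ω)).comp continuous_subtype_val)
    exact hcl.closure_subset_iff.2 (fun s hs => h s hs) (hD s)
  rw [this]
  refine MeasurableSet.biInter hDc fun s _ => ?_
  exact measurableSet_le measurable_const
    (measurable_coe_real_ereal.comp (measurable_subtype_coe.comp (h s s.2)))

theorem measurable_runMax {I : Set ℝ} {Ω : Type*} {m : MeasurableSpace Ω} {Y : Ω → ContPath I}
    {t : ℝ≥0} (h : ∀ s ≤ t, Measurable fun ω => (Y ω).1 s) :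
    Measurable fun ω => runMax t (Y ω) := by
  obtain ⟨D, hDc, hD⟩ := TopologicalSpace.exists_countable_dense (Iic t)
  refine measurable_of_Iic fun a => ?_
  have : (fun ω => runMax t (Y ω)) ⁻¹' Iic a =
      ⋂ s ∈ D, {ω | (((Y ω).1 (s : Iic t) : ℝ) : EReal) ≤ a} := by
    ext ω
    simp only [mem_preimage, mem_Iic, mem_iInter, mem_ofPred_eq, runMax, iSup_le_iff]
    refine ⟨fun h s _ => h s, fun h s => ?_⟩
    have hcl : IsClosed {s : Iic t | (((Y ω).1 s : ℝ) : EReal) ≤ a} :=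
      isClosed_Iic.preimage ((continuous_coordE (Y ω)).comp continuous_subtype_val)
    exact hcl.closure_subset_iff.2 (fun s hs => h s hs) (hD s)
  rw [this]
  refine MeasurableSet.biInter hDc fun s _ => ?_
  exact measurableSet_le
    (measurable_coe_real_ereal.comp (measurable_subtype_coe.comp (h s s.2))) measurable_const

theorem measurableSet_exitTime_le {I : Set ℝ} {Ω : Type*} {m : MeasurableSpace Ω}
    {Y : Ω → ContPath I} {t : ℝ≥0} (h : ∀ s ≤ t, Measurable fun ω => (Y ω).1 s)
    {A B : Ω → EReal} (hA : Measurable A) (hB : Measurable B) :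
    MeasurableSet {ω | exitTime (A ω) (B ω) (Y ω) ≤ t} := by
  simp only [exitTime_le_iff]
  exact (measurableSet_le (measurable_runMin h) hA).union
    (measurableSet_le hB (measurable_runMax h))

theorem isStoppingTime_exitTime {I : Set ℝ} {Ω : Type*} {mΩ : MeasurableSpace Ω}
    {𝓕 : Filtration ℝ≥0 mΩ} {Y : Ω → ContPath I} (hY : ∀ t, Measurable[𝓕 t] fun ω => (Y ω).1 t)
    {A B : Ω → EReal} (hA : Measurable[𝓕 0] A) (hB : Measurable[𝓕 0] B) :
    IsStoppingTime 𝓕 fun ω => exitTime (A ω) (B ω) (Y ω) := fun t =>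
  measurableSet_exitTime_le (m := 𝓕 t) (fun s hs => (hY s).mono (𝓕.mono hs) le_rfl)
    (hA.mono (𝓕.mono zero_le) le_rfl) (hB.mono (𝓕.mono zero_le) le_rfl)

theorem measurableSet_firstHit_le {I : Set ℝ} {Ω : Type*} {m : MeasurableSpace Ω}
    {Y : Ω → ContPath I} {t : ℝ≥0} (h : ∀ s ≤ t, Measurable fun ω => (Y ω).1 s) (v : I) :
    MeasurableSet {ω | firstHit {((v : ℝ) : EReal)} (Y ω) ≤ t} := by
  simp only [firstHit_singleton_le_iff]
  exact (measurableSet_le (measurable_runMin h) measurable_const).inter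
    (measurableSet_le measurable_const (measurable_runMax h))

theorem isStoppingTime_firstHit {I : Set ℝ} {Ω : Type*} {mΩ : MeasurableSpace Ω}
    {𝓕 : Filtration ℝ≥0 mΩ} {Y : Ω → ContPath I} (hY : ∀ t, Measurable[𝓕 t] fun ω => (Y ω).1 t)
    (v : I) : IsStoppingTime 𝓕 fun ω => firstHit {((v : ℝ) : EReal)} (Y ω) := fun t =>
  measurableSet_firstHit_le (m := 𝓕 t) (fun s hs => (hY s).mono (𝓕.mono hs) le_rfl) v

theorem measurable_withTop_of_le {Ω : Type*} {m : MeasurableSpace Ω} {τ : Ω → WithTop ℝ≥0}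
    (h : ∀ t : ℝ≥0, MeasurableSet {ω | τ ω ≤ t}) : Measurable τ := by
  refine measurable_of_Iic fun x => ?_
  induction x using WithTop.recTopCoe with
  | top => simp
  | coe t => exact h t

theorem measurable_coord_uncurry {I : Set ℝ} :
    Measurable fun p : ContPath I × ℝ≥0 => (p.1.1 p.2) :=
  measurable_uncurry_of_continuous_of_measurable
    (u := fun (t : ℝ≥0) (w : ContPath I) => w.1 t) (fun w => w.2) (fun t => measurable_coord t)
    |>.comp measurable_swap

theorem measurable_coord_comp {I : Set ℝ} {Ω : Type*} {m : MeasurableSpace Ω} {Y : Ω → ContPath I}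
    (hY : Measurable Y) {T : Ω → ℝ≥0} (hT : Measurable T) : Measurable fun ω => (Y ω).1 (T ω) :=
  measurable_coord_uncurry.comp (hY.prodMk hT)

theorem measurable_shift_comp {I : Set ℝ} {Ω : Type*} {m : MeasurableSpace Ω} {Y : Ω → ContPath I}
    (hY : Measurable Y) {T : Ω → ℝ≥0} (hT : Measurable T) :
    Measurable fun ω => shift (T ω) (Y ω) :=
  measurable_path fun _ => measurable_coord_comp hY (hT.add_const _)

theorem measurable_stoppedProcess {I : Set ℝ} {Ω : Type*} {m : MeasurableSpace Ω}
    {Y : Ω → ContPath I} (hY : Measurable Y) {τ : Ω → WithTop ℝ≥0} (hτ : Measurable τ) (t : ℝ≥0) :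
    Measurable (stoppedProcess (coordProcess Y) τ t) :=
  measurable_coe_real_ereal.comp (measurable_subtype_coe.comp
    (measurable_coord_comp hY (measurable_const.min hτ).untopA))

/-! ### Consequences of the strong Markov property -/

/-- The paths which visit `v`. -/
def hit {I : Set ℝ} (v : I) : Set (ContPath I) := {w | ∃ t, w.1 t = v}

@[simp] theorem untopA_coe' (t : ℝ≥0) : (t : WithTop ℝ≥0).untopA = t := rfl

theorem coordE_eq_iff {I : Set ℝ} {z v : I} :
    ((z : ℝ) : EReal) ∈ ({((v : ℝ) : EReal)} : Set EReal) ↔ z = v := by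
  rw [mem_singleton_iff, EReal.coe_eq_coe_iff, Subtype.coe_inj]

theorem firstHit_singleton_ne_top_iff {I : Set ℝ} {v : I} {w : ContPath I} :
    firstHit {((v : ℝ) : EReal)} w ≠ ⊤ ↔ w ∈ hit v := by
  rw [Ne, firstHit_eq_top_iff]
  simp only [coordE_eq_iff, not_forall, not_not]
  rfl

theorem firstHit_singleton_spec {I : Set ℝ} {v : I} {w : ContPath I} (h : w ∈ hit v) :
    ∃ s : ℝ≥0, firstHit {((v : ℝ) : EReal)} w = s ∧ w.1 s = v ∧ ∀ t < s, w.1 t ≠ v := by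
  obtain ⟨s, hs⟩ := WithTop.ne_top_iff_exists.1 (firstHit_singleton_ne_top_iff.2 h)
  refine ⟨s, hs.symm, coordE_eq_iff.1 (firstHit_mem isClosed_singleton hs.symm), fun t ht h => ?_⟩
  refine notMem_of_lt_firstHit (C := {((v : ℝ) : EReal)}) (w := w) (t := t) ?_ (coordE_eq_iff.2 h)
  rw [← hs]; exact WithTop.coe_lt_coe.2 ht

theorem firstHit_singleton_le {I : Set ℝ} {v : I} {w : ContPath I} {t : ℝ≥0} (h : w.1 t = v) :
    firstHit {((v : ℝ) : EReal)} w ≤ t := firstHit_le_of_mem (coordE_eq_iff.2 h)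

theorem measurable_firstHit {I : Set ℝ} (v : I) :
    Measurable (firstHit {((v : ℝ) : EReal)} : ContPath I → WithTop ℝ≥0) :=
  measurable_withTop_of_le fun _ =>
    measurableSet_firstHit_le (Y := id) (fun s _ => measurable_coord s) v

theorem measurableSet_hit {I : Set ℝ} (v : I) : MeasurableSet (hit v) := by
  have : hit v = (firstHit {((v : ℝ) : EReal)}) ⁻¹' {⊤}ᶜ := by
    ext w; rw [← firstHit_singleton_ne_top_iff]; rfl
  rw [this]
  exact measurable_firstHit v (measurableSet_singleton _).compl

theorem measurable_exitTime {I : Set ℝ} (a b : EReal) :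
    Measurable (exitTime a b : ContPath I → WithTop ℝ≥0) :=
  measurable_withTop_of_le fun _ =>
    measurableSet_exitTime_le (Y := id) (fun s _ => measurable_coord s)
      measurable_const measurable_const

/-- The paths which visit `b` before `a`. -/
def reach {I : Set ℝ} (b a : I) : Set (ContPath I) := {w | ∃ t, w.1 t = b ∧ ∀ s ≤ t, w.1 s ≠ a}

theorem mem_reach_iff {I : Set ℝ} {a b : I} {w : ContPath I} :
    w ∈ reach b a ↔ firstHit {((b : ℝ) : EReal)} w < firstHit {((a : ℝ) : EReal)} w := by
  constructor
  · rintro ⟨t, ht, h⟩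
    refine (firstHit_singleton_le ht).trans_lt (lt_of_not_ge fun hle => ?_)
    obtain ⟨s, hs, h'⟩ := (firstHit_le_iff isClosed_singleton).1 hle
    exact h s hs (coordE_eq_iff.1 h')
  · intro h
    obtain ⟨t, ht, htb, -⟩ := firstHit_singleton_spec (firstHit_singleton_ne_top_iff.1 h.ne_top)
    refine ⟨t, htb, fun s hs hsa => ?_⟩
    rw [ht] at h
    exact absurd ((firstHit_singleton_le hsa).trans (WithTop.coe_le_coe.2 hs)) (not_le.2 h)

theorem measurableSet_reach {I : Set ℝ} (a b : I) : MeasurableSet (reach b a) := by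
  have : reach b a = {w | firstHit {((b : ℝ) : EReal)} w < firstHit {((a : ℝ) : EReal)} w} := by
    ext w; exact mem_reach_iff
  rw [this]
  exact measurableSet_lt (measurable_firstHit b) (measurable_firstHit a)

theorem measurableSet_const_path {I : Set ℝ} (z : I) :
    MeasurableSet {w : ContPath I | ∀ t, w.1 t = z} := by
  have : {w : ContPath I | ∀ t, w.1 t = z} =
      ⋂ t ∈ range (TopologicalSpace.denseSeq ℝ≥0), {w | w.1 t = z} := by
    ext w
    simp only [mem_iInter, mem_ofPred_eq]
    refine ⟨fun h t _ => h t, fun h t => ?_⟩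
    have hcl : IsClosed {t | w.1 t = z} := isClosed_eq w.2 continuous_const
    exact hcl.closure_subset_iff.2 h (TopologicalSpace.denseRange_denseSeq ℝ≥0 t)
  rw [this]
  exact MeasurableSet.biInter (countable_range _) fun t _ =>
    measurableSet_eq_fun (measurable_coord t) measurable_const

section StrongMarkov

variable {I : Set ℝ} {Ω : Type*} {mΩ : MeasurableSpace Ω} {P : Measure Ω}
  {𝓕 : Filtration ℝ≥0 mΩ} {κ : Kernel I (ContPath I)} {Y : Ω → ContPath I}

theorem IsStrongMarkov.measurable (hY : IsStrongMarkov 𝓕 P Y κ) : Measurable Y :=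
  measurable_path fun t => (hY.1 t).mono (𝓕.le t) le_rfl

theorem IsStrongMarkov.measure_shift (hY : IsStrongMarkov 𝓕 P Y κ) {τ : Ω → WithTop ℝ≥0}
    (hτ : IsStoppingTime 𝓕 τ) {B : Set (ContPath I)} (hB : MeasurableSet B) :
    P {ω | τ ω ≠ ⊤ ∧ shift (τ ω).untopA (Y ω) ∈ B} =
      ∫⁻ ω in {ω | τ ω ≠ ⊤}, κ ((Y ω).1 (τ ω).untopA) B ∂P := by
  have := hY.2 τ hτ univ B MeasurableSet.univ hB
  simpa only [univ_inter] using this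

theorem IsStrongMarkov.measure_shift_const (hY : IsStrongMarkov 𝓕 P Y κ) (t : ℝ≥0) {A : Set Ω}
    (hA : MeasurableSet[𝓕 t] A) {B : Set (ContPath I)} (hB : MeasurableSet B) :
    P (A ∩ {ω | shift t (Y ω) ∈ B}) = ∫⁻ ω in A, κ ((Y ω).1 t) B ∂P := by
  have := hY.2 (fun _ => (t : WithTop ℝ≥0)) (isStoppingTime_const 𝓕 t) A B
    (by rw [IsStoppingTime.measurableSpace_const]; exact hA) hB
  change P (A ∩ {ω | (t : WithTop ℝ≥0) ≠ ⊤ ∧ shift t (Y ω) ∈ B}) =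
    ∫⁻ ω in A ∩ {ω | (t : WithTop ℝ≥0) ≠ ⊤}, κ ((Y ω).1 t) B ∂P at this
  have hne : (t : WithTop ℝ≥0) ≠ ⊤ := WithTop.coe_ne_top
  simpa only [hne, ne_eq, not_false_eq_true, true_and, ofPred_true, inter_univ] using this

/-- This is the Markov property at time `0`, where the shift is the identity and the state is `y`.
-/
theorem IsStrongMarkov.map_eq (hY : IsStrongMarkov 𝓕 P Y κ) [IsProbabilityMeasure P] {y : I}
    (h0 : ∀ᵐ ω ∂P, (Y ω).1 0 = y) : P.map Y = κ y := by
  ext B hB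
  have := hY.measure_shift_const 0 (A := univ) MeasurableSet.univ hB
  rw [Measure.map_apply hY.measurable hB]
  have hs : ∀ w : ContPath I, shift 0 w = w := fun w => by ext t; simp [shift_apply]
  simp only [hs, univ_inter] at this
  change P {ω | Y ω ∈ B} = _
  rw [this, setLIntegral_univ, lintegral_congr_ae (g := fun _ => κ y B)
    (h0.mono fun ω h => by simp only [h])]
  simp

/-- The strong Markov property at the first visit to `z`. -/
theorem IsStrongMarkov.measure_shift_firstHit (hY : IsStrongMarkov 𝓕 P Y κ) (z : I)
    {B : Set (ContPath I)} (hB : MeasurableSet B) :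
    P {ω | ∃ t, (Y ω).1 t = z ∧ (∀ s < t, (Y ω).1 s ≠ z) ∧ shift t (Y ω) ∈ B} =
      κ z B * P {ω | Y ω ∈ hit z} := by
  have h := hY.measure_shift (isStoppingTime_firstHit hY.1 z) hB
  simp only [firstHit_singleton_ne_top_iff] at h
  have hm : MeasurableSet {ω | Y ω ∈ hit z} := hY.measurable (measurableSet_hit z)
  -- At the first visit the state is `z`, so the kernel in the integrand is constant on the event
  -- that `z` is visited.
  rw [setLIntegral_congr_fun (g := fun _ => κ z B) hm ?_] at h
  · rw [setLIntegral_const] at h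
    rw [← h]
    congr 1
    ext ω
    constructor
    · rintro ⟨t, ht, hlt, hB⟩
      obtain ⟨s, hs, hsz, hlt'⟩ := firstHit_singleton_spec (v := z) (w := Y ω) ⟨t, ht⟩
      have : s = t := le_antisymm (not_lt.1 fun h => hlt' _ h ht) (not_lt.1 fun h => hlt _ h hsz)
      subst this
      refine ⟨⟨_, ht⟩, ?_⟩
      rwa [hs, untopA_coe']
    · rintro ⟨hz, hB⟩
      obtain ⟨s, hs, hsz, hlt'⟩ := firstHit_singleton_spec hz
      rw [hs, untopA_coe'] at hB
      exact ⟨s, hsz, hlt', hB⟩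
  · intro ω hω
    obtain ⟨s, hs, hsz, -⟩ := firstHit_singleton_spec hω
    simp only [hs, untopA_coe', hsz]

end StrongMarkov

/-! ### Hitting probabilities and exit from bounded intervals -/

section Diffusion

variable {I : Set ℝ} {κ : Kernel I (ContPath I)}

theorem mem_interior_of_lt (hI : I.OrdConnected) {a x b : I} (ha : a < x) (hb : x < b) :
    (x : ℝ) ∈ interior I :=
  mem_interior.2 ⟨Ioo a b, Ioo_subset_Icc_self.trans (hI.out a.2 b.2), isOpen_Ioo, ha, hb⟩

theorem firstVisit {w : ContPath I} {z : I} (h : w ∈ hit z) :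
    ∃ t, w.1 t = z ∧ ∀ s < t, w.1 s ≠ z :=
  let ⟨s, _, h⟩ := firstHit_singleton_spec h
  ⟨s, h⟩

theorem hit_eq_ae (hκ : IsRegularDiffusion I κ) {x z v : I} (hz : z ∈ uIcc x v) :
    κ x (hit v) = κ x {w | ∃ t, w.1 t = z ∧ (∀ s < t, w.1 s ≠ z) ∧ shift t w ∈ hit v} := by
  refine measure_congr ((hκ.start x).mono fun w h0 => propext ⟨?_, ?_⟩)
  · rintro ⟨t, ht⟩
    have h2 : z ∈ uIcc (w.1 0) (w.1 t) := by rw [h0, ht]; exact hz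
    obtain ⟨s, hs, hsz⟩ := intermediate_value_uIcc w.2.continuousOn h2
    obtain ⟨u, hu, hlt⟩ := firstVisit (w := w) ⟨s, hsz⟩
    have hut : u ≤ t := (not_lt.1 fun h => hlt _ h hsz).trans (by simpa using hs.2)
    exact ⟨u, hu, hlt, t - u, by rw [shift_apply, add_tsub_cancel_of_le hut, ht]⟩
  · rintro ⟨t, -, -, s, hs⟩
    exact ⟨_, hs⟩

/-- A continuous path from `x` to `v` passes every level `z` between them and starts afresh at its
first visit there. This multiplicativity is the source of the scale function. -/
theorem measure_hit_mul (hκ : IsRegularDiffusion I κ) {x z v : I} (hz : z ∈ uIcc x v) :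
    κ x (hit v) = κ x (hit z) * κ z (hit v) := by
  rw [hit_eq_ae hκ hz, mul_comm]
  exact (hκ.strongMarkov x).measure_shift_firstHit z (measurableSet_hit v)

theorem measure_hit_self (hκ : IsRegularDiffusion I κ) (x : I) : κ x (hit x) = 1 := by
  have := hκ.isMarkovKernel
  rw [prob_compl_eq_zero_iff (measurableSet_hit x) |>.symm]
  exact (hκ.start x).mono fun w h => ⟨0, h⟩

theorem measure_le_one (hκ : IsRegularDiffusion I κ) (x : I) (B : Set (ContPath I)) :
    κ x B ≤ 1 := by
  have := hκ.isMarkovKernel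
  exact prob_le_one

theorem measure_hit_of_notMem_interior (hκ : IsRegularDiffusion I κ) {x v : I}
    (hx : (x : ℝ) ∉ interior I) (hv : v ≠ x) : κ x (hit v) = 0 := by
  refine measure_mono_null ?_ (hκ.absorbing x hx)
  rintro w ⟨t, ht⟩ h
  exact hv (ht ▸ (h t : w.1 t = x).symm ▸ rfl)

/-- The paths which stay in `(a, b)`. -/
def stay (a b : I) : Set (ContPath I) := {w | ∀ t, w.1 t ∈ Ioo a b}

theorem coordE_mem_Ioo {z a b : I} :
    ((z : ℝ) : EReal) ∈ Ioo ((a : ℝ) : EReal) ((b : ℝ) : EReal) ↔ z ∈ Ioo a b := by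
  simp

theorem exitTime_eq_top_iff {a b : EReal} {w : ContPath I} :
    exitTime a b w = ⊤ ↔ ∀ t, ((w.1 t : ℝ) : EReal) ∈ Ioo a b := by
  rw [exitTime_eq_firstHit, firstHit_eq_top_iff]
  simp only [notMem_compl_iff]

theorem measurableSet_stay (a b : I) : MeasurableSet (stay a b) := by
  have : stay a b = exitTime ((a : ℝ) : EReal) ((b : ℝ) : EReal) ⁻¹' {⊤} := by
    ext w
    rw [mem_preimage, mem_singleton_iff, exitTime_eq_top_iff]
    simp only [coordE_mem_Ioo]
    rfl
  rw [this]
  exact measurable_exitTime _ _ (measurableSet_singleton _)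

/-- Wherever in `(a, b)` the path currently is, it leaves with probability at least some fixed `δ >
0`. Conditioning at time `n` and letting `n → ∞`, the probability `p` of staying forever satisfies
`p ≤ (1 - δ) p`, hence vanishes. -/
theorem measure_stay (hκ : IsRegularDiffusion I κ) (a b z : I) : κ z (stay a b) = 0 := by
  have := hκ.isMarkovKernel
  by_cases hx : z ∈ Ioo a b
  swap
  · exact measure_mono_null (fun w (hw : w ∈ stay a b) (h0 : w.1 0 = z) => hx (h0 ▸ hw 0))
      (hκ.start z)
  have hint := mem_interior_of_lt hκ.ordConnected hx.1 hx.2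
  set δ := min (κ z (hit a)) (κ z (hit b))
  have hδ : 0 < δ := lt_min (hκ.regular z hint a) (hκ.regular z hint b)
  have hbound : ∀ u : I, κ u (stay a b) ≤ 1 - δ := by
    intro u
    by_cases hu : u ∈ Ioo a b
    swap
    · refine (measure_mono_null (fun w (hw : w ∈ stay a b) (h0 : w.1 0 = u) => hu (h0 ▸ hw 0))
        (hκ.start u)).trans_le zero_le
    -- A path from `z` to the end point on the far side of `u` passes `u`, so that end point is at
    -- least as likely to be hit from `u` as from `z`.
    rcases le_total u z with huz | huz
    · calc κ u (stay a b) ≤ κ u (hit a)ᶜ :=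
            measure_mono fun w hw ⟨t, ht⟩ => (hw t).1.ne' ht
        _ = 1 - κ u (hit a) := prob_compl_eq_one_sub (measurableSet_hit a)
        _ ≤ 1 - δ := by
          refine tsub_le_tsub_left ((min_le_left _ _).trans ?_) _
          rw [measure_hit_mul hκ (x := z) (z := u) (v := a) (by
            rw [uIcc_of_ge hx.1.le]; exact ⟨hu.1.le, huz⟩)]
          exact mul_le_of_le_one_left zero_le (measure_le_one hκ _ _)
    · calc κ u (stay a b) ≤ κ u (hit b)ᶜ :=
            measure_mono fun w hw ⟨t, ht⟩ => (hw t).2.ne ht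
        _ = 1 - κ u (hit b) := prob_compl_eq_one_sub (measurableSet_hit b)
        _ ≤ 1 - δ := by
          refine tsub_le_tsub_left ((min_le_right _ _).trans ?_) _
          rw [measure_hit_mul hκ (x := z) (z := u) (v := b) (by
            rw [uIcc_of_le hx.2.le]; exact ⟨huz, hu.2.le⟩)]
          exact mul_le_of_le_one_left zero_le (measure_le_one hκ _ _)
  set E : ContPath I → WithTop ℝ≥0 := exitTime ((a : ℝ) : EReal) ((b : ℝ) : EReal)
  have hE : IsStoppingTime (canonicalFiltration I) E :=
    isStoppingTime_exitTime (Y := id) (hκ.strongMarkov z).1 measurable_const measurable_const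
  have hmem : ∀ w, w ∈ stay a b ↔ E w = ⊤ := fun w => by
    rw [exitTime_eq_top_iff]; simp only [coordE_mem_Ioo]; rfl
  have hn : ∀ n : ℕ, κ z (stay a b) ≤ (1 - δ) * κ z {w | (n : WithTop ℝ≥0) < E w} := by
    intro n
    have hA := hE.measurableSet_gt (n : ℝ≥0)
    have key := (hκ.strongMarkov z).measure_shift_const (n : ℝ≥0) hA (measurableSet_stay a b)
    calc κ z (stay a b) ≤ κ z ({w | ((n : ℝ≥0) : WithTop ℝ≥0) < E w} ∩
          {w | shift (n : ℝ≥0) (id w) ∈ stay a b}) := by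
          refine measure_mono fun w hw => ⟨?_, fun t => hw _⟩
          rw [mem_ofPred_eq, (hmem w).1 hw]; exact WithTop.coe_lt_top _
      _ ≤ ∫⁻ w in {w | ((n : ℝ≥0) : WithTop ℝ≥0) < E w}, (1 - δ) ∂(κ z) := by
          rw [key]; exact lintegral_mono fun w => hbound _
      _ = _ := by rw [setLIntegral_const]; rfl
  have hlim : Tendsto (fun n : ℕ => κ z {w | (n : WithTop ℝ≥0) < E w}) atTop
      (𝓝 (κ z (⋂ n : ℕ, {w | (n : WithTop ℝ≥0) < E w}))) := by
    refine tendsto_measure_iInter_atTop (fun n => ?_) ?_ ⟨0, measure_ne_top _ _⟩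
    · exact (measurableSet_lt measurable_const (measurable_exitTime _ _)).nullMeasurableSet
    · intro m n hmn w hw
      exact lt_of_le_of_lt (b := ((n : ℝ≥0) : WithTop ℝ≥0)) (by exact_mod_cast hmn) hw
  have hset : (⋂ n : ℕ, {w | (n : WithTop ℝ≥0) < E w}) = stay a b := by
    ext w
    rw [hmem, mem_iInter]
    constructor
    · intro h
      by_contra hne
      obtain ⟨s, hs⟩ := WithTop.ne_top_iff_exists.1 hne
      obtain ⟨n, hn⟩ := exists_nat_ge s
      have := h n
      rw [mem_ofPred_eq, ← hs] at this
      have h2 : (s : WithTop ℝ≥0) ≤ (n : WithTop ℝ≥0) := by exact_mod_cast hn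
      exact absurd this (not_lt.2 h2)
    · intro h n
      rw [mem_ofPred_eq, h]; exact WithTop.coe_lt_top (n : ℝ≥0)
  rw [hset] at hlim
  have hle : κ z (stay a b) ≤ (1 - δ) * κ z (stay a b) :=
    ge_of_tendsto' (ENNReal.Tendsto.const_mul hlim (Or.inr (by finiteness))) hn
  by_contra hne
  have h1 : (1 - δ) * κ z (stay a b) < 1 * κ z (stay a b) :=
    ENNReal.mul_lt_mul_left hne (measure_ne_top _ _)
      (ENNReal.sub_lt_self (by simp) (by simp) hδ.ne')
  rw [one_mul] at h1
  exact absurd hle (not_le.2 h1)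

/-- Rational points, together with a least and a greatest point if `I` has them (these may be
irrational). Null sets indexed by intervals with end points in `I` can then be united. -/
theorem exists_countable_cofinal (hI : I.OrdConnected) :
    ∃ S : Set I, S.Countable ∧ (∀ a : I, ∃ s ∈ S, s ≤ a) ∧ ∀ a : I, ∃ s ∈ S, a ≤ s := by
  refine ⟨({a | IsLeast univ a} ∪ {a | IsGreatest univ a}) ∪
    (fun a : I => (a : ℝ)) ⁻¹' (range ((↑) : ℚ → ℝ)), ?_, fun a => ?_, fun a => ?_⟩
  · exact ((Set.Subsingleton.countable fun a ha b hb => ha.unique hb).union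
      (Set.Subsingleton.countable fun a ha b hb => ha.unique hb)).union
      ((countable_range _).preimage Subtype.coe_injective)
  · by_cases h : IsLeast univ a
    · exact ⟨a, Or.inl (Or.inl h), le_rfl⟩
    · obtain ⟨c, hc⟩ : ∃ c, c < a := by
        by_contra! hn
        exact h ⟨trivial, fun c _ => hn c⟩
      obtain ⟨q, hq1, hq2⟩ := exists_rat_btwn (show (c : ℝ) < a from hc)
      exact ⟨⟨q, hI.out c.2 a.2 ⟨hq1.le, hq2.le⟩⟩, Or.inr ⟨q, rfl⟩, hq2.le⟩
  · by_cases h : IsGreatest univ a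
    · exact ⟨a, Or.inl (Or.inr h), le_rfl⟩
    · obtain ⟨c, hc⟩ : ∃ c, a < c := by
        by_contra! hn
        exact h ⟨trivial, fun c _ => hn c⟩
      obtain ⟨q, hq1, hq2⟩ := exists_rat_btwn (show (a : ℝ) < c from hc)
      exact ⟨⟨q, hI.out a.2 c.2 ⟨hq1.le, hq2.le⟩⟩, Or.inr ⟨q, rfl⟩, hq1.le⟩

/-- Almost surely, the path leaves all the intervals `(a, b)` with end points in `I` after all
times. -/
theorem IsStrongMarkov.ae_exit (hκ : IsRegularDiffusion I κ) {Ω : Type*} {mΩ : MeasurableSpace Ω}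
    {P : Measure Ω} {𝓕 : Filtration ℝ≥0 mΩ} {Y : Ω → ContPath I} (hY : IsStrongMarkov 𝓕 P Y κ) :
    ∀ᵐ ω ∂P, ∀ (a b : I) (t : ℝ≥0), ∃ s ≥ t, (Y ω).1 s ∉ Ioo a b := by
  obtain ⟨S, hS, hlo, hhi⟩ := exists_countable_cofinal hκ.ordConnected
  have h1 : ∀ᵐ ω ∂P, ∀ a ∈ S, ∀ b ∈ S, ∀ n : ℕ, shift (n : ℝ≥0) (Y ω) ∉ stay a b := by
    refine (ae_ball_iff hS).2 fun a _ => (ae_ball_iff hS).2 fun b _ => ae_all_iff.2 fun n => ?_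
    have := hY.measure_shift_const (n : ℝ≥0) (A := univ) MeasurableSet.univ
      (measurableSet_stay a b)
    simp only [univ_inter, measure_stay hκ, lintegral_zero] at this
    rw [ae_iff]
    simpa using this
  filter_upwards [h1] with ω h a b t
  obtain ⟨a', ha', haa⟩ := hlo a
  obtain ⟨b', hb', hbb⟩ := hhi b
  obtain ⟨n, hn⟩ := exists_nat_ge t
  have := h a' ha' b' hb' n
  simp only [stay, mem_ofPred_eq, not_forall] at this
  obtain ⟨s, hs⟩ := this
  exact ⟨n + s, hn.trans (le_add_of_nonneg_right zero_le),
    fun hmem => hs ⟨haa.trans_lt hmem.1, hmem.2.trans_le hbb⟩⟩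

end Diffusion

/-! ### Reflection -/

/-- The reflected interval `-I`. -/
abbrev negSet (I : Set ℝ) : Set ℝ := Neg.neg ⁻¹' I

/-- The map `z ↦ -z` from `I` to `-I`. -/
def negPt {I : Set ℝ} (z : I) : negSet I := ⟨-z, by simp⟩

/-- The map `z ↦ -z` from `-I` to `I`. -/
def unnegPt {I : Set ℝ} (z : negSet I) : I := ⟨-z, z.2⟩

@[simp] theorem coe_negPt {I : Set ℝ} (z : I) : ((negPt z : negSet I) : ℝ) = -z := rfl

@[simp] theorem coe_unnegPt {I : Set ℝ} (z : negSet I) : (unnegPt z : ℝ) = -z := rfl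

@[simp] theorem unnegPt_negPt {I : Set ℝ} (z : I) : unnegPt (negPt z) = z := Subtype.ext (neg_neg _)

@[simp] theorem negPt_unnegPt {I : Set ℝ} (z : negSet I) : negPt (unnegPt z) = z :=
  Subtype.ext (neg_neg _)

theorem negPt_eq_iff {I : Set ℝ} {z : I} {v : negSet I} : negPt z = v ↔ z = unnegPt v :=
  ⟨fun h => by rw [← h, unnegPt_negPt], fun h => by rw [h, negPt_unnegPt]⟩

theorem continuous_negPt {I : Set ℝ} : Continuous (negPt : I → negSet I) :=
  (continuous_subtype_val.neg).subtype_mk _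

theorem measurable_unnegPt {I : Set ℝ} : Measurable (unnegPt : negSet I → I) :=
  (measurable_subtype_coe.neg).subtype_mk

theorem measurable_negPt {I : Set ℝ} : Measurable (negPt : I → negSet I) :=
  (measurable_subtype_coe.neg).subtype_mk

/-- The reflected path. -/
def negPath {I : Set ℝ} (w : ContPath I) : ContPath (negSet I) :=
  ⟨fun t => negPt (w.1 t), continuous_negPt.comp w.2⟩

theorem negPath_apply {I : Set ℝ} (w : ContPath I) (t : ℝ≥0) : (negPath w).1 t = negPt (w.1 t) :=
  rfl

theorem measurable_negPath {I : Set ℝ} : Measurable (negPath : ContPath I → _) :=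
  measurable_path fun t => measurable_negPt.comp (measurable_coord t)

/-- The laws of the reflected diffusion. -/
noncomputable def negKernel {I : Set ℝ} (κ : Kernel I (ContPath I)) :
    Kernel (negSet I) (ContPath (negSet I)) :=
  (κ.comap unnegPt measurable_unnegPt).map negPath

theorem negKernel_apply {I : Set ℝ} (κ : Kernel I (ContPath I)) (z : negSet I)
    {B : Set (ContPath (negSet I))} (hB : MeasurableSet B) :
    negKernel κ z B = κ (unnegPt z) (negPath ⁻¹' B) := by
  rw [negKernel, Kernel.map_apply' _ measurable_negPath _ hB, Kernel.comap_apply]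

theorem negKernel_eq_map {I : Set ℝ} (κ : Kernel I (ContPath I)) (z : negSet I) :
    negKernel κ z = (κ (unnegPt z)).map negPath := by
  rw [negKernel, Kernel.map_apply _ measurable_negPath, Kernel.comap_apply]

theorem measurable_canonicalFiltration {I : Set ℝ} {Ω : Type*} {m : MeasurableSpace Ω}
    {Y : Ω → ContPath I} {t : ℝ≥0} (h : ∀ s ≤ t, Measurable[m] fun ω => (Y ω).1 s) :
    Measurable[m, canonicalFiltration I t] Y := by
  rw [measurable_iff_comap_le]
  simp only [canonicalFiltration, Filtration.natural, MeasurableSpace.comap_iSup, iSup_le_iff]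
  intro s hs
  rw [MeasurableSpace.comap_comp]
  -- The natural filtration is built from the Borel σ-algebra of `I`, which has to be identified
  -- with the σ-algebra that `I` carries as a subtype.
  have hb := @BorelSpace.measurable_eq I _ _ _
  refine le_trans (le_of_eq ?_) (measurable_iff_comap_le.1 (h s hs))
  rw [hb]
  rfl

/-- Reflection commutes with the shift, and neither the filtration nor its stopping times change. -/
theorem IsStrongMarkov.negPath {I : Set ℝ} {Ω : Type*} {mΩ : MeasurableSpace Ω} {P : Measure Ω}
    {𝓕 : Filtration ℝ≥0 mΩ} {κ : Kernel I (ContPath I)} {Y : Ω → ContPath I}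
    (hY : IsStrongMarkov 𝓕 P Y κ) :
    IsStrongMarkov 𝓕 P (fun ω => OptStop.negPath (Y ω)) (negKernel κ) := by
  refine ⟨fun t => measurable_negPt.comp (hY.1 t), fun τ hτ A B hA hB => ?_⟩
  have := hY.2 τ hτ A (OptStop.negPath ⁻¹' B) hA (measurable_negPath hB)
  simp only [negKernel_apply κ _ hB, negPath_apply, unnegPt_negPt]
  exact this

/-- The law of a strong Markov process satisfies the strong Markov property on path space. -/
theorem IsStrongMarkov.map_id {I : Set ℝ} {Ω : Type*} {mΩ : MeasurableSpace Ω} {P : Measure Ω}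
    {𝓕 : Filtration ℝ≥0 mΩ} {κ : Kernel I (ContPath I)} {Y : Ω → ContPath I}
    (hY : IsStrongMarkov 𝓕 P Y κ) : IsStrongMarkov (canonicalFiltration I) (P.map Y) id κ := by
  have hmeas : ∀ t, Measurable[𝓕 t, canonicalFiltration I t] Y := fun t =>
    measurable_canonicalFiltration (m := 𝓕 t) fun s hs => (hY.1 s).mono (𝓕.mono hs) le_rfl
  have hcan : ∀ t, Measurable[canonicalFiltration I t] fun w : ContPath I => w.1 t := fun t =>
    (Filtration.stronglyAdapted_natural (u := fun t (w : ContPath I) => w.1 t)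
      (fun t => (measurable_coord t).stronglyMeasurable) t).measurable
  refine ⟨hcan, fun τ hτ A B hA hB => ?_⟩
  have hτY : IsStoppingTime 𝓕 fun ω => τ (Y ω) := fun t => hmeas t (hτ t)
  have hτm : Measurable τ := measurable_withTop_of_le fun t => (canonicalFiltration I).le t _ (hτ t)
  -- Events prior to `τ` pull back along `Y` to events prior to `τ ∘ Y`.
  have hAY : MeasurableSet[hτY.measurableSpace] (Y ⁻¹' A) := by
    rw [IsStoppingTime.measurableSet] at hA ⊢
    refine ⟨?_, fun t => hmeas t (hA.2 t)⟩
    refine measurable_iff_comap_le.2 ?_ hA.1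
    rw [MeasurableSpace.comap_iSup]
    exact iSup_mono fun t => measurable_iff_comap_le.1 (hmeas t)
  have hA' : MeasurableSet A := hτ.measurableSpace_le _ hA
  have key := hY.2 _ hτY (Y ⁻¹' A) B hAY hB
  have hm1 : MeasurableSet {w | τ w ≠ ⊤} := (hτm (measurableSet_singleton ⊤)).compl
  have hT : Measurable fun w => (τ w).untopA := hτm.untopA
  have hm2 : MeasurableSet (A ∩ {w | τ w ≠ ⊤ ∧ shift (τ w).untopA (id w) ∈ B}) :=
    hA'.inter (hm1.inter (measurable_shift_comp measurable_id hT hB))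
  rw [Measure.map_apply hY.measurable hm2]
  have hmk : Measurable fun w : ContPath I => κ (w.1 (τ w).untopA) B :=
    (κ.measurable_coe hB).comp (measurable_coord_comp (Y := id) measurable_id hT)
  exact key.trans (setLIntegral_map (hA'.inter hm1) hmk hY.measurable).symm

theorem IsRegularDiffusion.negKernel {I : Set ℝ} {κ : Kernel I (ContPath I)}
    (hκ : IsRegularDiffusion I κ) : IsRegularDiffusion (negSet I) (negKernel κ) := by
  have hint : ∀ z : negSet I, (z : ℝ) ∈ interior (negSet I) ↔ (unnegPt z : ℝ) ∈ interior I := by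
    intro z
    have : interior (negSet I) = Neg.neg ⁻¹' interior I :=
      ((Homeomorph.neg ℝ).preimage_interior I).symm
    rw [this]; rfl
  have hm := hκ.isMarkovKernel
  refine ⟨hκ.ordConnected.preimage_anti fun _ _ h => neg_le_neg h, ?_, fun z => ?_, fun z => ?_,
    fun z hz v => ?_, fun z hz => ?_⟩
  · exact Kernel.IsMarkovKernel.map _ measurable_negPath
  · rw [negKernel_eq_map]
    refine (ae_map_iff measurable_negPath.aemeasurable ?_).2 ?_
    · exact measurableSet_eq_fun (measurable_coord 0) measurable_const
    · exact (hκ.start (unnegPt z)).mono fun w h => by rw [negPath_apply, negPt_eq_iff, h]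
  · rw [negKernel_eq_map]
    exact (hκ.strongMarkov (unnegPt z)).negPath.map_id
  · change 0 < OptStop.negKernel κ z (hit v)
    rw [negKernel_apply κ z (measurableSet_hit v)]
    refine (hκ.regular _ ((hint z).1 hz) (unnegPt v)).trans_le (measure_mono ?_)
    rintro w ⟨t, ht⟩
    exact ⟨t, by rw [negPath_apply, negPt_eq_iff, ht]⟩
  · rw [negKernel_eq_map]
    refine ae_map_iff measurable_negPath.aemeasurable ?_ |>.2 ?_
    · exact measurableSet_const_path z
    · exact (hκ.absorbing (unnegPt z) fun h => hz ((hint z).2 h)).mono fun w h t => by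
        rw [negPath_apply, negPt_eq_iff, h]

theorem negKernel_hit {I : Set ℝ} (κ : Kernel I (ContPath I)) (z v : I) :
    negKernel κ (negPt z) (hit (negPt v)) = κ z (hit v) := by
  rw [negKernel_apply κ _ (measurableSet_hit _), unnegPt_negPt]
  congr 1
  ext w
  simp only [hit, mem_preimage, mem_ofPred_eq, negPath_apply, negPt_eq_iff, unnegPt_negPt]

theorem negKernel_reach {I : Set ℝ} (κ : Kernel I (ContPath I)) (z a b : I) :
    negKernel κ (negPt z) (reach (negPt b) (negPt a)) = κ z (reach b a) := by
  rw [negKernel_apply κ _ (measurableSet_reach _ _), unnegPt_negPt]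
  congr 1
  ext w
  simp only [reach, mem_preimage, mem_ofPred_eq, negPath_apply, negPt_eq_iff, unnegPt_negPt, Ne]

/-! ### Visiting one level before another -/

section Diffusion

variable {I : Set ℝ} {κ : Kernel I (ContPath I)}

/-- Regularity only gives a positive chance of reaching `b` at some time, perhaps after visits to
`a`. On such a path, look just after the last visit to `a` before `b`: at some rational time it is
in `(a, x)` and from then on it reaches `b` before `a`. If that were impossible from `x`, it would
be so from all of `(a, x)`, since a path from there to `b` passes `x`; then `b` would almost surely
never be hit. -/
theorem measure_reach_pos (hκ : IsRegularDiffusion I κ) {a x b : I} (ha : a < x) (hb : x < b) :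
    0 < κ x (reach b a) := by
  rw [pos_iff_ne_zero]
  intro h0
  have hxint := mem_interior_of_lt hκ.ordConnected ha hb
  have hz : ∀ z ∈ Ioo a x, κ z (reach b a) = 0 := by
    intro z hz
    have h := (hκ.strongMarkov z).measure_shift_firstHit x (measurableSet_reach a b)
    rw [h0, zero_mul] at h
    refine measure_mono_null_ae ?_ h
    filter_upwards [hκ.start z] with w hw0
    rintro ⟨t, htb, hta⟩
    obtain ⟨s, hs, hsx⟩ := exists_mid_of_le (w := w) (v := x) (s := 0) (t := t)
      (by rw [hw0]; exact hz.2.le) (by rw [htb]; exact hb.le)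
    obtain ⟨u, hu, hlt⟩ := firstVisit (w := w) ⟨s, hsx⟩
    have hut : u ≤ t := (not_lt.1 fun h => hlt _ h hsx).trans (by simpa using hs.2)
    refine ⟨u, hu, hlt, t - u, ?_, fun r hr => hta _ ?_⟩
    · rw [shift_apply, id, add_tsub_cancel_of_le hut, htb]
    · exact (add_le_add_right hr u).trans (add_tsub_cancel_of_le hut).le
  have hq : ∀ q : ℚ, κ x ({w | w.1 (Real.toNNReal q) ∈ Ioo a x} ∩
      {w | shift (Real.toNNReal q) w ∈ reach b a}) = 0 := by
    intro q
    have h := (hκ.strongMarkov x).measure_shift_const (Real.toNNReal q)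
      ((hκ.strongMarkov x).1 _ (measurableSet_Ioo (a := a) (b := x))) (measurableSet_reach a b)
    refine h.trans ?_
    exact (setLIntegral_congr_fun (g := fun _ => 0) (measurable_coord _ measurableSet_Ioo)
      (fun w hw => hz _ hw)).trans lintegral_zero
  refine (hκ.regular x hxint b).ne' (measure_mono_null_ae (t := reach b a ∪ ⋃ q : ℚ,
    ({w | w.1 (Real.toNNReal q) ∈ Ioo a x} ∩ {w | shift (Real.toNNReal q) w ∈ reach b a})) ?_
    (measure_union_null h0 (measure_iUnion_null hq)))
  filter_upwards [hκ.start x] with w hw0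
  rintro ⟨t, htb⟩
  by_cases hne : ∀ s ≤ t, w.1 s ≠ a
  · exact Or.inl ⟨t, htb, hne⟩
  push Not at hne
  right
  obtain ⟨s₀, hs₀, hsa₀⟩ := hne
  -- The greatest element `s` of this compact set is the last visit to `a` before time `t`; after it
  -- the path stays above `a` up to `t`.
  have hcpt : IsCompact (Iic t ∩ {s | w.1 s = a}) :=
    (isCompact_Iic_nnreal t).inter_right (isClosed_eq w.2 continuous_const)
  obtain ⟨s, ⟨hst, hsa⟩, hmax⟩ := hcpt.exists_isGreatest ⟨s₀, hs₀, hsa₀⟩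
  have hst' : s < t := lt_of_le_of_ne hst fun h => (ha.trans hb).ne (by
    rw [← htb, ← h]; exact hsa.symm)
  have hgt : ∀ r, s < r → r ≤ t → a < w.1 r := by
    intro r hsr hrt
    by_contra! hle
    obtain ⟨u, hu, hua⟩ := exists_mid_of_le (w := w) (v := a) (s := r) (t := t) hle
      (by rw [htb]; exact (ha.trans hb).le)
    rw [uIcc_of_le hrt] at hu
    exact absurd (hmax ⟨hu.2, hua⟩) (not_le.2 (hsr.trans_le hu.1))
  have hev : ∀ᶠ r in 𝓝[>] s, w.1 r < x ∧ r < t := by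
    refine (((w.2.tendsto s).eventually_lt_const ?_).filter_mono nhdsWithin_le_nhds).and
      ((eventually_lt_nhds hst').filter_mono nhdsWithin_le_nhds)
    change w.1 s < x
    rw [show w.1 s = a from hsa]; exact ha
  obtain ⟨c, hc, hsub⟩ := (mem_nhdsGT_iff_exists_Ioo_subset' hst').1 hev
  obtain ⟨q, -, hq1, hq2⟩ := (NNReal.lt_iff_exists_rat_btwn _ _).1 hc
  have hqm := hsub ⟨hq1, hq2⟩
  refine mem_iUnion.2 ⟨q, ⟨hgt _ hq1 hqm.2.le, hqm.1⟩, t - Real.toNNReal q, ?_, fun r hr => ?_⟩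
  · rw [shift_apply, add_tsub_cancel_of_le hqm.2.le, htb]
  · rw [shift_apply]
    exact (hgt _ (hq1.trans_le (le_add_of_nonneg_right zero_le))
      ((add_le_add_right hr _).trans (add_tsub_cancel_of_le hqm.2.le).le)).ne'

theorem measure_reach_pos' (hκ : IsRegularDiffusion I κ) {a x b : I} (ha : a < x) (hb : x < b) :
    0 < κ x (reach a b) := by
  rw [← negKernel_reach]
  refine measure_reach_pos hκ.negKernel (a := negPt b) (b := negPt a) ?_ ?_
  · exact neg_lt_neg (show (x : ℝ) < b from hb)
  · exact neg_lt_neg (show (a : ℝ) < x from ha)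

theorem reach_disjoint {a b : I} : Disjoint (reach b a) (reach a b) := by
  rw [Set.disjoint_left]
  intro w h1 h2
  rw [mem_reach_iff] at h1 h2
  exact lt_asymm h1 h2

/-- The path leaves `(a, b)` almost surely by `measure_stay`, so one of the two end points is
visited; it cannot visit both for the first time at once. -/
theorem measure_reach_add (hκ : IsRegularDiffusion I κ) {a x b : I} (ha : a < x) (hb : x < b) :
    κ x (reach b a) + κ x (reach a b) = 1 := by
  have := hκ.isMarkovKernel
  rw [← measure_union reach_disjoint (measurableSet_reach _ _),
    ← prob_compl_eq_zero_iff ((measurableSet_reach _ _).union (measurableSet_reach _ _))]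
  change ∀ᵐ w ∂(κ x), w ∈ reach b a ∪ reach a b
  have hs := measure_stay hκ a b x
  have hs' : ∀ᵐ w ∂(κ x), w ∉ stay a b := measure_eq_zero_iff_ae_notMem.1 hs
  filter_upwards [hs', hκ.start x] with w hw h0
  simp only [stay, mem_ofPred_eq, not_forall] at hw
  obtain ⟨t, ht⟩ := hw
  rw [mem_union, mem_reach_iff, mem_reach_iff]
  have hab : a ≠ b := (ha.trans hb).ne
  have hor : w ∈ hit a ∨ w ∈ hit b := by
    rw [mem_Ioo, not_and_or, not_lt, not_lt] at ht
    rcases ht with ht | ht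
    · obtain ⟨u, -, hu⟩ := exists_mid_of_le (w := w) (v := a) (s := t) (t := 0) ht
        (by rw [h0]; exact ha.le)
      exact Or.inl ⟨u, hu⟩
    · obtain ⟨u, -, hu⟩ := exists_mid_of_le (w := w) (v := b) (s := 0) (t := t)
        (by rw [h0]; exact hb.le) ht
      exact Or.inr ⟨u, hu⟩
  refine lt_or_gt_of_ne fun heq => hab ?_
  rcases hor with h | h
  · obtain ⟨s, hs, hsa, -⟩ := firstHit_singleton_spec h
    exact hsa.symm.trans (coordE_eq_iff.1 (firstHit_mem isClosed_singleton (heq.trans hs)))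
  · obtain ⟨s, hs, hsa, -⟩ := firstHit_singleton_spec h
    exact (coordE_eq_iff.1 (firstHit_mem isClosed_singleton (heq.symm.trans hs))).symm.trans hsa

theorem exitTime_spec {a x b : I} (ha : a < x) (hb : x < b) {w : ContPath I} (h0 : w.1 0 = x)
    {s : ℝ≥0} (hs : exitTime ((a : ℝ) : EReal) ((b : ℝ) : EReal) w = s) :
    (w.1 s = b ∧ w ∈ reach b a) ∨ (w.1 s = a ∧ w ∈ reach a b) := by
  have hlt : ∀ t < s, w.1 t ∈ Ioo a b := fun t ht => by
    by_contra hn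
    have := firstHit_le_of_mem (C := (Ioo ((a : ℝ) : EReal) ((b : ℝ) : EReal))ᶜ) (w := w) (t := t)
      (fun h => hn (coordE_mem_Ioo.1 h))
    rw [← exitTime_eq_firstHit, hs] at this
    exact absurd ht (not_lt.2 (WithTop.coe_le_coe.1 this))
  have hmem : w.1 s ∉ Ioo a b := fun h =>
    firstHit_mem (C := (Ioo ((a : ℝ) : EReal) ((b : ℝ) : EReal))ᶜ) isOpen_Ioo.isClosed_compl hs
      (coordE_mem_Ioo.2 h)
  have hab := ha.trans hb
  rw [mem_Ioo, not_and_or, not_lt, not_lt] at hmem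
  rcases hmem with h | h
  · obtain ⟨u, hu, hua⟩ := exists_mid_of_le (w := w) (v := a) (s := s) (t := 0) h
      (by rw [h0]; exact ha.le)
    have hus : u = s := le_antisymm (by simpa using hu.2)
      (not_lt.1 fun hlt' => (hlt u hlt').1.ne' hua)
    subst hus
    refine Or.inr ⟨hua, u, hua, fun t ht htb => ?_⟩
    rcases ht.lt_or_eq with ht | rfl
    · exact (hlt t ht).2.ne htb
    · exact hab.ne (hua.symm.trans htb)
  · obtain ⟨u, hu, hua⟩ := exists_mid_of_le (w := w) (v := b) (s := 0) (t := s)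
      (by rw [h0]; exact hb.le) h
    have hus : u = s := le_antisymm (by simpa using hu.2)
      (not_lt.1 fun hlt' => (hlt u hlt').2.ne hua)
    subst hus
    refine Or.inl ⟨hua, u, hua, fun t ht htb => ?_⟩
    rcases ht.lt_or_eq with ht | rfl
    · exact (hlt t ht).1.ne' htb
    · exact hab.ne' (hua.symm.trans htb)

/-- The strong Markov property at the exit from `(a, b)`: either `b` has been reached already, or
the path starts anew from `a`. -/
theorem measure_hit_eq_add (hκ : IsRegularDiffusion I κ) {a x b : I} (ha : a < x) (hb : x < b) :
    κ x (hit b) = κ x (reach b a) + κ x (reach a b) * κ a (hit b) := by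
  set E : ContPath I → WithTop ℝ≥0 := exitTime ((a : ℝ) : EReal) ((b : ℝ) : EReal) with hE
  have hEs : IsStoppingTime (canonicalFiltration I) E :=
    isStoppingTime_exitTime (Y := id) (hκ.strongMarkov x).1 measurable_const measurable_const
  have hm : MeasurableSet {w | E w ≠ ⊤} :=
    (measurable_exitTime _ _ (measurableSet_singleton ⊤)).compl
  have key := (hκ.strongMarkov x).measure_shift hEs (measurableSet_hit b)
  have htop : ∀ w, w ∈ hit b → E w ≠ ⊤ := fun w ⟨t, ht⟩ h =>
    (coordE_mem_Ioo.1 (exitTime_eq_top_iff.1 h t)).2.ne ht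
  have htop' : ∀ w, w ∈ hit a → E w ≠ ⊤ := fun w ⟨t, ht⟩ h =>
    (coordE_mem_Ioo.1 (exitTime_eq_top_iff.1 h t)).1.ne' ht
  have h1 : κ x (hit b) = κ x {w | E w ≠ ⊤ ∧ shift (E w).untopA (id w) ∈ hit b} := by
    refine measure_congr ((hκ.start x).mono fun w h0 => propext ⟨fun hw => ?_, ?_⟩)
    · obtain ⟨s, hs⟩ := WithTop.ne_top_iff_exists.1 (htop w hw)
      refine ⟨htop w hw, ?_⟩
      obtain ⟨t, ht⟩ := hw
      have hst : s ≤ t := by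
        have : E w ≤ t := firstHit_le_of_mem (fun h => (coordE_mem_Ioo.1 h).2.ne ht)
        rw [← hs] at this
        exact WithTop.coe_le_coe.1 this
      rw [← hs, untopA_coe']
      exact ⟨t - s, by rw [shift_apply, add_tsub_cancel_of_le hst]; exact ht⟩
    · rintro ⟨-, t, ht⟩
      exact ⟨_, ht⟩
  rw [h1, key, ← lintegral_indicator hm]
  calc ∫⁻ w, {w | E w ≠ ⊤}.indicator (fun w => κ ((id w).1 (E w).untopA) (hit b)) w ∂(κ x)
      = ∫⁻ w, ((reach b a).indicator (fun _ => 1) w +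
          (reach a b).indicator (fun _ => κ a (hit b)) w) ∂(κ x) := by
        refine lintegral_congr_ae ((hκ.start x).mono fun w h0 => ?_)
        by_cases hw : E w = ⊤
        · have hb' : w ∉ reach b a := fun ⟨t, ht, _⟩ => htop w ⟨t, ht⟩ hw
          have ha' : w ∉ reach a b := fun ⟨t, ht, _⟩ => htop' w ⟨t, ht⟩ hw
          simp [hw, hb', ha']
        · obtain ⟨s, hs⟩ := WithTop.ne_top_iff_exists.1 hw
          have hmem : w ∈ {w | E w ≠ ⊤} := hw
          simp only [indicator_of_mem hmem, ← hs, untopA_coe', id]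
          rcases exitTime_spec ha hb h0 hs.symm with ⟨h, hr⟩ | ⟨h, hr⟩
          · rw [indicator_of_mem hr, indicator_of_notMem (reach_disjoint.notMem_of_mem_left hr), h,
              measure_hit_self hκ, add_zero]
          · rw [indicator_of_mem hr, indicator_of_notMem
              (reach_disjoint.symm.notMem_of_mem_left hr), h, zero_add]
    _ = _ := by
        rw [lintegral_add_left (measurable_const.indicator (measurableSet_reach _ _)),
          lintegral_indicator_const (measurableSet_reach _ _),
          lintegral_indicator_const (measurableSet_reach _ _), one_mul, mul_comm (κ a (hit b))]

/-! ### The dichotomy between recurrence and transience in one direction -/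

/-- The equation `H = A + (1 - A) H` reads `A (H - 1) = 0`. It is the step by which a repeated trial
with positive chance of success succeeds almost surely. -/
theorem eq_one_of_eq_add_mul {A B H : ℝ≥0∞} (hadd : A + B = 1) (hA : 0 < A) (hH : H ≤ 1)
    (h : H = A + B * H) : H = 1 := by
  have hAt : A ≠ ⊤ := ne_top_of_le_ne_top ENNReal.one_ne_top (hadd ▸ le_self_add)
  have hBt : B ≠ ⊤ := ne_top_of_le_ne_top ENNReal.one_ne_top (hadd ▸ le_add_self)
  have hHt : H ≠ ⊤ := ne_top_of_le_ne_top ENNReal.one_ne_top hH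
  lift A to ℝ≥0 using hAt
  lift B to ℝ≥0 using hBt
  lift H to ℝ≥0 using hHt
  norm_cast at *
  have e1 : (A : ℝ) + B = 1 := by exact_mod_cast hadd
  have e2 : (H : ℝ) = A + B * H := by exact_mod_cast h
  have e3 : (0 : ℝ) < A := by exact_mod_cast hA
  have : (A : ℝ) * (H - 1) = 0 := by
    have : (B : ℝ) = 1 - A := by linarith
    rw [this] at e2; linarith
  have : (H : ℝ) = 1 := by
    rcases mul_eq_zero.1 this with h | h <;> linarith
  exact_mod_cast this

/-- If some higher level is missed with positive probability, from some interior point, then all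
higher levels are missed with positive probability, from all points. -/
theorem measure_hit_lt_one (hκ : IsRegularDiffusion I κ) {x v : I}
    (hxv : x < v) (h : κ x (hit v) < 1) {a b : I} (hab : a < b) : κ a (hit b) < 1 := by
  have hle := measure_le_one hκ
  refine lt_of_le_of_ne (hle _ _) fun h1 => h.ne ?_
  have hmul : ∀ {p q r : I}, p ≤ q → q ≤ r → κ p (hit r) = κ p (hit q) * κ q (hit r) :=
    fun {p q r} hpq hqr => measure_hit_mul hκ (by rw [uIcc_of_le (hpq.trans hqr)]; exact ⟨hpq, hqr⟩)
  -- If `q` is surely reached from `p`, then from `q` the path reaches `r` before `p` with positive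
  -- probability, and otherwise returns from `p` to `q` and tries again.
  have hup : ∀ {p q r : I}, p < q → q < r → κ p (hit q) = 1 → κ q (hit r) = 1 := by
    intro p q r hpq hqr hp
    have hadd := measure_reach_add hκ hpq hqr
    have heq := measure_hit_eq_add hκ hpq hqr
    rw [hmul hpq.le hqr.le, hp, one_mul] at heq
    have hpos := measure_reach_pos hκ hpq hqr
    exact eq_one_of_eq_add_mul hadd hpos (hle _ _) heq
  -- From `q` the path visits `p` before `r` with positive probability, so missing `r` from `p`
  -- would mean missing it from `q` as well.
  have hdown : ∀ {p q r : I}, p < q → q < r → κ q (hit r) = 1 → κ p (hit r) = 1 := by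
    intro p q r hpq hqr hq
    have hadd := measure_reach_add hκ hpq hqr
    have heq := measure_hit_eq_add hκ hpq hqr
    have hpos := measure_reach_pos' hκ hpq hqr
    rw [hq] at heq
    by_contra hne
    have hlt : κ p (hit r) < 1 := lt_of_le_of_ne (hle _ _) hne
    have : κ q (reach r p) + κ q (reach p r) * κ p (hit r) <
        κ q (reach r p) + κ q (reach p r) * 1 :=
      ENNReal.add_lt_add_left (ne_top_of_le_ne_top ENNReal.one_ne_top (hle _ _))
        (ENNReal.mul_lt_mul_right hpos.ne'
          (ne_top_of_le_ne_top ENNReal.one_ne_top (hle _ _)) hlt)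
    rw [mul_one, hadd, ← heq] at this
    exact lt_irrefl _ this
  have haint : (a : ℝ) ∈ interior I := by
    by_contra hn
    rw [measure_hit_of_notMem_interior hκ hn hab.ne'] at h1
    exact zero_ne_one h1
  -- A level above both `b` and `v` which is surely reached from `a`. Sure passage to `m` is then
  -- moved from `a` to `x`, and the path from `x` to `m` has to cross `v`.
  obtain ⟨m, hm, hvm, h1m⟩ : ∃ m, b ≤ m ∧ v ≤ m ∧ κ a (hit m) = 1 := by
    rcases le_or_gt v b with hvb | hvb
    · exact ⟨b, le_rfl, hvb, h1⟩
    · exact ⟨v, hvb.le, le_rfl, by rw [hmul hab.le hvb.le, h1, hup hab hvb h1, one_mul]⟩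
  have ham := hab.trans_le hm
  have hxm : κ x (hit m) = 1 := by
    rcases lt_trichotomy x a with hxa | rfl | hxa
    · exact hdown hxa ham h1m
    · exact h1m
    · rw [hmul hxa.le (hxv.le.trans hvm)] at h1m
      exact le_antisymm (hle _ _) (h1m.symm.le.trans (mul_le_of_le_one_left zero_le (hle _ _)))
  rw [hmul hxv.le hvm] at hxm
  exact le_antisymm (hle _ _) (hxm.symm.le.trans (mul_le_of_le_one_right zero_le (hle _ _)))

end Diffusion

/-! ### Stopped values -/

section StoppedAt

variable {I : Set ℝ} {Ω : Type*} {mΩ : MeasurableSpace Ω} {P : Measure Ω}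
  {𝓕 : Filtration ℝ≥0 mΩ} {Y : Ω → ContPath I} {τ : Ω → WithTop ℝ≥0} {ω : Ω}

theorem stoppedProcess_of_eq_coe {s : ℝ≥0} (h : τ ω = s) (t : ℝ≥0) :
    stoppedProcess (coordProcess Y) τ t ω = (((Y ω).1 (min t s) : ℝ) : EReal) := by
  simp only [stoppedProcess, h, coordProcess]
  rw [← WithTop.coe_min, untopA_coe']

theorem stoppedProcess_of_eq_top (h : τ ω = ⊤) (t : ℝ≥0) :
    stoppedProcess (coordProcess Y) τ t ω = (((Y ω).1 t : ℝ) : EReal) := by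
  simp only [stoppedProcess, h, coordProcess]
  rw [min_top_right, untopA_coe']

theorem tendsto_stoppedProcess_of_eq_coe {s : ℝ≥0} (h : τ ω = s) :
    Tendsto (fun t => stoppedProcess (coordProcess Y) τ t ω) atTop
      (𝓝 (((Y ω).1 s : ℝ) : EReal)) := by
  refine tendsto_const_nhds.congr' ((eventually_ge_atTop s).mono fun t ht => ?_)
  simp only [stoppedProcess_of_eq_coe h, min_eq_right ht]

theorem stoppedAt_of_eq_coe {s : ℝ≥0} (h : τ ω = s) :
    stoppedAt Y τ ω = (((Y ω).1 s : ℝ) : EReal) :=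
  (tendsto_stoppedProcess_of_eq_coe h).limsup_eq

theorem tendsto_stoppedProcess_iff_of_eq_top (h : τ ω = ⊤) {l : EReal} :
    Tendsto (fun t => stoppedProcess (coordProcess Y) τ t ω) atTop (𝓝 l) ↔
      Tendsto (fun t => (((Y ω).1 t : ℝ) : EReal)) atTop (𝓝 l) := by
  simp only [stoppedProcess_of_eq_top h]

theorem stoppedAt_of_eq_top (h : τ ω = ⊤) {l : EReal}
    (hl : Tendsto (fun t => (((Y ω).1 t : ℝ) : EReal)) atTop (𝓝 l)) : stoppedAt Y τ ω = l :=
  ((tendsto_stoppedProcess_iff_of_eq_top h).2 hl).limsup_eq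

theorem measurable_of_isStoppingTime (hτ : IsStoppingTime 𝓕 τ) : Measurable τ :=
  measurable_withTop_of_le fun t => 𝓕.le t _ (hτ t)

theorem tendsto_natCast_nnreal : Tendsto (fun n : ℕ => (n : ℝ≥0)) atTop atTop :=
  tendsto_natCast_atTop_atTop

theorem tendsto_stoppedAt (h : τ ∈ allRules 𝓕 P Y) :
    ∀ᵐ ω ∂P, Tendsto (fun t => stoppedProcess (coordProcess Y) τ t ω) atTop
      (𝓝 (stoppedAt Y τ ω)) := by
  filter_upwards [h.2] with ω ⟨l, hl⟩
  rw [stoppedAt, hl.limsup_eq]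
  exact hl

/-- The upper limit runs over uncountably many times; the one along the integers is measurable and
agrees wherever the limit exists. -/
theorem aemeasurable_stoppedAt (hY : Measurable Y) (h : τ ∈ allRules 𝓕 P Y) :
    AEMeasurable (stoppedAt Y τ) P := by
  refine ⟨fun ω => limsup (fun n : ℕ => stoppedProcess (coordProcess Y) τ (n : ℝ≥0) ω) atTop,
    Measurable.limsup fun n => measurable_stoppedProcess hY (measurable_of_isStoppingTime h.1) n,
    ?_⟩
  filter_upwards [tendsto_stoppedAt h] with ω hω
  exact (hω.comp tendsto_natCast_nnreal).limsup_eq.symm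

theorem stoppedAt_mem_closedRange (h : τ ∈ allRules 𝓕 P Y) :
    ∀ᵐ ω ∂P, stoppedAt Y τ ω ∈ closedRange I := by
  filter_upwards [tendsto_stoppedAt h] with ω hω
  refine isClosed_closure.mem_of_tendsto hω (Eventually.of_forall fun t => subset_closure ?_)
  exact ⟨_, Subtype.coe_prop _, rfl⟩

end StoppedAt

/-! ### Transience -/

section Diffusion

variable {I : Set ℝ} {κ : Kernel I (ContPath I)}

/-- The paths which visit both `c` and `d` at arbitrarily large times. -/
def recur (c d : I) : Set (ContPath I) :=
  {w | ∀ n : ℕ, shift (n : ℝ≥0) w ∈ hit c ∧ shift (n : ℝ≥0) w ∈ hit d}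

theorem measurableSet_recur (c d : I) : MeasurableSet (recur c d) := by
  simp only [recur, ofPred_forall]
  refine MeasurableSet.iInter fun n => ?_
  have hm : Measurable fun w : ContPath I => shift (n : ℝ≥0) w :=
    measurable_shift_comp measurable_id measurable_const
  exact (hm (measurableSet_hit c)).inter (hm (measurableSet_hit d))

theorem shift_mem_recur {c d : I} {w : ContPath I} (hw : w ∈ recur c d) (s : ℝ≥0) :
    shift s w ∈ recur c d := by
  intro n
  obtain ⟨m, hm⟩ := exists_nat_ge (s + n)
  obtain ⟨⟨t, ht⟩, ⟨u, hu⟩⟩ := hw m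
  refine ⟨⟨m - (s + n) + t, ?_⟩, ⟨m - (s + n) + u, ?_⟩⟩
  · rw [shift_apply, shift_apply, ← add_assoc, ← add_assoc, add_tsub_cancel_of_le hm]
    exact ht
  · rw [shift_apply, shift_apply, ← add_assoc, ← add_assoc, add_tsub_cancel_of_le hm]
    exact hu

/-- Let `q_z` be the probability from `z` of visiting both levels at arbitrarily large times.
Restarting at the first visit to `d`, then to `c`, gives `q_c ≤ P^c(hit d) q_d` and `q_d ≤ q_c`.
Hence `q_c ≤ P^c(hit d) q_c` forces `q_c = 0`, and any other start first has to visit `c`. -/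
theorem measure_recur (hκ : IsRegularDiffusion I κ) {c d : I} (h : κ c (hit d) < 1) (x : I) :
    κ x (recur c d) = 0 := by
  have := hκ.isMarkovKernel
  have hle : ∀ x z : I, (z = c ∨ z = d) →
      κ x (recur c d) ≤ κ z (recur c d) * κ x (hit z) := by
    intro x z hz
    refine le_trans (measure_mono fun w hw => ?_)
      ((hκ.strongMarkov x).measure_shift_firstHit z (measurableSet_recur c d)).le
    have hzw : w ∈ hit z := by
      obtain ⟨⟨t, ht⟩, ⟨u, hu⟩⟩ := hw 0
      rcases hz with rfl | rfl
      · exact ⟨_, ht⟩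
      · exact ⟨_, hu⟩
    obtain ⟨t, ht, hlt⟩ := firstVisit hzw
    exact ⟨t, ht, hlt, shift_mem_recur hw t⟩
  have hc : κ c (recur c d) ≤ κ c (recur c d) * κ c (hit d) :=
    calc κ c (recur c d) ≤ κ d (recur c d) * κ c (hit d) := hle c d (Or.inr rfl)
      _ ≤ _ := mul_le_mul_left ((hle d c (Or.inl rfl)).trans
          (mul_le_of_le_one_right zero_le (measure_le_one hκ _ _))) _
  have hc0 : κ c (recur c d) = 0 := by
    by_contra hne
    have h1 := ENNReal.mul_lt_mul_right hne (measure_ne_top _ _) h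
    rw [mul_one] at h1
    exact absurd hc (not_le.2 h1)
  have := hle x c (Or.inl rfl)
  rwa [hc0, zero_mul, nonpos_iff_eq_zero] at this

/-- The almost sure properties of the paths of a transient diffusion. -/
structure IsTransientPath (w : ContPath I) : Prop where
  exit : ∀ (a b : I) (t : ℝ≥0), ∃ s ≥ t, w.1 s ∉ Ioo a b
  conv : ∃ l : EReal, Tendsto (fun t => ((w.1 t : ℝ) : EReal)) atTop (𝓝 l)
  absorb : ∀ e : I, (e : ℝ) ∉ interior I → ∀ t, w.1 t = e → ∀ s ≥ t, w.1 s = e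

theorem dense_ratCast_ereal : Dense (range fun q : ℚ => ((q : ℝ) : EReal)) :=
  dense_of_exists_between fun _ _ hab =>
    let ⟨q, h1, h2⟩ := EReal.lt_iff_exists_rat_btwn.1 hab
    ⟨_, ⟨q, rfl⟩, h1, h2⟩

/-- Points of `I` outside the interior are least or greatest, so there are only countably many null
sets; each comes from the strong Markov property at the first visit. -/
theorem absorb_ae (hκ : IsRegularDiffusion I κ) {Ω : Type*} {mΩ : MeasurableSpace Ω}
    {P : Measure Ω} {𝓕 : Filtration ℝ≥0 mΩ} {Y : Ω → ContPath I} (hY : IsStrongMarkov 𝓕 P Y κ) :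
    ∀ᵐ ω ∂P, ∀ e : I, (e : ℝ) ∉ interior I → ∀ t, (Y ω).1 t = e → ∀ s ≥ t, (Y ω).1 s = e := by
  have hc : {e : I | (e : ℝ) ∉ interior I}.Countable := by
    have : {e : I | (e : ℝ) ∉ interior I} ⊆ {a | IsLeast univ a} ∪ {a | IsGreatest univ a} := by
      intro e he
      by_contra hn
      rw [mem_union, not_or] at hn
      obtain ⟨a, ha⟩ : ∃ a, a < e := by
        by_contra! h
        exact hn.1 ⟨trivial, fun c _ => h c⟩
      obtain ⟨b, hb⟩ : ∃ b, e < b := by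
        by_contra! h
        exact hn.2 ⟨trivial, fun c _ => h c⟩
      exact he (mem_interior_of_lt hκ.ordConnected ha hb)
    exact ((Set.Subsingleton.countable fun a ha b hb => ha.unique hb).union
      (Set.Subsingleton.countable fun a ha b hb => ha.unique hb)).mono this
  refine (ae_ball_iff hc).2 fun e he => ?_
  have h := hY.measure_shift_firstHit e (measurableSet_const_path e).compl
  have h0 : κ e {w : ContPath I | ∀ t, w.1 t = e}ᶜ = 0 := hκ.absorbing e he
  rw [h0, zero_mul] at h
  filter_upwards [measure_eq_zero_iff_ae_notMem.1 h] with ω hω t ht s hs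
  obtain ⟨u, hu, hlt⟩ := firstVisit (w := Y ω) ⟨t, ht⟩
  have hut : u ≤ t := not_lt.1 fun h => hlt t h ht
  by_contra hne
  refine hω ⟨u, hu, hlt, fun hall => hne ?_⟩
  have := hall (s - u)
  rwa [shift_apply, add_tsub_cancel_of_le (hut.trans hs)] at this

/-- Infinitely many crossings between two rational levels would put the path in `recur` for these
levels, a null event; a path without such crossings converges in `[-∞, ∞]`. -/
theorem IsStrongMarkov.ae_isTransientPath (hκ : IsRegularDiffusion I κ)
    (hT : ∀ a b : I, a < b → κ a (hit b) < 1) {Ω : Type*} {mΩ : MeasurableSpace Ω}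
    {P : Measure Ω} {𝓕 : Filtration ℝ≥0 mΩ} {Y : Ω → ContPath I} (hY : IsStrongMarkov 𝓕 P Y κ) :
    ∀ᵐ ω ∂P, IsTransientPath (Y ω) := by
  have hJ : ∀ᵐ ω ∂P, ∀ p : ℚ × ℚ, ∀ c d : I, (c : ℝ) = p.1 → (d : ℝ) = p.2 → c < d →
      Y ω ∉ recur c d := by
    refine ae_all_iff.2 fun p => ?_
    by_cases hp : ∃ c d : I, (c : ℝ) = p.1 ∧ (d : ℝ) = p.2 ∧ c < d
    · obtain ⟨c, d, hc, hd, hcd⟩ := hp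
      have h := hY.measure_shift_const 0 (A := univ) MeasurableSet.univ (measurableSet_recur c d)
      simp only [univ_inter, measure_recur hκ (hT c d hcd), lintegral_zero] at h
      filter_upwards [measure_eq_zero_iff_ae_notMem.1 h] with ω hω c' d' hc' hd' _ hmem
      obtain rfl : c' = c := Subtype.ext (hc'.trans hc.symm)
      obtain rfl : d' = d := Subtype.ext (hd'.trans hd.symm)
      exact hω (shift_mem_recur hmem 0)
    · exact Eventually.of_forall fun ω c d hc hd hcd => absurd ⟨c, d, hc, hd, hcd⟩ hp
  filter_upwards [hY.ae_exit hκ, absorb_ae hκ hY, hJ] with ω h1 h2 h3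
  refine ⟨h1, ?_, h2⟩
  refine tendsto_of_no_upcrossings dense_ratCast_ereal ?_
  rintro _ ⟨p, rfl⟩ _ ⟨q, rfl⟩ hpq ⟨hf1, hf2⟩
  simp only [EReal.coe_lt_coe_iff] at hpq hf1 hf2
  obtain ⟨s, hs⟩ := hf1.exists
  obtain ⟨t, ht⟩ := hf2.exists
  have hI := hκ.ordConnected.out ((Y ω).1 s).2 ((Y ω).1 t).2
  refine h3 (p, q) ⟨p, hI ⟨hs.le, (hpq.trans ht).le⟩⟩ ⟨q, hI ⟨(hs.trans hpq).le, ht.le⟩⟩ rfl rfl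
    hpq fun n => ?_
  obtain ⟨s', hs', hs2⟩ := (frequently_atTop.1 hf1) (n : ℝ≥0)
  obtain ⟨t', ht', ht2⟩ := (frequently_atTop.1 hf2) (n : ℝ≥0)
  have hmin : (n : ℝ≥0) ≤ min s' t' := le_min hs' ht'
  refine ⟨?_, ?_⟩
  · obtain ⟨u, hu, huv⟩ := exists_mid_of_le (w := Y ω) (v := ⟨p, hI ⟨hs.le, (hpq.trans ht).le⟩⟩)
      (s := s') (t := t') hs2.le (hpq.trans ht2).le
    exact ⟨u - n, by rw [shift_apply, add_tsub_cancel_of_le (hmin.trans hu.1), huv]⟩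
  · obtain ⟨u, hu, huv⟩ := exists_mid_of_le (w := Y ω) (v := ⟨q, hI ⟨(hs.trans hpq).le, ht.le⟩⟩)
      (s := s') (t := t') (hs2.trans hpq).le ht2.le
    exact ⟨u - n, by rw [shift_apply, add_tsub_cancel_of_le (hmin.trans hu.1), huv]⟩

/-- The paths which reach the level `v` or a higher one. -/
def above (v : I) : Set (ContPath I) := {w | ∃ t, v ≤ w.1 t}

theorem measurableSet_above (v : I) : MeasurableSet (above v) := by
  have : above v = ⋃ n : ℕ, {w | ((v : ℝ) : EReal) ≤ runMax (n : ℝ≥0) w} := by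
    ext w
    simp only [above, mem_iUnion, mem_ofPred_eq, le_runMax_iff, EReal.coe_le_coe_iff]
    constructor
    · rintro ⟨t, ht⟩
      obtain ⟨n, hn⟩ := exists_nat_ge t
      exact ⟨n, t, hn, ht⟩
    · rintro ⟨n, t, -, ht⟩
      exact ⟨t, ht⟩
  rw [this]
  exact MeasurableSet.iUnion fun n => measurableSet_le measurable_const
    (measurable_runMax (Y := id) fun s _ => measurable_coord s)

theorem measure_above_of_le (hκ : IsRegularDiffusion I κ) {z v : I} (h : v ≤ z) :
    κ z (above v) = 1 := by
  have := hκ.isMarkovKernel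
  rw [← prob_compl_eq_zero_iff (measurableSet_above v)]
  exact (hκ.start z).mono fun w hw => ⟨0, by rw [hw]; exact h⟩

theorem measure_above_of_ge (hκ : IsRegularDiffusion I κ) {z v : I} (h : z ≤ v) :
    κ z (above v) = κ z (hit v) := by
  refine measure_congr ((hκ.start z).mono fun w hw => propext ⟨?_, ?_⟩)
  · rintro ⟨t, ht⟩
    obtain ⟨u, -, hu⟩ := exists_mid_of_le (w := w) (v := v) (s := 0) (t := t)
      (by rw [hw]; exact h) ht
    exact ⟨u, hu⟩
  · rintro ⟨t, ht⟩
    exact ⟨t, ht.ge⟩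

/-- A limit strictly between two points of `I` would trap the path between them from some time on,
although it leaves every such interval at arbitrarily late times. -/
theorem IsTransientPath.limit_dichotomy {w : ContPath I} (hw : IsTransientPath w) {l : EReal}
    (hl : Tendsto (fun t => ((w.1 t : ℝ) : EReal)) atTop (𝓝 l)) :
    (∀ v : I, ((v : ℝ) : EReal) ≤ l) ∨ ∀ v : I, l ≤ ((v : ℝ) : EReal) := by
  by_contra! h
  obtain ⟨⟨b, hb⟩, ⟨a, ha⟩⟩ := h
  obtain ⟨T, hT⟩ := eventually_atTop.1 (hl.eventually (Ioo_mem_nhds ha hb))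
  obtain ⟨s, hs, hn⟩ := hw.exit a b T
  exact hn (coordE_mem_Ioo.1 (hT s hs))

/-- The path is finally above `a`, so when it is outside `(a, v)` again it must be at `v` or higher.
-/
theorem IsTransientPath.mem_above {w : ContPath I} (hw : IsTransientPath w) {l : EReal}
    (hl : Tendsto (fun t => ((w.1 t : ℝ) : EReal)) atTop (𝓝 l)) {a : I}
    (ha : ((a : ℝ) : EReal) < l) (v : I) (t : ℝ≥0) : ∃ s ≥ t, v ≤ w.1 s := by
  obtain ⟨T, hT⟩ := eventually_atTop.1 (hl.eventually (eventually_gt_nhds ha))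
  obtain ⟨s, hs, hn⟩ := hw.exit a v (max T t)
  have := hT s ((le_max_left _ _).trans hs)
  rw [EReal.coe_lt_coe_iff] at this
  exact ⟨s, (le_max_right _ _).trans hs, not_lt.1 fun h => hn ⟨this, h⟩⟩

end Diffusion

/-! ### The value at the exit from an interval -/

theorem exists_lt_of_mem_interior {I : Set ℝ} {x : I} (hx : (x : ℝ) ∈ interior I) :
    ∃ a : I, a < x := by
  obtain ⟨a, ha, hlt⟩ := ((mem_interior_iff_mem_nhds.1 hx |> fun h =>
    (Filter.Eventually.filter_mono nhdsWithin_le_nhds h : ∀ᶠ z in 𝓝[<] (x : ℝ), z ∈ I)).and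
      self_mem_nhdsWithin).exists
  exact ⟨⟨a, ha⟩, hlt⟩

theorem exists_gt_of_mem_interior {I : Set ℝ} {x : I} (hx : (x : ℝ) ∈ interior I) :
    ∃ a : I, x < a := by
  obtain ⟨a, ha, hlt⟩ := ((mem_interior_iff_mem_nhds.1 hx |> fun h =>
    (Filter.Eventually.filter_mono nhdsWithin_le_nhds h : ∀ᶠ z in 𝓝[>] (x : ℝ), z ∈ I)).and
      self_mem_nhdsWithin).exists
  exact ⟨⟨a, ha⟩, hlt⟩

theorem coe_mem_closedRange {I : Set ℝ} (z : I) : ((z : ℝ) : EReal) ∈ closedRange I :=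
  subset_closure ⟨z, z.2, rfl⟩

theorem closedRange_subset_Iic {I : Set ℝ} {l : EReal} (h : ∀ v : I, ((v : ℝ) : EReal) ≤ l) :
    closedRange I ⊆ Iic l :=
  closure_minimal (by rintro _ ⟨z, hz, rfl⟩; exact h ⟨z, hz⟩) isClosed_Iic

theorem closedRange_subset_Ici {I : Set ℝ} {l : EReal} (h : ∀ v : I, l ≤ ((v : ℝ) : EReal)) :
    closedRange I ⊆ Ici l :=
  closure_minimal (by rintro _ ⟨z, hz, rfl⟩; exact h ⟨z, hz⟩) isClosed_Ici

/-- The value of the path at its exit from `(a, b)`. -/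
noncomputable def exitValue {I : Set ℝ} (p : EReal × EReal) (w : ContPath I) : EReal :=
  stoppedAt (id : ContPath I → ContPath I) (exitTime p.1 p.2) w

theorem exitValue_of_ne_top {I : Set ℝ} {a b : EReal} {w : ContPath I} {y : I} (h0 : w.1 0 = y)
    (ha : a ≤ ((y : ℝ) : EReal)) (hb : ((y : ℝ) : EReal) ≤ b) (h : exitTime a b w ≠ ⊤) :
    exitValue (a, b) w = a ∨ exitValue (a, b) w = b := by
  obtain ⟨s, hs⟩ := WithTop.ne_top_iff_exists.1 h
  rw [exitValue, stoppedAt_of_eq_coe (Y := id) (τ := exitTime a b) hs.symm]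
  have hmem : ((w.1 s : ℝ) : EReal) ∉ Ioo a b :=
    firstHit_mem (C := (Ioo a b)ᶜ) isOpen_Ioo.isClosed_compl hs.symm
  suffices hIcc : ((w.1 s : ℝ) : EReal) ∈ Icc a b by
    rw [mem_Ioo, not_and_or, not_lt, not_lt] at hmem
    exact hmem.imp (fun h => le_antisymm h hIcc.1) (fun h => le_antisymm hIcc.2 h)
  -- An exit at time `0` has no earlier times to take a limit over; the position is then `y` itself.
  rcases eq_or_ne s 0 with rfl | hs0
  · rw [h0]; exact ⟨ha, hb⟩
  · have hne : (𝓝[<] s).NeBot := nhdsLT_neBot_of_exists_lt ⟨0, pos_iff_ne_zero.2 hs0⟩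
    refine isClosed_Icc.mem_of_tendsto
      (((continuous_coordE w).tendsto s).mono_left (nhdsWithin_le_nhds (s := Iio s))) ?_
    filter_upwards [self_mem_nhdsWithin] with t ht
    refine Ioo_subset_Icc_self (not_not.1 (notMem_of_lt_firstHit (C := (Ioo a b)ᶜ) ?_))
    change _ < exitTime a b w
    rw [← hs]
    exact WithTop.coe_lt_coe.2 ht

section Diffusion

variable {I : Set ℝ} {κ : Kernel I (ContPath I)}

/-- Without an exit the limit is an end of `I` by `limit_dichotomy`. The thresholds lie in the
closure of `I`, so the limit, being between them, equals one of them. -/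
theorem IsTransientPath.exitValue_eq {w : ContPath I} (hw : IsTransientPath w) {y : I}
    (h0 : w.1 0 = y) {p : EReal × EReal} (hp : p ∈ thresholdPairs I y) :
    exitValue p w = p.1 ∨ exitValue p w = p.2 := by
  obtain ⟨a, b⟩ := p
  by_cases h : exitTime a b w = ⊤
  swap
  · exact exitValue_of_ne_top h0 hp.1.1 hp.2.1 h
  obtain ⟨l, hl⟩ := hw.conv
  have hv : exitValue (a, b) w = l := stoppedAt_of_eq_top (Y := id) h hl
  have hmem := exitTime_eq_top_iff.1 h
  have hIcc : l ∈ Icc a b := isClosed_Icc.mem_of_tendsto hl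
    (Eventually.of_forall fun t => Ioo_subset_Icc_self (hmem t))
  rw [hv]
  rcases hw.limit_dichotomy hl with h | h
  · exact Or.inr (le_antisymm hIcc.2 (closedRange_subset_Iic h hp.2.2))
  · exact Or.inl (le_antisymm (closedRange_subset_Ici h hp.1.2) hIcc.1)

theorem IsTransientPath.exists_tendsto {Ω : Type*} {Y : Ω → ContPath I} {τ : Ω → WithTop ℝ≥0}
    {ω : Ω} (hw : IsTransientPath (Y ω)) :
    ∃ l : EReal, Tendsto (fun t => stoppedProcess (coordProcess Y) τ t ω) atTop (𝓝 l) := by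
  by_cases h : τ ω = ⊤
  · obtain ⟨l, hl⟩ := hw.conv
    exact ⟨l, (tendsto_stoppedProcess_iff_of_eq_top h).2 hl⟩
  · obtain ⟨s, hs⟩ := WithTop.ne_top_iff_exists.1 h
    exact ⟨_, tendsto_stoppedProcess_of_eq_coe hs.symm⟩

theorem IsStrongMarkov.mem_allRules (hκ : IsRegularDiffusion I κ)
    (hT : ∀ a b : I, a < b → κ a (hit b) < 1) {Ω : Type*} {mΩ : MeasurableSpace Ω}
    {P : Measure Ω} {𝓕 : Filtration ℝ≥0 mΩ} {Y : Ω → ContPath I} (hY : IsStrongMarkov 𝓕 P Y κ)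
    {τ : Ω → WithTop ℝ≥0} (hτ : IsStoppingTime 𝓕 τ) : τ ∈ allRules 𝓕 P Y :=
  ⟨hτ, (hY.ae_isTransientPath hκ hT).mono fun _ h => h.exists_tendsto⟩

/-! ### The scale function of a transient diffusion -/

open Classical in
/-- The scale function, normalized to vanish at the lower end point and to be `1` at `c`. -/
noncomputable def scaleFun (κ : Kernel I (ContPath I)) (c z : I) : ℝ≥0∞ :=
  if z ≤ c then κ z (hit c) else (κ c (hit z))⁻¹

theorem scaleFun_of_le {c z : I} (h : z ≤ c) : scaleFun κ c z = κ z (hit c) := if_pos h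

theorem scaleFun_of_lt {c z : I} (h : c < z) : scaleFun κ c z = (κ c (hit z))⁻¹ :=
  if_neg (not_le.2 h)

theorem scaleFun_self (hκ : IsRegularDiffusion I κ) (c : I) : scaleFun κ c c = 1 := by
  rw [scaleFun_of_le le_rfl, measure_hit_self hκ]

theorem measure_hit_mul_of_le (hκ : IsRegularDiffusion I κ) {p q r : I} (hpq : p ≤ q)
    (hqr : q ≤ r) : κ p (hit r) = κ p (hit q) * κ q (hit r) :=
  measure_hit_mul hκ (by rw [uIcc_of_le (hpq.trans hqr)]; exact ⟨hpq, hqr⟩)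

theorem measure_hit_ne_top (hκ : IsRegularDiffusion I κ) (p q : I) : κ p (hit q) ≠ ⊤ :=
  ne_top_of_le_ne_top ENNReal.one_ne_top (measure_le_one hκ _ _)

/-- The identity characterizing the scale function up to a factor. The reciprocal above `c` is
chosen so that it persists there, by multiplicativity of hitting probabilities. -/
theorem scaleFun_eq_mul (hκ : IsRegularDiffusion I κ) {c : I} (hc : (c : ℝ) ∈ interior I)
    {a b : I} (hab : a ≤ b) : scaleFun κ c a = κ a (hit b) * scaleFun κ c b := by
  have hr : ∀ v, κ c (hit v) ≠ 0 := fun v => (hκ.regular c hc v).ne'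
  rcases le_or_gt b c with hb | hb
  · rw [scaleFun_of_le hb, scaleFun_of_le (hab.trans hb), measure_hit_mul_of_le hκ hab hb]
  rcases le_or_gt a c with ha | ha
  · rw [scaleFun_of_le ha, scaleFun_of_lt hb, measure_hit_mul_of_le hκ ha hb.le, mul_assoc,
      ENNReal.mul_inv_cancel (hr b) (measure_hit_ne_top hκ _ _), mul_one]
  · have hcb := measure_hit_mul_of_le hκ ha.le hab
    have hne : κ a (hit b) ≠ 0 := fun h => hr b (hcb.trans (by rw [h, mul_zero]))
    change (κ c) (hit b) = _ at hcb
    rw [scaleFun_of_lt ha, scaleFun_of_lt hb, hcb,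
      ENNReal.mul_inv (Or.inr (measure_hit_ne_top hκ _ _)) (Or.inr hne), mul_left_comm,
      ENNReal.mul_inv_cancel hne (measure_hit_ne_top hκ _ _), mul_one]

theorem scaleFun_ne_top (hκ : IsRegularDiffusion I κ) {c : I} (hc : (c : ℝ) ∈ interior I)
    (z : I) : scaleFun κ c z ≠ ⊤ := by
  rcases le_or_gt z c with h | h
  · rw [scaleFun_of_le h]; exact measure_hit_ne_top hκ _ _
  · rw [scaleFun_of_lt h]; exact ENNReal.inv_ne_top.2 (hκ.regular c hc z).ne'

theorem scaleFun_ne_zero (hκ : IsRegularDiffusion I κ) {c : I} (hc : (c : ℝ) ∈ interior I)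
    {a b : I} (hab : a < b) : scaleFun κ c b ≠ 0 := by
  rcases le_or_gt b c with h | h
  · rw [scaleFun_of_le h]
    rcases h.lt_or_eq with h | rfl
    · exact (hκ.regular b (mem_interior_of_lt hκ.ordConnected hab h) c).ne'
    · rw [measure_hit_self hκ]; exact one_ne_zero
  · rw [scaleFun_of_lt h]; exact ENNReal.inv_ne_zero.2 (measure_hit_ne_top hκ _ _)

theorem scaleFun_lt (hκ : IsRegularDiffusion I κ) (hT : ∀ a b : I, a < b → κ a (hit b) < 1)
    {c : I} (hc : (c : ℝ) ∈ interior I) {a b : I} (hab : a < b) :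
    scaleFun κ c a < scaleFun κ c b := by
  rw [scaleFun_eq_mul hκ hc hab.le]
  simpa using ENNReal.mul_lt_mul_left (scaleFun_ne_zero hκ hc hab) (scaleFun_ne_top hκ hc b)
    (hT a b hab)

theorem scaleFun_le (hκ : IsRegularDiffusion I κ)
    {c : I} (hc : (c : ℝ) ∈ interior I) {a b : I} (hab : a ≤ b) :
    scaleFun κ c a ≤ scaleFun κ c b := by
  rw [scaleFun_eq_mul hκ hc hab]
  exact mul_le_of_le_one_left zero_le (measure_le_one hκ _ _)

theorem scaleFun_of_isLeast (hκ : IsRegularDiffusion I κ) {c : I} (hc : (c : ℝ) ∈ interior I)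
    {z : I} (hz : ∀ v, z ≤ v) : scaleFun κ c z = 0 := by
  have hn : (z : ℝ) ∉ interior I := fun h =>
    let ⟨a, ha⟩ := exists_lt_of_mem_interior h
    absurd (hz a) (not_le.2 ha)
  rw [scaleFun_of_le (hz c), measure_hit_of_notMem_interior hκ hn]
  rintro rfl
  exact hn hc

/-- The reason for working with `above v` rather than `hit v`: the formula then needs no case
distinction on the order of `z` and `v`, and expresses a truncated scale function as a hitting
probability. -/
theorem scaleFun_mul_measure_above (hκ : IsRegularDiffusion I κ) {c : I}
    (hc : (c : ℝ) ∈ interior I) (z v : I) :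
    scaleFun κ c v * κ z (above v) = min (scaleFun κ c z) (scaleFun κ c v) := by
  rcases le_total v z with h | h
  · rw [measure_above_of_le hκ h, mul_one, min_eq_right (scaleFun_le hκ hc h)]
  · rw [measure_above_of_ge hκ h, min_eq_left (scaleFun_le hκ hc h), scaleFun_eq_mul hκ hc h,
      mul_comm]

/-- The scale function, extended to `[-∞, ∞]`. -/
noncomputable def scaleE (κ : Kernel I (ContPath I)) (c : I) (x : EReal) : ℝ≥0∞ :=
  ⨆ (z : I) (_ : ((z : ℝ) : EReal) ≤ x), scaleFun κ c z

theorem scaleE_mono (κ : Kernel I (ContPath I)) (c : I) : Monotone (scaleE κ c) :=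
  fun _ _ h => iSup_mono fun _ => iSup_mono' fun hz => ⟨hz.trans h, le_rfl⟩

theorem scaleFun_le_scaleE {c z : I} {x : EReal} (h : ((z : ℝ) : EReal) ≤ x) :
    scaleFun κ c z ≤ scaleE κ c x := le_iSup₂_of_le z h le_rfl

theorem scaleE_coe (hκ : IsRegularDiffusion I κ) {c : I} (hc : (c : ℝ) ∈ interior I) (z : I) :
    scaleE κ c ((z : ℝ) : EReal) = scaleFun κ c z :=
  le_antisymm (iSup₂_le fun _ h => scaleFun_le hκ hc (EReal.coe_le_coe_iff.1 h))
    (scaleFun_le_scaleE le_rfl)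

/-- The supremum is either empty or taken over a least point of `I`, an absorbing end point from
which `c` is never reached. -/
theorem scaleE_of_le (hκ : IsRegularDiffusion I κ) {c : I} (hc : (c : ℝ) ∈ interior I)
    {l : EReal} (h : ∀ v : I, l ≤ ((v : ℝ) : EReal)) : scaleE κ c l = 0 := by
  rw [scaleE, ← nonpos_iff_eq_zero]
  refine iSup₂_le fun z hz => (scaleFun_of_isLeast hκ hc fun v => ?_).le
  exact EReal.coe_le_coe_iff.1 (hz.trans (h v))

theorem exists_seq_cofinal (hI : I.OrdConnected) (y : I) :
    ∃ v : ℕ → I, Monotone v ∧ (∀ n, y ≤ v n) ∧ ∀ a, ∃ n, a ≤ v n := by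
  have : Nonempty I := ⟨y⟩
  obtain ⟨v, hv, hlim⟩ := exists_seq_monotone_tendsto_atTop_atTop I
  refine ⟨fun n => max y (v n), fun m n h => max_le_max le_rfl (hv h), fun n => le_max_left _ _,
    fun a => ?_⟩
  obtain ⟨n, hn⟩ := (hlim.eventually_ge_atTop a).exists
  exact ⟨n, hn.trans (le_max_right _ _)⟩

/-! ### Optional stopping for the scale function -/

section Stopped

variable {Ω : Type*} {mΩ : MeasurableSpace Ω} {P : Measure Ω} {𝓕 : Filtration ℝ≥0 mΩ}
  {Y : Ω → ContPath I}

/-- Where `τ` is finite, the strong Markov property turns the truncated scale function of `Y_τ` into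
the chance of reaching `v` after `τ`. Where it is infinite, the limit is an end of `I`, with
truncated scale `scaleFun κ c v` or `0`. The point `u < v` guarantees that a limit at the lower end
lies strictly below `v`. -/
theorem lintegral_min_scaleE (hκ : IsRegularDiffusion I κ)
    (hT : ∀ a b : I, a < b → κ a (hit b) < 1) (hY : IsStrongMarkov 𝓕 P Y κ)
    {c : I} (hc : (c : ℝ) ∈ interior I) {τ : Ω → WithTop ℝ≥0} (hτ : IsStoppingTime 𝓕 τ)
    {u v : I} (huv : u < v) :
    ∫⁻ ω, min (scaleE κ c (stoppedAt Y τ ω)) (scaleFun κ c v) ∂P =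
      scaleFun κ c v * P ({ω | τ ω ≠ ⊤ ∧ shift (τ ω).untopA (Y ω) ∈ above v} ∪
        {ω | τ ω = ⊤ ∧ ((v : ℝ) : EReal) ≤ stoppedAt Y τ ω}) := by
  have hτm := measurable_of_isStoppingTime hτ
  have hA : MeasurableSet {ω | τ ω ≠ ⊤} := (hτm (measurableSet_singleton ⊤)).compl
  have hrule := hY.mem_allRules hκ hT hτ
  rw [← lintegral_add_compl _ hA, ← measure_inter_add_sdiff _ hA, mul_add]
  congr 1
  · have hG : ({ω | τ ω ≠ ⊤ ∧ shift (τ ω).untopA (Y ω) ∈ above v} ∪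
        {ω | τ ω = ⊤ ∧ ((v : ℝ) : EReal) ≤ stoppedAt Y τ ω}) ∩ {ω | τ ω ≠ ⊤} =
        {ω | τ ω ≠ ⊤ ∧ shift (τ ω).untopA (Y ω) ∈ above v} := by
      ext ω
      simp only [mem_inter_iff, mem_union, mem_ofPred_eq]
      tauto
    rw [hG, hY.measure_shift hτ (measurableSet_above v), ← lintegral_const_mul' _ _
      (scaleFun_ne_top hκ hc v)]
    refine setLIntegral_congr_fun hA fun ω hω => ?_
    obtain ⟨s, hs⟩ := WithTop.ne_top_iff_exists.1 hω
    simp only [stoppedAt_of_eq_coe hs.symm, ← hs, untopA_coe', scaleE_coe hκ hc,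
      scaleFun_mul_measure_above hκ hc]
  · have hS : NullMeasurableSet {ω | ((v : ℝ) : EReal) ≤ stoppedAt Y τ ω}
        (P.restrict {ω | τ ω ≠ ⊤}ᶜ) :=
      ((aemeasurable_stoppedAt hY.measurable hrule).nullMeasurable measurableSet_Ici).mono_ac
        Measure.restrict_le_self.absolutelyContinuous
    have hG : ({ω | τ ω ≠ ⊤ ∧ shift (τ ω).untopA (Y ω) ∈ above v} ∪
        {ω | τ ω = ⊤ ∧ ((v : ℝ) : EReal) ≤ stoppedAt Y τ ω}) \ {ω | τ ω ≠ ⊤} =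
        {ω | ((v : ℝ) : EReal) ≤ stoppedAt Y τ ω} ∩ {ω | τ ω ≠ ⊤}ᶜ := by
      ext ω
      simp only [mem_inter_iff, mem_union, mem_ofPred_eq, Set.mem_sdiff, mem_compl_iff, not_not]
      tauto
    rw [hG, ← Measure.restrict_apply₀ hS, ← lintegral_indicator_const₀ hS]
    refine lintegral_congr_ae ((ae_restrict_iff' hA.compl).2 ?_)
    filter_upwards [hY.ae_isTransientPath hκ hT] with ω hω htop
    have htop : τ ω = ⊤ := not_not.1 htop
    obtain ⟨l, hl⟩ := hω.conv
    rw [stoppedAt_of_eq_top htop hl]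
    rcases hω.limit_dichotomy hl with h | h
    · rw [indicator_of_mem, min_eq_right (scaleFun_le_scaleE (h v))]
      rw [mem_ofPred_eq, stoppedAt_of_eq_top htop hl]; exact h v
    · rw [scaleE_of_le hκ hc h, min_eq_left zero_le, indicator_of_notMem]
      rw [mem_ofPred_eq, stoppedAt_of_eq_top htop hl, not_le]
      exact (h u).trans_lt (EReal.coe_lt_coe_iff.2 huv)

variable [IsProbabilityMeasure P]

theorem scaleFun_mul_measure (hκ : IsRegularDiffusion I κ) (hY : IsStrongMarkov 𝓕 P Y κ) {y : I}
    (h0 : ∀ᵐ ω ∂P, (Y ω).1 0 = y) {c : I} (hc : (c : ℝ) ∈ interior I) {v : I} (hv : y ≤ v) :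
    scaleFun κ c v * P {ω | Y ω ∈ above v} = scaleFun κ c y := by
  have : P {ω | Y ω ∈ above v} = κ y (above v) := by
    rw [← hY.map_eq h0, Measure.map_apply hY.measurable (measurableSet_above v)]; rfl
  rw [this, scaleFun_mul_measure_above hκ hc, min_eq_left (scaleFun_le hκ hc hv)]

/-- Reaching `v` after `τ`, or converging to a limit at least `v`, entails reaching `v` at some
time, an event whose probability is known exactly. -/
theorem lintegral_min_scaleE_le (hκ : IsRegularDiffusion I κ)
    (hT : ∀ a b : I, a < b → κ a (hit b) < 1) (hY : IsStrongMarkov 𝓕 P Y κ) {y : I}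
    (hy : (y : ℝ) ∈ interior I) (h0 : ∀ᵐ ω ∂P, (Y ω).1 0 = y)
    {c : I} (hc : (c : ℝ) ∈ interior I) {τ : Ω → WithTop ℝ≥0} (hτ : IsStoppingTime 𝓕 τ)
    {v : I} (hv : y ≤ v) :
    ∫⁻ ω, min (scaleE κ c (stoppedAt Y τ ω)) (scaleFun κ c v) ∂P ≤ scaleFun κ c y := by
  obtain ⟨u, hu⟩ := exists_lt_of_mem_interior hy
  rw [lintegral_min_scaleE hκ hT hY hc hτ (hu.trans_le hv), ← scaleFun_mul_measure hκ hY h0 hc hv]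
  refine mul_le_mul_right (measure_mono_ae ?_) _
  filter_upwards [hY.ae_isTransientPath hκ hT] with ω hω hmem
  rcases hmem with ⟨-, t, ht⟩ | ⟨htop, hle⟩
  · exact ⟨_, ht⟩
  · obtain ⟨l, hl⟩ := hω.conv
    rw [stoppedAt_of_eq_top htop hl] at hle
    obtain ⟨t, -, ht⟩ := hω.mem_above hl
      ((EReal.coe_lt_coe_iff.2 (hu.trans_le hv)).trans_le hle) v 0
    exact ⟨t, ht⟩

/-- The scale function of the stopped process has expectation at most its initial value. -/
theorem lintegral_scaleE_le (hκ : IsRegularDiffusion I κ)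
    (hT : ∀ a b : I, a < b → κ a (hit b) < 1) (hY : IsStrongMarkov 𝓕 P Y κ) {y : I}
    (hy : (y : ℝ) ∈ interior I) (h0 : ∀ᵐ ω ∂P, (Y ω).1 0 = y)
    {c : I} (hc : (c : ℝ) ∈ interior I) {τ : Ω → WithTop ℝ≥0} (hτ : IsStoppingTime 𝓕 τ) :
    ∫⁻ ω, scaleE κ c (stoppedAt Y τ ω) ∂P ≤ scaleFun κ c y := by
  obtain ⟨v, hvm, hyv, hcof⟩ := exists_seq_cofinal hκ.ordConnected y
  have hsup : ∀ x, scaleE κ c x = ⨆ n, min (scaleE κ c x) (scaleFun κ c (v n)) := by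
    intro x
    refine le_antisymm (iSup₂_le fun z hz => ?_) (iSup_le fun n => min_le_left _ _)
    obtain ⟨n, hn⟩ := hcof z
    exact le_iSup_of_le n (le_min (scaleFun_le_scaleE hz) (scaleFun_le hκ hc hn))
  have hm : AEMeasurable (fun ω => scaleE κ c (stoppedAt Y τ ω)) P :=
    (scaleE_mono κ c).measurable.comp_aemeasurable
      (aemeasurable_stoppedAt hY.measurable (hY.mem_allRules hκ hT hτ))
  calc ∫⁻ ω, scaleE κ c (stoppedAt Y τ ω) ∂P
      = ∫⁻ ω, ⨆ n, min (scaleE κ c (stoppedAt Y τ ω)) (scaleFun κ c (v n)) ∂P :=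
        lintegral_congr fun ω => hsup _
    _ = ⨆ n, ∫⁻ ω, min (scaleE κ c (stoppedAt Y τ ω)) (scaleFun κ c (v n)) ∂P :=
        lintegral_iSup' (fun n => hm.min aemeasurable_const)
          (Eventually.of_forall fun ω m n h => min_le_min le_rfl (scaleFun_le hκ hc (hvm h)))
    _ ≤ _ := iSup_le fun n => lintegral_min_scaleE_le hκ hT hY hy h0 hc hτ (hyv n)

/-- Optional stopping for a bounded scale function. -/
theorem lintegral_scaleE_eq (hκ : IsRegularDiffusion I κ)
    (hT : ∀ a b : I, a < b → κ a (hit b) < 1) (hY : IsStrongMarkov 𝓕 P Y κ) {y : I}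
    (hy : (y : ℝ) ∈ interior I) (h0 : ∀ᵐ ω ∂P, (Y ω).1 0 = y)
    {c : I} (hc : (c : ℝ) ∈ interior I) {τ : Ω → WithTop ℝ≥0} (hτ : IsStoppingTime 𝓕 τ)
    (hfin : scaleE κ c ⊤ ≠ ⊤) :
    ∫⁻ ω, scaleE κ c (stoppedAt Y τ ω) ∂P = scaleFun κ c y := by
  refine le_antisymm (lintegral_scaleE_le hκ hT hY hy h0 hc hτ) ?_
  obtain ⟨u, hu⟩ := exists_lt_of_mem_interior hy
  obtain ⟨v, hvm, hyv, hcof⟩ := exists_seq_cofinal hκ.ordConnected y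
  have htoprule : (fun _ : Ω => (⊤ : WithTop ℝ≥0)) ∈ allRules 𝓕 P Y :=
    hY.mem_allRules hκ hT fun t => by simp
  set L : Ω → EReal := stoppedAt Y fun _ => ⊤
  have hLm : NullMeasurableSet {ω | L ω < ((y : ℝ) : EReal)} P :=
    (aemeasurable_stoppedAt hY.measurable htoprule).nullMeasurable measurableSet_Iio
  have hLeq : ∀ ω l, Tendsto (fun t => (((Y ω).1 t : ℝ) : EReal)) atTop (𝓝 l) → L ω = l :=
    fun ω l hl => stoppedAt_of_eq_top (τ := fun _ => ⊤) rfl hl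
  clear_value L
  -- The paths that reach `v n` and yet finally fall below `y`. Off this event, a path reaching `v
  -- n` still does so after `τ`, or `τ` is infinite and the limit is at least `v n`.
  set N : ℕ → Set Ω := fun n => {ω | Y ω ∈ above (v n)} ∩ {ω | L ω < ((y : ℝ) : EReal)}
  have hN0 : P (⋂ n, N n) = 0 := by
    rw [measure_eq_zero_iff_ae_notMem]
    filter_upwards [hY.ae_isTransientPath hκ hT] with ω hω hmem
    rw [mem_iInter] at hmem
    obtain ⟨l, hl⟩ := hω.conv
    have hly : l < ((y : ℝ) : EReal) := by
      have := (hmem 0).2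
      rwa [mem_ofPred_eq, hLeq ω l hl] at this
    obtain ⟨T, hT'⟩ := eventually_atTop.1 (hl.eventually (eventually_lt_nhds hly))
    obtain ⟨t, ht, hmax⟩ := (isCompact_Iic_nnreal T).exists_isMaxOn ⟨T, le_refl T⟩
      (Y ω).2.continuousOn
    -- A path in all `N n` has on `[0, T]` a maximum dominating all of `I`, hence at an absorbing
    -- end point, which it could not leave to fall below `y`.
    have hge : ∀ a, a ≤ (Y ω).1 t := by
      intro a
      obtain ⟨n, hn⟩ := hcof a
      obtain ⟨s, hs⟩ := (hmem n).1
      rcases le_total s T with hsT | hsT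
      · exact hn.trans (hs.trans (hmax hsT))
      · have := hT' s hsT
        rw [EReal.coe_lt_coe_iff] at this
        exact absurd ((hyv n).trans hs) (not_le.2 this)
    have hnint : (((Y ω).1 t : I) : ℝ) ∉ interior I := fun h =>
      let ⟨a, ha⟩ := exists_gt_of_mem_interior h
      absurd (hge a) (not_le.2 ha)
    have := hT' (max t T) (le_max_right _ _)
    rw [hω.absorb _ hnint t rfl _ (le_max_left _ _), EReal.coe_lt_coe_iff] at this
    exact absurd (hge y) (not_le.2 this)
  have hNlim : Tendsto (fun n => P (N n)) atTop (𝓝 0) := by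
    rw [← hN0]
    refine tendsto_measure_iInter_atTop (fun n => ?_) (fun m n h => ?_) ⟨0, measure_ne_top _ _⟩
    · exact (hY.measurable (measurableSet_above _)).nullMeasurableSet.inter hLm
    · exact inter_subset_inter_left _ fun ω ⟨t, ht⟩ => ⟨t, (hvm h).trans ht⟩
  have hbound : ∀ n, scaleFun κ c y ≤
      ∫⁻ ω, scaleE κ c (stoppedAt Y τ ω) ∂P + scaleE κ c ⊤ * P (N n) := by
    intro n
    rw [← scaleFun_mul_measure hκ hY h0 hc (hyv n)]
    set G : Set Ω := {ω | τ ω ≠ ⊤ ∧ shift (τ ω).untopA (Y ω) ∈ above (v n)} ∪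
      {ω | τ ω = ⊤ ∧ ((v n : ℝ) : EReal) ≤ stoppedAt Y τ ω} with hG
    have hsub : P {ω | Y ω ∈ above (v n)} ≤ P (G ∪ N n) := by
      refine measure_mono_ae ?_
      filter_upwards [hY.ae_isTransientPath hκ hT] with ω hω
      intro (hmem : Y ω ∈ above (v n))
      by_contra hn
      have hn : ω ∉ G ∪ N n := hn
      obtain ⟨l, hl⟩ := hω.conv
      have hLl : L ω = l := hLeq ω l hl
      rw [mem_union, not_or] at hn
      have hyl : ((y : ℝ) : EReal) ≤ l := by
        by_contra! hlt
        exact hn.2 ⟨hmem, by rw [mem_ofPred_eq, hLl]; exact hlt⟩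
      have hul := (EReal.coe_lt_coe_iff.2 (show (u : ℝ) < y from hu)).trans_le hyl
      by_cases hτω : τ ω = ⊤
      · refine hn.1 (Or.inr ⟨hτω, ?_⟩)
        rw [stoppedAt_of_eq_top hτω hl]
        rcases hω.limit_dichotomy hl with h | h
        · exact h _
        · exact absurd (h u) (not_le.2 hul)
      · obtain ⟨s, hs⟩ := WithTop.ne_top_iff_exists.1 hτω
        obtain ⟨t, hst, ht⟩ := hω.mem_above hl hul (v n) s
        refine hn.1 (Or.inl ⟨hτω, t - s, ?_⟩)
        rw [← hs, untopA_coe', shift_apply, add_tsub_cancel_of_le hst]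
        exact ht
    calc scaleFun κ c (v n) * P {ω | Y ω ∈ above (v n)}
        ≤ scaleFun κ c (v n) * P G + scaleFun κ c (v n) * P (N n) := by
          rw [← mul_add]
          exact mul_le_mul_right (hsub.trans (measure_union_le _ _)) _
      _ ≤ _ := by
          rw [hG, ← lintegral_min_scaleE hκ hT hY hc hτ (hu.trans_le (hyv n))]
          exact add_le_add (lintegral_mono fun ω => min_le_left _ _)
            (mul_le_mul_left (scaleFun_le_scaleE le_top) _)
  -- Boundedness of the scale function is needed here, so that the weight of the vanishing event `N
  -- n` stays finite.
  have hlim : Tendsto (fun n => ∫⁻ ω, scaleE κ c (stoppedAt Y τ ω) ∂P +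
      scaleE κ c ⊤ * P (N n)) atTop
      (𝓝 (∫⁻ ω, scaleE κ c (stoppedAt Y τ ω) ∂P + scaleE κ c ⊤ * 0)) :=
    tendsto_const_nhds.add (ENNReal.Tendsto.const_mul hNlim (Or.inr hfin))
  rw [mul_zero, add_zero] at hlim
  exact ge_of_tendsto' hlim hbound

/-- Optional stopping at the exit from an interval whose upper end point belongs to `I`. -/
theorem lintegral_min_scaleE_exitTime (hκ : IsRegularDiffusion I κ)
    (hT : ∀ a b : I, a < b → κ a (hit b) < 1) (hY : IsStrongMarkov 𝓕 P Y κ) {y : I}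
    (hy : (y : ℝ) ∈ interior I) (h0 : ∀ᵐ ω ∂P, (Y ω).1 0 = y)
    {c : I} (hc : (c : ℝ) ∈ interior I) (a : EReal) {v : I} (hv : y ≤ v) :
    ∫⁻ ω, min (scaleE κ c (exitValue (a, ((v : ℝ) : EReal)) (Y ω))) (scaleFun κ c v) ∂P =
      scaleFun κ c y := by
  have hτ : IsStoppingTime 𝓕 fun ω => exitTime a ((v : ℝ) : EReal) (Y ω) :=
    isStoppingTime_exitTime hY.1 measurable_const measurable_const
  refine le_antisymm (lintegral_min_scaleE_le hκ hT hY hy h0 hc hτ hv) ?_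
  obtain ⟨u, hu⟩ := exists_lt_of_mem_interior hy
  refine le_trans ?_ (lintegral_min_scaleE hκ hT hY hc hτ (hu.trans_le hv)).ge
  rw [← scaleFun_mul_measure hκ hY h0 hc hv]
  -- A path that reaches `v` or a higher level at time `t` has left the interval by then, so that
  -- visit is not before the exit time.
  refine mul_le_mul_right (measure_mono ?_) _
  rintro ω ⟨t, ht⟩
  left
  have hle : exitTime a ((v : ℝ) : EReal) (Y ω) ≤ t :=
    firstHit_le_of_mem fun h => absurd h.2 (not_lt.2 (EReal.coe_le_coe_iff.2 ht))
  obtain ⟨s, hs⟩ := WithTop.ne_top_iff_exists.1 (ne_top_of_le_ne_top WithTop.coe_ne_top hle)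
  rw [← hs] at hle
  refine ⟨by rw [← hs]; exact WithTop.coe_ne_top, t - s, ?_⟩
  rw [← hs, untopA_coe', shift_apply, add_tsub_cancel_of_le (WithTop.coe_le_coe.1 hle)]
  exact ht

end Stopped

end Diffusion

/-! ### Random variables with a given law -/

theorem continuous_cdf_of_noAtoms (ν : Measure ℝ) [IsProbabilityMeasure ν]
    (h : ∀ x, ν {x} = 0) : Continuous (cdf ν) := by
  refine continuous_iff_continuousAt.2 fun x => ?_
  rw [(monotone_cdf ν).continuousAt_iff_leftLim_eq_rightLim, StieltjesFunction.rightLim_eq]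
  have h1 := (cdf ν).measure_singleton x
  rw [measure_cdf, h x] at h1
  have h2 := ENNReal.ofReal_eq_zero.1 h1.symm
  exact le_antisymm ((monotone_cdf ν).leftLim_le le_rfl) (by linarith)

/-- The probability integral transform. Continuity makes the distribution function attain every
value in `(0, 1)`; as it may have flat pieces, the upper bound is taken through values `s > t`. -/
theorem map_cdf_eq_volume (ν : Measure ℝ) [IsProbabilityMeasure ν] (h : ∀ x, ν {x} = 0) :
    ν.map (fun x => (⟨cdf ν x, cdf_nonneg ν x, cdf_le_one ν x⟩ : unitInterval)) = volume := by
  have hc := continuous_cdf_of_noAtoms ν h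
  have hm : Measurable (fun x => (⟨cdf ν x, cdf_nonneg ν x, cdf_le_one ν x⟩ : unitInterval)) :=
    hc.measurable.subtype_mk
  have := Measure.isProbabilityMeasure_map (μ := ν) hm.aemeasurable
  have hex : ∀ t : ℝ, 0 < t → t < 1 → ∃ x, cdf ν x = t := fun t h0 h1 =>
    mem_range_of_exists_le_of_exists_ge hc
      ((tendsto_cdf_atBot ν).eventually_le_const h0).exists
      ((tendsto_cdf_atTop ν).eventually_const_le h1).exists
  have hI : ∀ x, ν (Iic x) = ENNReal.ofReal (cdf ν x) := fun x => (ofReal_cdf ν x).symm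
  refine Measure.ext_of_Iic _ _ fun t => ?_
  rw [Measure.map_apply hm measurableSet_Iic, unitInterval.volume_Iic]
  have hset : (fun x => (⟨cdf ν x, cdf_nonneg ν x, cdf_le_one ν x⟩ : unitInterval)) ⁻¹' Iic t =
      {x | cdf ν x ≤ t} := rfl
  rw [hset]
  refine le_antisymm ?_ ?_
  · rcases t.2.2.eq_or_lt with h1 | h1
    · rw [h1]; simpa using prob_le_one
    rw [ENNReal.le_ofReal_iff_toReal_le (measure_ne_top _ _) t.2.1]
    refine le_of_forall_gt_imp_ge_of_dense fun s hs => ?_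
    rcases le_or_gt 1 s with h2 | h2
    · exact (ENNReal.toReal_mono ENNReal.one_ne_top prob_le_one).trans (by simpa using h2)
    obtain ⟨x, hx⟩ := hex s (t.2.1.trans_lt hs) h2
    have hsub : ν {x | cdf ν x ≤ t} ≤ ENNReal.ofReal s := by
      rw [← hx, ← hI]
      refine measure_mono fun z (hz : cdf ν z ≤ t) => ?_
      by_contra hn
      exact absurd (monotone_cdf ν (not_le.1 hn).le) (not_le.2 (hz.trans_lt (hx ▸ hs)))
    exact ENNReal.toReal_le_of_le_ofReal (t.2.1.trans hs.le) hsub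
  · rcases t.2.1.eq_or_lt with h1 | h1
    · rw [← h1]; simp
    rcases t.2.2.eq_or_lt with h2 | h2
    · rw [h2]
      have : {x | cdf ν x ≤ 1} = univ := eq_univ_of_forall fun x => cdf_le_one ν x
      rw [this]; simp
    · obtain ⟨x, hx⟩ := hex t h1 h2
      rw [← hx, ← hI]
      exact measure_mono fun z hz => monotone_cdf ν hz

theorem IsRich.exists_uniform {I : Set ℝ} {Ω : Type*} {mΩ : MeasurableSpace Ω}
    {𝓕 : Filtration ℝ≥0 mΩ} {P : Measure Ω} [IsProbabilityMeasure P] {Y : Ω → ContPath I}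
    (h : IsRich 𝓕 P Y) :
    ∃ V : Ω → unitInterval, Measurable[𝓕 0] V ∧ P.map V = volume ∧ IndepFun V Y P := by
  obtain ⟨U, hU, hat, hind⟩ := h
  have hUm : Measurable U := hU.mono (𝓕.le 0) le_rfl
  have hp := Measure.isProbabilityMeasure_map (μ := P) hUm.aemeasurable
  have hν : ∀ x, P.map U {x} = 0 := fun x => by
    rw [Measure.map_apply hUm (measurableSet_singleton x)]; exact hat x
  have hm : Measurable (fun x => (⟨cdf (P.map U) x, cdf_nonneg _ x, cdf_le_one _ x⟩ :
    unitInterval)) := (continuous_cdf_of_noAtoms _ hν).measurable.subtype_mk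
  refine ⟨_, hm.comp hU, ?_, hind.comp hm measurable_id⟩
  rw [← map_cdf_eq_volume _ hν, Measure.map_map hm hUm]

theorem measurableSet_thresholdPairs (I : Set ℝ) (y : I) : MeasurableSet (thresholdPairs I y) :=
  (measurableSet_Iic.inter isClosed_closure.measurableSet).prod
    (measurableSet_Ici.inter isClosed_closure.measurableSet)

theorem self_mem_thresholdPairs {I : Set ℝ} (y : I) :
    (((y : ℝ) : EReal), ((y : ℝ) : EReal)) ∈ thresholdPairs I y :=
  ⟨⟨self_mem_Iic, coe_mem_closedRange y⟩, ⟨self_mem_Ici, coe_mem_closedRange y⟩⟩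

theorem IsRich.exists_pair {I : Set ℝ} {Ω : Type*} {mΩ : MeasurableSpace Ω}
    {𝓕 : Filtration ℝ≥0 mΩ} {P : Measure Ω} [IsProbabilityMeasure P] {Y : Ω → ContPath I}
    (h : IsRich 𝓕 P Y) {y : I} (ρ : Measure (EReal × EReal)) [IsProbabilityMeasure ρ]
    (hρ : ∀ᵐ p ∂ρ, p ∈ thresholdPairs I y) :
    ∃ Θ : Ω → EReal × EReal, Measurable[𝓕 0] Θ ∧ (∀ ω, Θ ω ∈ thresholdPairs I y) ∧
      IndepFun Θ Y P ∧ P.map Θ = ρ := by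
  classical
  obtain ⟨V, hV, hlaw, hind⟩ := h.exists_uniform
  obtain ⟨f, hf, hfρ⟩ := Measure.exists_measurable_map_eq ρ
  have hVm : Measurable V := hV.mono (𝓕.le 0) le_rfl
  -- The thresholds must be admissible for every `ω`, so the null set where the sample is not is
  -- sent to `(y, y)`.
  set g : EReal × EReal → EReal × EReal := fun p =>
    if p ∈ thresholdPairs I y then p else (((y : ℝ) : EReal), ((y : ℝ) : EReal)) with hg
  have hgm : Measurable g :=
    Measurable.ite (measurableSet_thresholdPairs I y) measurable_id measurable_const
  refine ⟨fun ω => g (f (V ω)), (hgm.comp hf).comp hV, fun ω => ?_,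
    hind.comp (hgm.comp hf) measurable_id, ?_⟩
  · simp only [hg]
    split_ifs with h
    · exact h
    · exact self_mem_thresholdPairs y
  · have h1 : P.map (fun ω => g (f (V ω))) = ((P.map V).map f).map g := by
      rw [Measure.map_map hf hVm, Measure.map_map hgm (hf.comp hVm)]; rfl
    rw [h1, hlaw, hfρ]
    have : g =ᵐ[ρ] id := hρ.mono fun p hp => if_pos hp
    rw [Measure.map_congr this, Measure.map_id]

/-! ### The law at a random exit time -/

/-- A jointly measurable version of `exitValue`. -/
noncomputable def exitLim {I : Set ℝ} (p : EReal × EReal) (w : ContPath I) : EReal :=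
  limsup (fun n : ℕ => stoppedProcess (coordProcess (id : ContPath I → ContPath I))
    (exitTime p.1 p.2) (n : ℝ≥0) w) atTop

theorem measurable_exitLim {I : Set ℝ} :
    Measurable fun q : (EReal × EReal) × ContPath I => exitLim q.1 q.2 := by
  have hτ : Measurable fun q : (EReal × EReal) × ContPath I => exitTime q.1.1 q.1.2 q.2 :=
    measurable_withTop_of_le fun t => measurableSet_exitTime_le
      (Y := fun q : (EReal × EReal) × ContPath I => q.2)
      (fun s _ => (measurable_coord s).comp measurable_snd)
      (measurable_fst.comp measurable_fst) (measurable_snd.comp measurable_fst)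
  exact Measurable.limsup fun n => measurable_stoppedProcess
    (Y := fun q : (EReal × EReal) × ContPath I => q.2) measurable_snd hτ n

/-- The stopped path converges. -/
def ExitConv {I : Set ℝ} (p : EReal × EReal) (w : ContPath I) : Prop :=
  ∃ l : EReal, Tendsto (fun t => stoppedProcess (coordProcess (id : ContPath I → ContPath I))
    (exitTime p.1 p.2) t w) atTop (𝓝 l)

theorem ExitConv.exitLim_eq {I : Set ℝ} {p : EReal × EReal} {w : ContPath I} (h : ExitConv p w) :
    exitLim p w = exitValue p w := by
  obtain ⟨l, hl⟩ := h
  exact (hl.comp tendsto_natCast_nnreal).limsup_eq.trans hl.limsup_eq.symm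

theorem _root_.ProbabilityTheory.IndepFun.map_apply_eq_lintegral {Ω A B C : Type*}
    {mΩ : MeasurableSpace Ω} [MeasurableSpace A] [MeasurableSpace B] [MeasurableSpace C]
    {P : Measure Ω} [IsProbabilityMeasure P] {X : Ω → A} {Y : Ω → B} (h : IndepFun X Y P)
    (hX : Measurable X) (hY : Measurable Y) {f : A → B → C}
    (hf : Measurable fun q : A × B => f q.1 q.2) {S : Set C} (hS : MeasurableSet S) :
    P.map (fun ω => f (X ω) (Y ω)) S = ∫⁻ x, P.map Y {w | f x w ∈ S} ∂(P.map X) := by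
  have hpm := Measure.isProbabilityMeasure_map (μ := P) hY.aemeasurable
  have hm : Measurable fun ω => (X ω, Y ω) := hX.prodMk hY
  have hE : MeasurableSet {q : A × B | f q.1 q.2 ∈ S} := hf hS
  have hEm : Measurable fun ω => f (X ω) (Y ω) := hf.comp hm
  have h1 : P {ω | f (X ω) (Y ω) ∈ S} =
      P.map (fun ω => (X ω, Y ω)) {q | f q.1 q.2 ∈ S} := (Measure.map_apply hm hE).symm
  rw [Measure.map_apply hEm hS]
  refine h1.trans ?_
  rw [(indepFun_iff_map_prod_eq_prod_map_map hX.aemeasurable hY.aemeasurable).1 h,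
    Measure.prod_apply hE]
  rfl

/-- Reduces the embedding to a measure on pairs: draw the thresholds from `ρ` independently of `Y`
and apply Fubini. Since the pair is random, convergence is required off one null set of paths
simultaneously for all pairs in `T`. -/
theorem IsStrongMarkov.exists_randomizedThresholdRule {I : Set ℝ} {Ω : Type*}
    {mΩ : MeasurableSpace Ω} {P : Measure Ω} [IsProbabilityMeasure P] {𝓕 : Filtration ℝ≥0 mΩ}
    {κ : Kernel I (ContPath I)} [IsMarkovKernel κ] {Y : Ω → ContPath I}
    (hY : IsStrongMarkov 𝓕 P Y κ) {y : I}
    (h0 : ∀ᵐ ω ∂P, (Y ω).1 0 = y) (hrich : IsRich 𝓕 P Y) {μ : Measure EReal}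
    (ρ : Measure (EReal × EReal)) [IsProbabilityMeasure ρ] {T : Set (EReal × EReal)}
    (hρ : ∀ᵐ p ∂ρ, p ∈ thresholdPairs I y) (hρT : ∀ᵐ p ∂ρ, p ∈ T)
    (hconv : ∀ᵐ w ∂(κ y), ∀ p ∈ T, ExitConv p w)
    (hlaw : ∀ S, MeasurableSet S → ∫⁻ p, κ y {w | exitLim p w ∈ S} ∂ρ = μ S) :
    ∃ σ ∈ randomizedThresholdRules 𝓕 P Y y, P.map (stoppedAt Y σ) = μ := by
  obtain ⟨Θ, hΘ, hΘm, hind, hΘρ⟩ := hrich.exists_pair ρ hρ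
  have hΘ' : Measurable Θ := hΘ.mono (𝓕.le 0) le_rfl
  have hconv' : ∀ᵐ ω ∂P, ExitConv (Θ ω) (Y ω) := by
    rw [← hY.map_eq h0] at hconv
    rw [← hΘρ] at hρT
    filter_upwards [ae_of_ae_map hY.measurable.aemeasurable hconv,
      ae_of_ae_map hΘ'.aemeasurable hρT] with ω h1 h2 using h1 _ h2
  have hst : IsStoppingTime 𝓕 fun ω => exitTime (Θ ω).1 (Θ ω).2 (Y ω) :=
    isStoppingTime_exitTime hY.1 (measurable_fst.comp hΘ) (measurable_snd.comp hΘ)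
  have hrule : (fun ω => exitTime (Θ ω).1 (Θ ω).2 (Y ω)) ∈ allRules 𝓕 P Y := ⟨hst, hconv'⟩
  refine ⟨fun ω => exitTime (Θ ω).1 (Θ ω).2 (Y ω), ⟨hrule, Θ, hΘ, hΘm, hind, rfl⟩, ?_⟩
  have hae : stoppedAt Y (fun ω => exitTime (Θ ω).1 (Θ ω).2 (Y ω)) =ᵐ[P]
      fun ω => exitLim (Θ ω) (Y ω) := hconv'.mono fun ω h => h.exitLim_eq.symm
  ext S hS
  rw [Measure.map_congr hae, ← hlaw S hS, ← hΘρ, ← hY.map_eq h0]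
  exact hind.map_apply_eq_lintegral hΘ' hY.measurable measurable_exitLim hS

/-! ### The embedding of a law by a mixture of two-point laws -/

/-- Here `k (a, b)` stands for the exit law, with weights proportional to `β a` at `b` and `α b` at
`a`. The density `(α b + β a) / Im` cancels the normalization: integrating over `a ∈ L` restores `μ`
on `R`, and integrating over `b ∈ R` gives the fraction `Ip / Im` of `μ` on `L`. The rest of `μ` on
`L` comes from the pairs `(a, r)`, whose exit law is a point mass at `a`, and the atom at `y` from
`(y, y)`. -/
theorem exists_mixture_of_twoPoint {E : Type*} [MeasurableSpace E] [MeasurableSingletonClass E]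
    (μ : Measure E) [IsProbabilityMeasure μ] {L R : Set E} {y r : E} (hL : MeasurableSet L)
    (hR : MeasurableSet R) (hLR : Disjoint L R) (hyL : y ∉ L) (hyR : y ∉ R)
    (hμ : ∀ᵐ z ∂μ, z ∈ L ∨ z = y ∨ z ∈ R) {α β : E → ℝ≥0∞} (hα : Measurable α)
    (hβ : Measurable β) (hle : ∫⁻ z in R, α z ∂μ ≤ ∫⁻ z in L, β z ∂μ)
    (hpos : ∫⁻ z in L, β z ∂μ ≠ 0) (hfin : ∫⁻ z in L, β z ∂μ ≠ ⊤)
    {k : E × E → Set E → ℝ≥0∞} (hkm : ∀ S, MeasurableSet S → Measurable fun p => k p S)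
    (hk : ∀ p, k p univ = 1)
    (hk1 : ∀ a ∈ L, ∀ b ∈ R, α b ≠ ⊤ → ∀ S, MeasurableSet S →
      (α b + β a) * k (a, b) S = β a * S.indicator 1 b + α b * S.indicator 1 a)
    (hk2 : ∫⁻ z in R, α z ∂μ < ∫⁻ z in L, β z ∂μ → ∀ a ∈ L, ∀ S, MeasurableSet S →
      k (a, r) S = S.indicator 1 a)
    (hk3 : ∀ S, MeasurableSet S → k (y, y) S = S.indicator 1 y) :
    ∃ ρ : Measure (E × E), IsProbabilityMeasure ρ ∧
      (∀ᵐ p ∂ρ, (p.1 ∈ L ∨ p.1 = y) ∧ (p.2 ∈ R ∨ p.2 = y ∨ p.2 = r)) ∧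
      ∀ S, MeasurableSet S → ∫⁻ p, k p S ∂ρ = μ S := by
  set Im := ∫⁻ z in L, β z ∂μ
  set Ip := ∫⁻ z in R, α z ∂μ
  set ρ₁ : Measure (E × E) := ((μ.restrict L).prod (μ.restrict R)).withDensity
    fun p => Im⁻¹ * (α p.2 + β p.1) with hρ₁
  set ρ₂ : Measure (E × E) := ((1 - Ip * Im⁻¹) • μ.restrict L).map fun a => (a, r) with hρ₂
  set ρ₃ : Measure (E × E) := μ {y} • Measure.dirac (y, y) with hρ₃
  -- The two-point formula is assumed only for finite `α b`; infinite values, possible at the upper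
  -- end, are null because `Ip` is finite.
  have hαR : ∀ᵐ z ∂(μ.restrict R), α z ≠ ⊤ :=
    (ae_lt_top hα (ne_top_of_le_ne_top hfin hle)).mono fun _ h => h.ne
  have hgm : Measurable fun a : E => (a, r) := measurable_id.prodMk measurable_const
  have hprod : ∀ᵐ p ∂((μ.restrict L).prod (μ.restrict R)), p.1 ∈ L ∧ p.2 ∈ R ∧ α p.2 ≠ ⊤ := by
    filter_upwards [Measure.quasiMeasurePreserving_fst.ae (ae_restrict_mem hL),
      Measure.quasiMeasurePreserving_snd.ae (ae_restrict_mem hR),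
      Measure.quasiMeasurePreserving_snd.ae hαR] with p h1 h2 h3 using ⟨h1, h2, h3⟩
  have hdm : Measurable fun p : E × E => Im⁻¹ * (α p.2 + β p.1) :=
    ((hα.comp measurable_snd).add (hβ.comp measurable_fst)).const_mul _
  have hsplit : ∀ S, MeasurableSet S → μ S = μ (S ∩ R) + μ (S ∩ L) + μ {y} * S.indicator 1 y := by
    intro S hS
    have h1 : μ S = μ (((S ∩ R) ∪ (S ∩ L)) ∪ (S ∩ {y})) := by
      refine measure_congr (hμ.mono fun z hz => propext ?_)
      change z ∈ S ↔ z ∈ ((S ∩ R) ∪ (S ∩ L)) ∪ (S ∩ {y})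
      simp only [mem_union, mem_inter_iff, mem_singleton_iff]
      tauto
    rw [h1, measure_union _ (hS.inter (measurableSet_singleton y)),
      measure_union _ (hS.inter hL)]
    · congr 1
      by_cases h : y ∈ S
      · rw [inter_eq_right.2 (singleton_subset_iff.2 h), indicator_of_mem h, Pi.one_apply, mul_one]
      · rw [indicator_of_notMem h, mul_zero, inter_singleton_eq_empty.2 h, measure_empty]
    · exact (hLR.symm.mono inter_subset_right inter_subset_right)
    · rw [disjoint_union_left]
      constructor
      · refine Set.disjoint_left.2 fun z hz hz' => hyR ?_
        rw [← mem_singleton_iff.1 hz'.2]; exact hz.2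
      · refine Set.disjoint_left.2 fun z hz hz' => hyL ?_
        rw [← mem_singleton_iff.1 hz'.2]; exact hz.2
  have hind : ∀ (S A : Set E), MeasurableSet S →
      ∫⁻ z in A, S.indicator 1 z ∂μ = μ (S ∩ A) := fun S A hS => by
    rw [lintegral_indicator_one hS, Measure.restrict_apply hS]
  have key : ∀ S, MeasurableSet S → ∫⁻ p, k p S ∂(ρ₁ + ρ₂ + ρ₃) = μ S := by
    intro S hS
    have hSm : Measurable (S.indicator (1 : E → ℝ≥0∞)) := measurable_one.indicator hS
    have e1 : ∫⁻ p, k p S ∂ρ₁ = μ (S ∩ R) + Im⁻¹ * (Ip * μ (S ∩ L)) := by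
      rw [hρ₁, lintegral_withDensity_eq_lintegral_mul _ hdm (hkm S hS)]
      calc ∫⁻ p, ((fun p : E × E => Im⁻¹ * (α p.2 + β p.1)) * fun p => k p S) p
            ∂((μ.restrict L).prod (μ.restrict R))
          = ∫⁻ p, Im⁻¹ * (β p.1 * S.indicator 1 p.2 + S.indicator 1 p.1 * α p.2)
            ∂((μ.restrict L).prod (μ.restrict R)) := by
            refine lintegral_congr_ae (hprod.mono fun p hp => ?_)
            change Im⁻¹ * (α p.2 + β p.1) * k p S = _
            rw [mul_assoc, hk1 p.1 hp.1 p.2 hp.2.1 hp.2.2 S hS, mul_comm (α p.2)]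
        _ = Im⁻¹ * (Im * μ (S ∩ R) + μ (S ∩ L) * Ip) := by
            rw [lintegral_const_mul, lintegral_add_left,
              lintegral_prod_mul hβ.aemeasurable hSm.aemeasurable,
              lintegral_prod_mul hSm.aemeasurable hα.aemeasurable, hind S R hS, hind S L hS]
            · exact (hβ.comp measurable_fst).mul (hSm.comp measurable_snd)
            · exact ((hβ.comp measurable_fst).mul (hSm.comp measurable_snd)).add
                ((hSm.comp measurable_fst).mul (hα.comp measurable_snd))
        _ = _ := by
            rw [mul_add, ← mul_assoc, ENNReal.inv_mul_cancel hpos hfin, one_mul,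
              mul_comm (μ (S ∩ L))]
    have e2 : ∫⁻ p, k p S ∂ρ₂ = (1 - Ip * Im⁻¹) * μ (S ∩ L) := by
      rw [hρ₂, lintegral_map (hkm S hS) hgm,
        lintegral_smul_measure, smul_eq_mul]
      rcases hle.eq_or_lt with h | h
      · rw [h, ENNReal.mul_inv_cancel hpos hfin, tsub_self, zero_mul, zero_mul]
      · rw [← hind S L hS]
        congr 1
        exact setLIntegral_congr_fun hL fun a ha => hk2 h a ha S hS
    have e3 : ∫⁻ p, k p S ∂ρ₃ = μ {y} * S.indicator 1 y := by
      rw [hρ₃, lintegral_smul_measure, lintegral_dirac' _ (hkm S hS), hk3 S hS, smul_eq_mul]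
    rw [lintegral_add_measure, lintegral_add_measure, e1, e2, e3, hsplit S hS]
    congr 1
    rw [add_assoc]
    congr 1
    rw [← mul_assoc, ← add_mul, mul_comm Im⁻¹, add_tsub_cancel_of_le, one_mul]
    exact (mul_le_mul_left hle _).trans (ENNReal.mul_inv_cancel hpos hfin).le
  refine ⟨ρ₁ + ρ₂ + ρ₃, ⟨?_⟩, ?_, key⟩
  · have := key univ MeasurableSet.univ
    simpa [hk] using this
  · rw [ae_add_measure_iff, ae_add_measure_iff]
    refine ⟨⟨?_, ?_⟩, ?_⟩
    · refine (withDensity_absolutelyContinuous _ _).ae_le ?_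
      exact hprod.mono fun p hp => ⟨Or.inl hp.1, Or.inl hp.2.1⟩
    · have hset : MeasurableSet {p : E × E | p.1 ∈ L ∧ p.2 = r} :=
        (measurable_fst hL).inter (measurable_snd (measurableSet_singleton r))
      have : ∀ᵐ p ∂ρ₂, p.1 ∈ L ∧ p.2 = r := by
        refine (ae_map_iff hgm.aemeasurable hset).2 ?_
        refine Measure.ae_smul_measure ?_ _
        exact (ae_restrict_mem hL).mono fun a ha => ⟨ha, rfl⟩
      exact this.mono fun p hp => ⟨Or.inl hp.1, Or.inr (Or.inr hp.2)⟩
    · refine Measure.ae_smul_measure ?_ _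
      rw [ae_dirac_eq]
      exact ⟨Or.inr rfl, Or.inr (Or.inl rfl)⟩

/-! ### Embedding laws by randomized threshold rules: the transient case -/

theorem measurable_exitLim_right {I : Set ℝ} (p : EReal × EReal) :
    Measurable (exitLim p : ContPath I → EReal) :=
  Measurable.of_uncurry_left (f := exitLim) measurable_exitLim

theorem exists_mem_between_closedRange {I : Set ℝ} (hI : I.OrdConnected) {x z : EReal}
    (hx : x ∈ closedRange I) (hz : z ∈ closedRange I) (h : x < z) :
    ∃ v : I, x < ((v : ℝ) : EReal) ∧ ((v : ℝ) : EReal) < z := by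
  obtain ⟨m, hxm, hmz⟩ := EReal.lt_iff_exists_real_btwn.1 h
  obtain ⟨_, hj, j, hjI, rfl⟩ := mem_closure_iff.1 hx _ isOpen_Iio hxm
  obtain ⟨_, hi, i, hiI, rfl⟩ := mem_closure_iff.1 hz _ isOpen_Ioi hmz
  exact ⟨⟨m, hI.out hjI hiI ⟨(EReal.coe_lt_coe_iff.1 hj).le, (EReal.coe_lt_coe_iff.1 hi).le⟩⟩,
    hxm, hmz⟩

theorem lintegral_comp_of_twoPoint {W E : Type*} [MeasurableSpace W] [MeasurableSpace E]
    [MeasurableSingletonClass E] {ν : Measure W} {f : W → E} (hf : Measurable f) {a b : E}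
    (hab : a ≠ b) (h : ∀ᵐ w ∂ν, f w = a ∨ f w = b) (g : E → ℝ≥0∞) :
    ∫⁻ w, g (f w) ∂ν = g a * ν (f ⁻¹' {a}) + g b * ν (f ⁻¹' {b}) := by
  have ha : MeasurableSet (f ⁻¹' {a}) := hf (measurableSet_singleton a)
  have hb : MeasurableSet (f ⁻¹' {b}) := hf (measurableSet_singleton b)
  rw [← lintegral_indicator_const ha, ← lintegral_indicator_const hb,
    ← lintegral_add_left (measurable_const.indicator ha)]
  refine lintegral_congr_ae (h.mono fun w hw => ?_)
  change g (f w) = indicator _ _ _ + indicator _ _ _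
  rcases hw with hw | hw
  · rw [indicator_of_mem (show w ∈ f ⁻¹' {a} from hw),
      indicator_of_notMem (show w ∉ f ⁻¹' {b} from fun h => hab (hw.symm.trans h)), add_zero]
    exact congrArg g hw
  · rw [indicator_of_mem (show w ∈ f ⁻¹' {b} from hw),
      indicator_of_notMem (show w ∉ f ⁻¹' {a} from fun h => hab (h.symm.trans hw)), zero_add]
    exact congrArg g hw

theorem measure_preimage_of_ae_eq {W E : Type*} [MeasurableSpace W] {ν : Measure W}
    [IsProbabilityMeasure ν] {f : W → E} {a : E} (h : ∀ᵐ w ∂ν, f w = a) (S : Set E) :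
    ν {w | f w ∈ S} = S.indicator 1 a := by
  by_cases ha : a ∈ S
  · rw [indicator_of_mem ha, Pi.one_apply]
    rw [← measure_univ (μ := ν)]
    exact measure_congr (h.mono fun w hw => propext
      ⟨fun _ => trivial, fun _ => (hw ▸ ha : f w ∈ S)⟩)
  · rw [indicator_of_notMem ha]
    exact measure_eq_zero_iff_ae_notMem.2 (h.mono fun w hw hS => ha (hw ▸ hS))

/-- Total mass one and mean of `Φ` equal to one are two linear equations for the two weights. The
multiplied form avoids a division. -/
theorem mul_measure_preimage_of_twoPoint {W E : Type*} [MeasurableSpace W] [MeasurableSpace E]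
    [MeasurableSingletonClass E] {ν : Measure W} [IsProbabilityMeasure ν] {f : W → E}
    (hf : Measurable f) {a b : E} (hab : a ≠ b) (h : ∀ᵐ w ∂ν, f w = a ∨ f w = b) {Φ : E → ℝ≥0∞}
    (hint : ∫⁻ w, Φ (f w) ∂ν = 1) (ha : Φ a ≤ 1) (hb1 : 1 ≤ Φ b) (hb : Φ b ≠ ⊤) {S : Set E}
    (hS : MeasurableSet S) :
    ((Φ b - 1) + (1 - Φ a)) * ν {w | f w ∈ S} =
      (1 - Φ a) * S.indicator 1 b + (Φ b - 1) * S.indicator 1 a := by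
  have hS' : ν {w | f w ∈ S} = ∫⁻ w, S.indicator 1 (f w) ∂ν := by
    exact (lintegral_indicator_one (hf hS)).symm
  have hone : (1 : ℝ≥0∞) = ν (f ⁻¹' {a}) + ν (f ⁻¹' {b}) := by
    have := lintegral_comp_of_twoPoint hf hab h fun _ => 1
    simpa using this
  rw [lintegral_comp_of_twoPoint hf hab h] at hint
  rw [hS', lintegral_comp_of_twoPoint hf hab h]
  -- Truncated differences are replaced by variables with genuine additive identities, so that the
  -- linear algebra can be done in the reals.
  obtain ⟨A', hA'⟩ : ∃ A', A' = 1 - Φ a := ⟨_, rfl⟩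
  obtain ⟨B', hB'⟩ : ∃ B', B' = Φ b - 1 := ⟨_, rfl⟩
  have hA : Φ a + A' = 1 := by rw [hA', add_tsub_cancel_of_le ha]
  have hB : Φ b = B' + 1 := by rw [hB', tsub_add_cancel_of_le hb1]
  rw [← hA', ← hB']
  have hA't : A' ≠ ⊤ := by rw [hA']; simp
  have hB't : B' ≠ ⊤ := by rw [hB']; exact ENNReal.sub_ne_top hb
  have hat : Φ a ≠ ⊤ := ne_top_of_le_ne_top ENNReal.one_ne_top ha
  have hp : ν (f ⁻¹' {a}) ≠ ⊤ := measure_ne_top _ _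
  have hq : ν (f ⁻¹' {b}) ≠ ⊤ := measure_ne_top _ _
  rw [hB] at hint
  clear hA' hB' hB hb hb1 ha
  generalize ν (f ⁻¹' {a}) = p at *
  generalize ν (f ⁻¹' {b}) = q at *
  generalize Φ a = A at *
  lift A to ℝ≥0 using hat
  lift p to ℝ≥0 using hp
  lift q to ℝ≥0 using hq
  lift A' to ℝ≥0 using hA't
  lift B' to ℝ≥0 using hB't
  norm_cast at hint hone hA
  have h1 : (B' + A') * p = B' := by
    apply NNReal.coe_injective
    replace hint := congrArg NNReal.toReal hint
    replace hone := congrArg NNReal.toReal hone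
    replace hA := congrArg NNReal.toReal hA
    push_cast at *
    linear_combination (-1 : ℝ) * hint + p * hA - (1 + B') * hone
  have h2 : (B' + A') * q = A' := by
    apply NNReal.coe_injective
    replace h1 := congrArg NNReal.toReal h1
    replace hone := congrArg NNReal.toReal hone
    push_cast at *
    linear_combination (-1 : ℝ) * h1 - (B' + A') * hone
  have h1' : ((B' : ℝ≥0∞) + A') * p = B' := by exact_mod_cast h1
  have h2' : ((B' : ℝ≥0∞) + A') * q = A' := by exact_mod_cast h2
  calc ((B' : ℝ≥0∞) + A') * (S.indicator 1 a * p + S.indicator 1 b * q)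
      = S.indicator 1 b * ((B' + A') * q) + S.indicator 1 a * ((B' + A') * p) := by ring
    _ = _ := by rw [h1', h2']; ring

section Diffusion

variable {I : Set ℝ} {κ : Kernel I (ContPath I)}

theorem scaleE_lt (hκ : IsRegularDiffusion I κ) (hT : ∀ a b : I, a < b → κ a (hit b) < 1)
    {c : I} (hc : (c : ℝ) ∈ interior I) {x z : EReal} (hx : x ∈ closedRange I)
    (hz : z ∈ closedRange I) (h : x < z) : scaleE κ c x < scaleE κ c z := by
  obtain ⟨v, hxv, hvz⟩ := exists_mem_between_closedRange hκ.ordConnected hx hz h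
  obtain ⟨u, hvu, huz⟩ :=
    exists_mem_between_closedRange hκ.ordConnected (coe_mem_closedRange v) hz hvz
  calc scaleE κ c x ≤ scaleE κ c ((v : ℝ) : EReal) := scaleE_mono κ c hxv.le
    _ = scaleFun κ c v := scaleE_coe hκ hc v
    _ < scaleFun κ c u := scaleFun_lt hκ hT hc (EReal.coe_lt_coe_iff.1 hvu)
    _ ≤ scaleE κ c z := scaleFun_le_scaleE huz.le

theorem scaleE_eq_top_of_le (κ : Kernel I (ContPath I)) (c : I) {l : EReal}
    (h : ∀ v : I, ((v : ℝ) : EReal) ≤ l) : scaleE κ c l = scaleE κ c ⊤ :=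
  le_antisymm (scaleE_mono κ c le_top) (iSup₂_le fun _ _ => scaleFun_le_scaleE (h _))

theorem exists_coe_eq_or_forall_le (hI : I.OrdConnected) {y : I} {b : EReal}
    (h : ((y : ℝ) : EReal) ≤ b) :
    (∃ v : I, y ≤ v ∧ b = ((v : ℝ) : EReal)) ∨ ∀ v : I, ((v : ℝ) : EReal) ≤ b := by
  by_contra! hn
  obtain ⟨hn, v, hv⟩ := hn
  induction b with
  | bot => simp at h
  | top => simp at hv
  | coe b =>
    have h1 := EReal.coe_le_coe_iff.1 h
    exact hn ⟨b, hI.out y.2 v.2 ⟨h1, (EReal.coe_lt_coe_iff.1 hv).le⟩⟩ h1 rfl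

theorem IsRegularDiffusion.ae_isTransientPath (hκ : IsRegularDiffusion I κ)
    (hT : ∀ a b : I, a < b → κ a (hit b) < 1) (y : I) : ∀ᵐ w ∂κ y, IsTransientPath w :=
  (hκ.strongMarkov y).ae_isTransientPath hκ hT

theorem IsRegularDiffusion.ae_exitValue (hκ : IsRegularDiffusion I κ)
    (hT : ∀ a b : I, a < b → κ a (hit b) < 1) {y : I} {p : EReal × EReal}
    (hp : p ∈ thresholdPairs I y) :
    ∀ᵐ w ∂κ y, exitValue p w = p.1 ∨ exitValue p w = p.2 := by
  filter_upwards [hκ.ae_isTransientPath hT y, hκ.start y] with w h1 h2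
  exact h1.exitValue_eq h2 hp

theorem isStoppingTime_exitTime_id (a b : EReal) :
    IsStoppingTime (canonicalFiltration I) (exitTime a b : ContPath I → WithTop ℝ≥0) :=
  isStoppingTime_exitTime (Y := id) (A := fun _ => a) (B := fun _ => b)
    (fun t => (Filtration.stronglyAdapted_natural (u := fun t (w : ContPath I) => w.1 t)
      (fun s => (measurable_coord s).stronglyMeasurable) t).measurable)
    measurable_const measurable_const

/-- An upper threshold in `I` caps the scale function, so the truncated identity applies. Otherwise
the threshold lies above all of `I`, and its finite scale means that the scale function is bounded.
-/
theorem lintegral_scaleE_exitValue (hκ : IsRegularDiffusion I κ)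
    (hT : ∀ a b : I, a < b → κ a (hit b) < 1) {y : I} (hy : (y : ℝ) ∈ interior I)
    {c : I} (hc : (c : ℝ) ∈ interior I) {p : EReal × EReal} (hp : p ∈ thresholdPairs I y)
    (hfin : scaleE κ c p.2 ≠ ⊤) :
    ∫⁻ w, scaleE κ c (exitValue p w) ∂κ y = scaleFun κ c y := by
  rcases exists_coe_eq_or_forall_le hκ.ordConnected hp.2.1 with ⟨v, hv, hb⟩ | hb
  · have := hκ.isMarkovKernel
    rw [← lintegral_min_scaleE_exitTime hκ hT (hκ.strongMarkov y) hy (hκ.start y) hc p.1 hv]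
    refine lintegral_congr_ae ((hκ.ae_exitValue hT hp).mono fun w hw => ?_)
    have hpe : p = (p.1, ((v : ℝ) : EReal)) := Prod.ext rfl hb
    have hle : exitValue p w ≤ ((v : ℝ) : EReal) := by
      rcases hw with hw | hw
      · rw [hw]; exact hp.1.1.trans (EReal.coe_le_coe_iff.2 hv)
      · rw [hw, hb]
    rw [hpe] at hle ⊢
    exact (min_eq_left ((scaleE_mono κ c hle).trans (scaleE_coe hκ hc v).le)).symm
  · rw [scaleE_eq_top_of_le κ c hb] at hfin
    have := hκ.isMarkovKernel
    exact lintegral_scaleE_eq hκ hT (hκ.strongMarkov y) hy (hκ.start y) hc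
      (isStoppingTime_exitTime_id p.1 p.2) hfin

theorem lintegral_scaleE_exitValue_le (hκ : IsRegularDiffusion I κ)
    (hT : ∀ a b : I, a < b → κ a (hit b) < 1) {y : I} (hy : (y : ℝ) ∈ interior I)
    {c : I} (hc : (c : ℝ) ∈ interior I) (p : EReal × EReal) :
    ∫⁻ w, scaleE κ c (exitValue p w) ∂κ y ≤ scaleFun κ c y :=
  have := hκ.isMarkovKernel
  lintegral_scaleE_le hκ hT (hκ.strongMarkov y) hy (hκ.start y) hc
    (isStoppingTime_exitTime_id p.1 p.2)

theorem ExitConv.of_isTransientPath {w : ContPath I} (h : IsTransientPath w) (p : EReal × EReal) :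
    ExitConv p w :=
  IsTransientPath.exists_tendsto (Y := id) (τ := exitTime p.1 p.2) h

variable {Ω : Type*} {mΩ : MeasurableSpace Ω} {P : Measure Ω} [IsProbabilityMeasure P]
  {𝓕 : Filtration ℝ≥0 mΩ} {Y : Ω → ContPath I}

/-- The scale function is normalized at `y`, so `Φ - 1` and `1 - Φ`, as truncated differences, are
the positive and negative parts of its deviation from the initial value. `E[Φ(Y_τ)] ≤ 1` says that
the positive part has the smaller integral. -/
theorem exists_randomizedThresholdRule_of_transient (hκ : IsRegularDiffusion I κ)
    (hT : ∀ a b : I, a < b → κ a (hit b) < 1) (hY : IsStrongMarkov 𝓕 P Y κ) {y : I}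
    (hy : (y : ℝ) ∈ interior I) (h0 : ∀ᵐ ω ∂P, (Y ω).1 0 = y) (hrich : IsRich 𝓕 P Y)
    {τ : Ω → WithTop ℝ≥0} (hτ : τ ∈ allRules 𝓕 P Y) :
    ∃ σ ∈ randomizedThresholdRules 𝓕 P Y y, P.map (stoppedAt Y σ) = P.map (stoppedAt Y τ) := by
  have hMk := hκ.isMarkovKernel
  have hconv : ∀ᵐ w ∂(κ y), ∀ p ∈ (univ : Set (EReal × EReal)), ExitConv p w :=
    (hκ.ae_isTransientPath hT y).mono fun w hw p _ => ExitConv.of_isTransientPath hw p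
  have hlim : ∀ p, ∀ᵐ w ∂κ y, exitLim p w = exitValue p w := fun p =>
    hconv.mono fun w hw => (hw p (mem_univ p)).exitLim_eq
  have hEm : ∀ p : EReal × EReal, Measurable (exitLim p : ContPath I → EReal) := fun p =>
    measurable_exitLim_right p
  have hval : ∀ p ∈ thresholdPairs I y, ∀ᵐ w ∂κ y, exitLim p w = p.1 ∨ exitLim p w = p.2 :=
    fun p hp => by
      filter_upwards [hlim p, hκ.ae_exitValue hT hp] with w h1 h2
      rwa [h1]
  have hτm := aemeasurable_stoppedAt hY.measurable hτ
  have hμp := Measure.isProbabilityMeasure_map hτm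
  have hμI : ∀ᵐ z ∂P.map (stoppedAt Y τ), z ∈ closedRange I :=
    (ae_map_iff hτm isClosed_closure.measurableSet).2 (stoppedAt_mem_closedRange hτ)
  have hΦm : Measurable (scaleE κ y) := (scaleE_mono κ y).measurable
  have hΦle : ∫⁻ z, scaleE κ y z ∂P.map (stoppedAt Y τ) ≤ 1 := by
    rw [lintegral_map' hΦm.aemeasurable hτm, ← scaleFun_self hκ y]
    exact lintegral_scaleE_le hκ hT hY hy h0 hy hτ.1
  have hΦeq : ∫⁻ z, scaleE κ y z ∂P.map (stoppedAt Y τ) ≠ 1 → scaleE κ y ⊤ = ⊤ := by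
    rw [lintegral_map' hΦm.aemeasurable hτm, ← scaleFun_self hκ y]
    exact not_imp_comm.1 (lintegral_scaleE_eq hκ hT hY hy h0 hy hτ.1)
  generalize P.map (stoppedAt Y τ) = μ at *
  set Φ := scaleE κ y with hΦ
  set L : Set EReal := closedRange I ∩ Iio ((y : ℝ) : EReal) with hL
  set R : Set EReal := closedRange I ∩ Ioi ((y : ℝ) : EReal) with hR
  have hLm : MeasurableSet L := isClosed_closure.measurableSet.inter measurableSet_Iio
  have hRm : MeasurableSet R := isClosed_closure.measurableSet.inter measurableSet_Ioi
  have hy1 : Φ ((y : ℝ) : EReal) = 1 := (scaleE_coe hκ hy y).trans (scaleFun_self hκ y)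
  have hΦL : ∀ z ∈ L, Φ z < 1 := fun z hz => by
    rw [← hy1]; exact scaleE_lt hκ hT hy hz.1 (coe_mem_closedRange y) hz.2
  have hΦR : ∀ z ∈ R, 1 < Φ z := fun z hz => by
    rw [← hy1]; exact scaleE_lt hκ hT hy (coe_mem_closedRange y) hz.1 hz.2
  have hμ : ∀ᵐ z ∂μ, z ∈ L ∨ z = ((y : ℝ) : EReal) ∨ z ∈ R := hμI.mono fun z hz => by
    rcases lt_trichotomy z ((y : ℝ) : EReal) with h | h | h
    · exact Or.inl ⟨hz, h⟩
    · exact Or.inr (Or.inl h)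
    · exact Or.inr (Or.inr ⟨hz, h⟩)
  have hIp : ∫⁻ z in R, (Φ z - 1) ∂μ = ∫⁻ z, (Φ z - 1) ∂μ := by
    rw [← lintegral_indicator hRm]
    refine lintegral_congr_ae (hμ.mono fun z hz => ?_)
    rcases hz with h | h | h
    · rw [indicator_of_notMem (fun h' : z ∈ _ => lt_asymm (mem_Iio.1 h.2) (mem_Ioi.1 h'.2))]
      exact (tsub_eq_zero_of_le (hΦL z h).le).symm
    · rw [indicator_of_notMem (fun h' => (mem_Ioi.1 h'.2).ne' h), h]
      exact (tsub_eq_zero_of_le hy1.le).symm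
    · exact indicator_of_mem h _
  have hIm : ∫⁻ z in L, (1 - Φ z) ∂μ = ∫⁻ z, (1 - Φ z) ∂μ := by
    rw [← lintegral_indicator hLm]
    refine lintegral_congr_ae (hμ.mono fun z hz => ?_)
    rcases hz with h | h | h
    · exact indicator_of_mem h _
    · rw [indicator_of_notMem (fun h' => (mem_Iio.1 h'.2).ne h), h]
      exact (tsub_eq_zero_of_le hy1.ge).symm
    · rw [indicator_of_notMem (fun h' : z ∈ _ => lt_asymm (mem_Iio.1 h'.2) (mem_Ioi.1 h.2))]
      exact (tsub_eq_zero_of_le (hΦR z h).le).symm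
  -- Both integrands are `max Φ 1`; this turns comparisons of `∫ Φ` with `1` into comparisons of the
  -- two parts.
  have hid : ∫⁻ z, (Φ z - 1) ∂μ + 1 = ∫⁻ z, (1 - Φ z) ∂μ + ∫⁻ z, Φ z ∂μ := by
    rw [← lintegral_add_right _ hΦm]
    calc ∫⁻ z, (Φ z - 1) ∂μ + 1 = ∫⁻ z, (Φ z - 1 + 1) ∂μ := by
          rw [lintegral_add_right _ measurable_const]; simp
      _ = _ := by simp only [tsub_add_eq_max, max_comm]
  have hImfin : ∫⁻ z in L, (1 - Φ z) ∂μ ≠ ⊤ := by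
    rw [hIm]
    refine ne_top_of_le_ne_top ENNReal.one_ne_top ((lintegral_mono fun z => tsub_le_self).trans ?_)
    simp
  have hle : ∫⁻ z in R, (Φ z - 1) ∂μ ≤ ∫⁻ z in L, (1 - Φ z) ∂μ := by
    rw [hIp, hIm]
    refine (ENNReal.add_le_add_iff_right ENNReal.one_ne_top).1 ?_
    rw [hid]
    exact add_le_add_right hΦle _
  have hlt : ∫⁻ z in R, (Φ z - 1) ∂μ < ∫⁻ z in L, (1 - Φ z) ∂μ → Φ ⊤ = ⊤ := fun h => by
    refine hΦeq fun h1 => ?_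
    rw [hIp, hIm] at h
    rw [h1] at hid
    exact h.ne ((ENNReal.add_left_inj ENNReal.one_ne_top).1 hid)
  have hyD := self_mem_thresholdPairs (I := I) y
  have hk3 : ∀ S : Set EReal,
      κ y {w | exitLim (((y : ℝ) : EReal), ((y : ℝ) : EReal)) w ∈ S} =
        S.indicator 1 ((y : ℝ) : EReal) := fun S =>
    measure_preimage_of_ae_eq ((hval _ hyD).mono fun w hw => hw.elim id id) S
  -- If the negative part vanishes then so does the positive one, and `μ` is the point mass at `y`.
  by_cases hpos : ∫⁻ z in L, (1 - Φ z) ∂μ = 0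
  · have hβ : ∀ᵐ z ∂μ, 1 - Φ z = 0 :=
      (lintegral_eq_zero_iff (measurable_const.sub hΦm)).1 (hIm ▸ hpos)
    have hα : ∀ᵐ z ∂μ, Φ z - 1 = 0 := by
      refine (lintegral_eq_zero_iff (hΦm.sub measurable_const)).1 ?_
      exact le_antisymm (hIp ▸ hle.trans hpos.le) zero_le
    have hμy : ∀ᵐ z ∂μ, z = ((y : ℝ) : EReal) := by
      filter_upwards [hμ, hα, hβ] with z hz h1 h2
      rcases hz with h | h | h
      · exact absurd (tsub_eq_zero_iff_le.1 h2) (not_le.2 (hΦL z h))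
      · exact h
      · exact absurd (tsub_eq_zero_iff_le.1 h1) (not_le.2 (hΦR z h))
    refine hY.exists_randomizedThresholdRule h0 hrich
      (Measure.dirac (((y : ℝ) : EReal), ((y : ℝ) : EReal))) (T := univ) ?_ ?_ hconv ?_
    · rw [ae_dirac_eq]; exact hyD
    · exact Eventually.of_forall fun _ => mem_univ _
    · intro S hS
      rw [lintegral_dirac, hk3 S]
      exact (measure_preimage_of_ae_eq (f := id) hμy S).symm
  · have hyR : ((y : ℝ) : EReal) ∈ closedRange I := coe_mem_closedRange y
    set r := sSup (closedRange I) with hr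
    have hrI : r ∈ closedRange I :=
      (isClosed_closure.isCompact (X := EReal)).sSup_mem ⟨_, hyR⟩
    have hyr : ((y : ℝ) : EReal) ≤ r := le_sSup hyR
    have hkm : ∀ S : Set EReal, MeasurableSet S →
        Measurable fun p : EReal × EReal => κ y {w | exitLim p w ∈ S} := fun S hS =>
      measurable_measure_prodMk_left (measurable_exitLim hS)
    have hk1 : ∀ a ∈ L, ∀ b ∈ R, Φ b - 1 ≠ ⊤ → ∀ S, MeasurableSet S →
        ((Φ b - 1) + (1 - Φ a)) * κ y {w | exitLim (a, b) w ∈ S} =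
          (1 - Φ a) * S.indicator 1 b + (Φ b - 1) * S.indicator 1 a := by
      intro a ha b hb hbt S hS
      have hp : (a, b) ∈ thresholdPairs I y := ⟨⟨(mem_Iio.1 ha.2).le, ha.1⟩,
        ⟨(mem_Ioi.1 hb.2).le, hb.1⟩⟩
      have hbt' : Φ b ≠ ⊤ := fun h => hbt (by simp [h])
      refine mul_measure_preimage_of_twoPoint (hEm (a, b))
        ((mem_Iio.1 ha.2).trans (mem_Ioi.1 hb.2)).ne (hval _ hp)
        ?_ (hΦL a ha).le (hΦR b hb).le hbt' hS
      rw [← scaleFun_self hκ y, ← lintegral_scaleE_exitValue hκ hT hy hy hp hbt']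
      exact lintegral_congr_ae ((hlim (a, b)).mono fun w hw => congrArg Φ hw)
    have hk2 : ∫⁻ z in R, (Φ z - 1) ∂μ < ∫⁻ z in L, (1 - Φ z) ∂μ → ∀ a ∈ L, ∀ S,
        MeasurableSet S → κ y {w | exitLim (a, r) w ∈ S} = S.indicator 1 a := by
      intro h a ha S hS
      have hp : (a, r) ∈ thresholdPairs I y := ⟨⟨(mem_Iio.1 ha.2).le, ha.1⟩, ⟨hyr, hrI⟩⟩
      -- The scale is infinite at the upper end `r`, while its mean at the exit is finite, so the
      -- exit cannot be at `r` with positive probability.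
      have hrt : Φ r = ⊤ :=
        (scaleE_eq_top_of_le κ y fun v => le_sSup (coe_mem_closedRange v)).trans (hlt h)
      have hfin : ∫⁻ w, Φ (exitLim (a, r) w) ∂κ y ≠ ⊤ := by
        rw [lintegral_congr_ae ((hlim (a, r)).mono fun w hw => congrArg Φ hw)]
        exact ne_top_of_le_ne_top (scaleFun_ne_top hκ hy y)
          (lintegral_scaleE_exitValue_le hκ hT hy hy (a, r))
      refine measure_preimage_of_ae_eq ?_ S
      filter_upwards [hval _ hp, ae_lt_top (hΦm.comp (hEm (a, r))) hfin] with w h1 h2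
      refine h1.resolve_right fun h3 => h2.ne ?_
      change Φ (exitLim (a, r) w) = ⊤
      rw [h3, hrt]
    obtain ⟨ρ, hρp, hρ, hlaw⟩ := exists_mixture_of_twoPoint μ (L := L) (R := R)
      (y := ((y : ℝ) : EReal)) (r := r) hLm hRm
      (Set.disjoint_left.2 fun z h h' => lt_asymm (mem_Iio.1 h.2) (mem_Ioi.1 h'.2))
      (fun h => lt_irrefl _ (mem_Iio.1 h.2))
      (fun h => lt_irrefl _ (mem_Ioi.1 h.2)) hμ (α := fun z => Φ z - 1) (β := fun z => 1 - Φ z)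
      (hΦm.sub measurable_const) (measurable_const.sub hΦm) hle hpos hImfin
      (k := fun p S => κ y {w | exitLim p w ∈ S}) hkm (fun p => by simp)
      hk1 hk2 (fun S _ => hk3 S)
    · refine hY.exists_randomizedThresholdRule h0 hrich ρ (T := univ) (hρ.mono ?_)
        (Eventually.of_forall fun _ => mem_univ _) hconv hlaw
      rintro ⟨a, b⟩ ⟨ha, hb⟩
      refine ⟨?_, ?_⟩
      · rcases ha with ha | ha
        · exact ⟨(mem_Iio.1 ha.2).le, ha.1⟩
        · exact ⟨ha.le, ha ▸ hyR⟩
      · rcases hb with hb | hb | hb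
        · exact ⟨(mem_Ioi.1 hb.2).le, hb.1⟩
        · exact ⟨hb.ge, hb ▸ hyR⟩
        · exact ⟨hb ▸ hyr, hb ▸ hrI⟩

end Diffusion

/-! ### Stopping rules for the reflected process -/

theorem exitTime_negPath {I : Set ℝ} (a b : EReal) (w : ContPath I) :
    exitTime a b (negPath w) = exitTime (-b) (-a) w := by
  have h : ∀ t, coordProcess (id : ContPath (negSet I) → _) t (negPath w) ∈ (Ioo a b)ᶜ ↔
      coordProcess (id : ContPath I → _) t w ∈ (Ioo (-b) (-a))ᶜ := fun t => by
    have : coordProcess (id : ContPath (negSet I) → _) t (negPath w) =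
      -(coordProcess (id : ContPath I → _) t w) := EReal.coe_neg _
    rw [this, mem_compl_iff, mem_compl_iff, mem_Ioo, mem_Ioo, EReal.lt_neg_comm,
      EReal.neg_lt_comm, and_comm]
  simp only [exitTime, hittingAfter, h]
  congr 1
  simp only [h]

theorem neg_mem_closedRange {I : Set ℝ} {z : EReal} (hz : z ∈ closedRange (negSet I)) :
    -z ∈ closedRange I := by
  have : MapsTo (fun z : EReal => -z) ((fun r : ℝ => (r : EReal)) '' negSet I)
      ((fun r : ℝ => (r : EReal)) '' I) := by
    rintro _ ⟨r, hr, rfl⟩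
    exact ⟨-r, hr, EReal.coe_neg _⟩
  exact this.closure continuous_neg hz

section Reflection

variable {I : Set ℝ} {Ω : Type*} {mΩ : MeasurableSpace Ω} {P : Measure Ω}
  {𝓕 : Filtration ℝ≥0 mΩ} {Y : Ω → ContPath I}

theorem stoppedProcess_negPath (τ : Ω → WithTop ℝ≥0) (t : ℝ≥0) (ω : Ω) :
    stoppedProcess (coordProcess fun ω => negPath (Y ω)) τ t ω =
      -(stoppedProcess (coordProcess Y) τ t ω) := EReal.coe_neg _

theorem mem_allRules_negPath {τ : Ω → WithTop ℝ≥0} :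
    τ ∈ allRules 𝓕 P (fun ω => negPath (Y ω)) ↔ τ ∈ allRules 𝓕 P Y := by
  simp only [allRules, mem_ofPred_eq, stoppedProcess_negPath]
  refine and_congr_right fun _ => eventually_congr (Eventually.of_forall fun ω => ?_)
  constructor
  · rintro ⟨l, hl⟩
    exact ⟨-l, by simpa [Function.comp_def] using ((continuous_neg (G := EReal)).tendsto _).comp hl⟩
  · rintro ⟨l, hl⟩
    exact ⟨-l, (continuous_neg (G := EReal)).tendsto _ |>.comp hl⟩

theorem map_stoppedAt_negPath (hY : Measurable Y) {τ : Ω → WithTop ℝ≥0}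
    (hτ : τ ∈ allRules 𝓕 P Y) :
    P.map (stoppedAt (fun ω => negPath (Y ω)) τ) = (P.map (stoppedAt Y τ)).map fun z => -z := by
  rw [AEMeasurable.map_map_of_aemeasurable (measurable_neg (G := EReal)).aemeasurable
    (aemeasurable_stoppedAt hY hτ)]
  refine Measure.map_congr ?_
  filter_upwards [tendsto_stoppedAt hτ] with ω hω
  have := ((continuous_neg (G := EReal)).tendsto _).comp hω
  rw [stoppedAt]
  simp only [stoppedProcess_negPath]
  exact this.limsup_eq

theorem map_stoppedAt_eq_of_negPath (hY : Measurable Y) {σ τ : Ω → WithTop ℝ≥0}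
    (hσ : σ ∈ allRules 𝓕 P Y) (hτ : τ ∈ allRules 𝓕 P Y)
    (h : P.map (stoppedAt (fun ω => negPath (Y ω)) σ) =
      P.map (stoppedAt (fun ω => negPath (Y ω)) τ)) :
    P.map (stoppedAt Y σ) = P.map (stoppedAt Y τ) := by
  rw [map_stoppedAt_negPath hY hσ, map_stoppedAt_negPath hY hτ] at h
  have h2 := congrArg (Measure.map fun z : EReal => -z) h
  have hm := measurable_neg (G := EReal)
  rw [Measure.map_map hm hm, Measure.map_map hm hm] at h2
  simpa [Function.comp_def] using h2

theorem randomizedThresholdRules_negPath_subset (y : I) :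
    randomizedThresholdRules 𝓕 P (fun ω => negPath (Y ω)) (negPt y) ⊆
      randomizedThresholdRules 𝓕 P Y y := by
  rintro _ ⟨hall, Θ, hΘ, hmem, hind, rfl⟩
  have hg : Measurable fun p : EReal × EReal => (-p.2, -p.1) :=
    measurable_snd.neg.prodMk measurable_fst.neg
  refine ⟨mem_allRules_negPath.1 hall, fun ω => (-(Θ ω).2, -(Θ ω).1), hg.comp hΘ, fun ω => ?_, ?_,
    funext fun ω => exitTime_negPath _ _ _⟩
  · obtain ⟨⟨h1, h2⟩, h3, h4⟩ := hmem ω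
    have hcoe : (((negPt y : negSet I) : ℝ) : EReal) = -((y : ℝ) : EReal) := EReal.coe_neg _
    rw [hcoe] at h1 h3
    exact ⟨⟨EReal.neg_le.1 h3, neg_mem_closedRange h4⟩,
      ⟨EReal.le_neg.1 h1, neg_mem_closedRange h2⟩⟩
  · have h1 := hind.comp hg (measurable_negPath (I := negSet I))
    -- Independence passes back because the path is a measurable function of its reflection. A
    -- second `negPath` would land in `negSet (negSet I)`, so the inverse is written out.
    have hinv : ∀ w : ContPath I, (⟨fun t => unnegPt ((negPath w).1 t), by
        simpa [negPath_apply] using w.2⟩ : ContPath I) = w := fun w =>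
      Subtype.ext (funext fun t => unnegPt_negPt _)
    have hu : Measurable fun w : ContPath (negSet I) =>
        (⟨fun t => unnegPt (w.1 t), (continuous_subtype_val.neg.subtype_mk _).comp w.2⟩ :
          ContPath I) :=
      measurable_path fun t => measurable_unnegPt.comp (measurable_coord t)
    have h2 := hind.comp hg hu
    refine h2.congr (Eventually.of_forall fun _ => rfl) (Eventually.of_forall fun ω => ?_)
    exact hinv (Y ω)

theorem IsRich.negPath (h : IsRich 𝓕 P Y) : IsRich 𝓕 P fun ω => OptStop.negPath (Y ω) := by
  obtain ⟨U, hU, hat, hind⟩ := h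
  exact ⟨U, hU, hat, hind.comp measurable_id measurable_negPath⟩

end Reflection

/-! ### Embedding laws by randomized threshold rules: the recurrent case -/

/-- The path visits every level at arbitrarily late times. -/
def IsRecurrentPath {I : Set ℝ} (w : ContPath I) : Prop := ∀ (v : I) (t : ℝ≥0), ∃ s ≥ t, w.1 s = v

section Diffusion

variable {I : Set ℝ} {κ : Kernel I (ContPath I)} {Ω : Type*} {mΩ : MeasurableSpace Ω}
  {P : Measure Ω} [IsProbabilityMeasure P] {𝓕 : Filtration ℝ≥0 mΩ} {Y : Ω → ContPath I}

/-- A countable cofinal set of levels is visited after every integer time; all other levels follow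
by the intermediate value theorem. -/
theorem IsStrongMarkov.ae_isRecurrentPath (hκ : IsRegularDiffusion I κ)
    (hR : ∀ a b : I, κ a (hit b) = 1) (hY : IsStrongMarkov 𝓕 P Y κ) :
    ∀ᵐ ω ∂P, IsRecurrentPath (Y ω) := by
  obtain ⟨S, hS, hlo, hhi⟩ := exists_countable_cofinal hκ.ordConnected
  have h1 : ∀ᵐ ω ∂P, ∀ a ∈ S, ∀ n : ℕ, shift (n : ℝ≥0) (Y ω) ∈ hit a := by
    refine (ae_ball_iff hS).2 fun a _ => ae_all_iff.2 fun n => ?_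
    have := hY.measure_shift_const (n : ℝ≥0) (A := univ) MeasurableSet.univ (measurableSet_hit a)
    simp only [univ_inter, hR, lintegral_const, Measure.restrict_univ, measure_univ,
      mul_one] at this
    have hm : MeasurableSet {ω | shift (n : ℝ≥0) (Y ω) ∈ hit a} :=
      measurable_shift_comp hY.measurable measurable_const (measurableSet_hit a)
    exact (mem_ae_iff_prob_eq_one hm).2 this
  filter_upwards [h1] with ω hω v t
  obtain ⟨n, hn⟩ := exists_nat_ge t
  obtain ⟨a, ha, hav⟩ := hlo v
  obtain ⟨b, hb, hvb⟩ := hhi v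
  obtain ⟨s, hs⟩ := hω a ha n
  obtain ⟨u, hu⟩ := hω b hb n
  rw [shift_apply] at hs hu
  obtain ⟨x, hx, hxv⟩ := exists_mid_of_le (hs.le.trans hav) (hvb.trans hu.ge)
  refine ⟨x, hn.trans (le_trans ?_ hx.1), hxv⟩
  exact le_inf le_self_add le_self_add

theorem IsRecurrentPath.not_tendsto {w : ContPath I} (h : IsRecurrentPath w) {a b : I}
    (hab : a ≠ b) (l : EReal) : ¬ Tendsto (fun t => ((w.1 t : ℝ) : EReal)) atTop (𝓝 l) := by
  intro hl
  have key : ∀ v : I, ((v : ℝ) : EReal) = l := fun v => by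
    by_contra hne
    obtain ⟨T, hT⟩ := eventually_atTop.1 (hl.eventually_ne (Ne.symm hne))
    obtain ⟨s, hs, hv⟩ := h v T
    exact hT s hs (by rw [hv])
  exact hab (Subtype.ext (EReal.coe_eq_coe_iff.1 ((key a).trans (key b).symm)))

theorem IsRecurrentPath.exitTime_ne_top {w : ContPath I} (h : IsRecurrentPath w)
    {p : EReal × EReal} (hp : ∃ v : I, p.1 = ((v : ℝ) : EReal) ∨ p.2 = ((v : ℝ) : EReal)) :
    exitTime p.1 p.2 w ≠ ⊤ := by
  obtain ⟨v, hv⟩ := hp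
  obtain ⟨s, -, hs⟩ := h v 0
  intro htop
  have := exitTime_eq_top_iff.1 htop s
  rw [hs] at this
  rcases hv with hv | hv
  · exact this.1.ne hv
  · exact this.2.ne hv.symm

/-- No path converges, so `τ` is finite almost surely and `μ` lives on `I`. Every level of `I` is
surely reached, so it suffices to draw one from `μ` and wait for it. -/
theorem exists_randomizedThresholdRule_of_recurrent (hκ : IsRegularDiffusion I κ)
    (hR : ∀ a b : I, κ a (hit b) = 1) (hY : IsStrongMarkov 𝓕 P Y κ) {y : I}
    (hy : (y : ℝ) ∈ interior I) (h0 : ∀ᵐ ω ∂P, (Y ω).1 0 = y) (hrich : IsRich 𝓕 P Y)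
    {τ : Ω → WithTop ℝ≥0} (hτ : τ ∈ allRules 𝓕 P Y) :
    ∃ σ ∈ randomizedThresholdRules 𝓕 P Y y, P.map (stoppedAt Y σ) = P.map (stoppedAt Y τ) := by
  classical
  have hMk := hκ.isMarkovKernel
  obtain ⟨b, hb⟩ := exists_gt_of_mem_interior hy
  -- A point outside the interior would be absorbing and could not reach other levels.
  have hint : ∀ z : I, (z : ℝ) ∈ interior I := fun z => by
    by_contra hz
    obtain ⟨v, hv⟩ : ∃ v, v ≠ z := by
      by_contra! hn
      exact hb.ne ((hn y).trans (hn b).symm)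
    exact one_ne_zero ((hR z v).symm.trans (measure_hit_of_notMem_interior hκ hz hv))
  have hIo : IsOpen I := by
    rw [← subset_interior_iff_isOpen]; exact fun z hz => hint ⟨z, hz⟩
  set J : Set EReal := (fun r : ℝ => (r : EReal)) '' I with hJ
  have hJm : MeasurableSet J := (EReal.isOpenEmbedding_coe.isOpenMap _ hIo).measurableSet
  have hτm := aemeasurable_stoppedAt hY.measurable hτ
  have hμp := Measure.isProbabilityMeasure_map hτm
  have hμJ : ∀ᵐ z ∂P.map (stoppedAt Y τ), z ∈ J := by
    refine (ae_map_iff hτm hJm).2 ?_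
    filter_upwards [hτ.2, hY.ae_isRecurrentPath hκ hR] with ω ⟨l, hl⟩ h2
    by_cases h : τ ω = ⊤
    · exact absurd ((tendsto_stoppedProcess_iff_of_eq_top h).1 hl) (h2.not_tendsto hb.ne l)
    · obtain ⟨s, hs⟩ := WithTop.ne_top_iff_exists.1 h
      rw [stoppedAt_of_eq_coe hs.symm]
      exact ⟨_, Subtype.coe_prop _, rfl⟩
  generalize P.map (stoppedAt Y τ) = μ at *
  have hyR : ((y : ℝ) : EReal) ∈ closedRange I := coe_mem_closedRange y
  have hcpt : IsCompact (closedRange I) := isClosed_closure.isCompact (X := EReal)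
  set r := sSup (closedRange I) with hr
  set l := sInf (closedRange I) with hl
  have hrI : r ∈ closedRange I := hcpt.sSup_mem ⟨_, hyR⟩
  have hlI : l ∈ closedRange I := hcpt.sInf_mem ⟨_, hyR⟩
  have hlt : ∀ v : I, l < ((v : ℝ) : EReal) ∧ ((v : ℝ) : EReal) < r := fun v => by
    obtain ⟨a, ha⟩ := exists_lt_of_mem_interior (hint v)
    obtain ⟨b, hb⟩ := exists_gt_of_mem_interior (hint v)
    exact ⟨(sInf_le (coe_mem_closedRange a)).trans_lt (EReal.coe_lt_coe_iff.2 ha),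
      (EReal.coe_lt_coe_iff.2 hb).trans_le (le_sSup (coe_mem_closedRange b))⟩
  -- The second threshold is an end of `I`, which is not in `I` and so is never attained; the exit
  -- is then at `z`.
  set g : EReal → EReal × EReal := fun z =>
    if z < ((y : ℝ) : EReal) then (z, r) else if z = ((y : ℝ) : EReal) then (z, z) else (l, z)
    with hg
  have hgm : Measurable g :=
    Measurable.ite measurableSet_Iio (measurable_id.prodMk measurable_const)
      (Measurable.ite (measurableSet_singleton _) (measurable_id.prodMk measurable_id)
        (measurable_const.prodMk measurable_id))
  have hgD : ∀ z ∈ closedRange I, g z ∈ thresholdPairs I y := fun z hz => by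
    simp only [hg]
    split_ifs with h1 h2
    · exact ⟨⟨h1.le, hz⟩, ⟨(hlt y).2.le, hrI⟩⟩
    · exact ⟨⟨h2.le, hz⟩, ⟨h2.ge, hz⟩⟩
    · exact ⟨⟨(hlt y).1.le, hlI⟩, ⟨not_lt.1 h1, hz⟩⟩
  have hgT : ∀ z ∈ J, (g z).1 ∈ J ∨ (g z).2 ∈ J := fun z hz => by
    simp only [hg]
    split_ifs
    · exact Or.inl hz
    · exact Or.inl hz
    · exact Or.inr hz
  have hTex : ∀ p : EReal × EReal, p.1 ∈ J ∨ p.2 ∈ J →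
      ∃ v : I, p.1 = ((v : ℝ) : EReal) ∨ p.2 = ((v : ℝ) : EReal) := by
    rintro p (⟨v, hv, h⟩ | ⟨v, hv, h⟩)
    · exact ⟨⟨v, hv⟩, Or.inl h.symm⟩
    · exact ⟨⟨v, hv⟩, Or.inr h.symm⟩
  have hrec : ∀ᵐ w ∂κ y, IsRecurrentPath w := (hκ.strongMarkov y).ae_isRecurrentPath hκ hR
  have hconv : ∀ᵐ w ∂κ y, ∀ p ∈ {p : EReal × EReal | p.1 ∈ J ∨ p.2 ∈ J}, ExitConv p w :=
    hrec.mono fun w hw p hp => by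
      obtain ⟨s, hs⟩ := WithTop.ne_top_iff_exists.1 (hw.exitTime_ne_top (hTex p hp))
      exact ⟨_, tendsto_stoppedProcess_of_eq_coe (Y := id) hs.symm⟩
  have := Measure.isProbabilityMeasure_map (μ := μ) hgm.aemeasurable
  have hJI : J ⊆ closedRange I := subset_closure
  refine hY.exists_randomizedThresholdRule h0 hrich (μ.map g) ?_ ?_ hconv fun S hS => ?_
  · exact (ae_map_iff hgm.aemeasurable (measurableSet_thresholdPairs I y)).2
      (hμJ.mono fun z hz => hgD z (hJI hz))
  · refine (ae_map_iff hgm.aemeasurable ?_).2 (hμJ.mono fun z hz => hgT z hz)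
    exact (measurable_fst hJm).union (measurable_snd hJm)
  · have hkm : Measurable fun p : EReal × EReal => κ y {w | exitLim p w ∈ S} :=
      measurable_measure_prodMk_left (measurable_exitLim hS)
    rw [lintegral_map hkm hgm,
      ← lintegral_indicator_one hS]
    refine lintegral_congr_ae (hμJ.mono fun z hz => ?_)
    refine measure_preimage_of_ae_eq (a := z) ?_ S
    filter_upwards [hconv, hrec, hκ.start y] with w h1 h2 h3
    rw [(h1 _ (hgT z hz)).exitLim_eq]
    have hne := h2.exitTime_ne_top (hTex _ (hgT z hz))
    have hD := hgD z (hJI hz)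
    have hval := exitValue_of_ne_top h3 hD.1.1 hD.2.1 hne
    obtain ⟨s, hs⟩ := WithTop.ne_top_iff_exists.1 hne
    have hval' : exitValue (g z) w = ((w.1 s : ℝ) : EReal) :=
      stoppedAt_of_eq_coe (Y := id) (τ := exitTime (g z).1 (g z).2) hs.symm
    have hlr := hlt (w.1 s)
    rw [← hval'] at hlr
    change exitValue (g z) w = (g z).1 ∨ exitValue (g z) w = (g z).2 at hval
    simp only [hg] at hval hlr ⊢
    split_ifs at hval hlr ⊢ with c1 c2
    · exact hval.resolve_right hlr.2.ne
    · exact hval.elim id id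
    · exact hval.resolve_left hlr.1.ne'

/-- Every law of the stopped process is attained by a randomized threshold rule. -/
theorem exists_randomizedThresholdRule (hκ : IsRegularDiffusion I κ)
    (hY : IsStrongMarkov 𝓕 P Y κ) {y : I}
    (hy : (y : ℝ) ∈ interior I) (h0 : ∀ᵐ ω ∂P, (Y ω).1 0 = y) (hrich : IsRich 𝓕 P Y)
    {τ : Ω → WithTop ℝ≥0} (hτ : τ ∈ allRules 𝓕 P Y) :
    ∃ σ ∈ randomizedThresholdRules 𝓕 P Y y, P.map (stoppedAt Y σ) = P.map (stoppedAt Y τ) := by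
  have hMk := hκ.isMarkovKernel
  -- Either case hypothesis concerns a single pair of levels; `measure_hit_lt_one` extends it to all
  -- pairs, for the reflected process in the second case.
  by_cases hU : ∃ a b : I, a < b ∧ κ a (hit b) < 1
  · obtain ⟨a, b, hab, h⟩ := hU
    exact exists_randomizedThresholdRule_of_transient hκ
      (fun c d hcd => measure_hit_lt_one hκ hab h hcd) hY hy h0 hrich hτ
  by_cases hD : ∃ a b : I, a < b ∧ κ b (hit a) < 1
  · obtain ⟨a, b, hab, h⟩ := hD
    have hlt : ∀ {a b : I}, a < b → (negPt b : negSet I) < negPt a := fun {a b} h =>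
      neg_lt_neg (show (a : ℝ) < b from h)
    have hT : ∀ c d : negSet I, c < d → negKernel κ c (hit d) < 1 := fun c d hcd =>
      measure_hit_lt_one hκ.negKernel (hlt hab) (by rwa [negKernel_hit]) hcd
    have hyn : ((negPt y : negSet I) : ℝ) ∈ interior (negSet I) := by
      have : interior (negSet I) = Neg.neg ⁻¹' interior I :=
        ((Homeomorph.neg ℝ).preimage_interior I).symm
      rw [this]
      simpa using hy
    obtain ⟨σ, hσ, hlaw⟩ := exists_randomizedThresholdRule_of_transient hκ.negKernel hT hY.negPath
      hyn (h0.mono fun ω h => congrArg negPt h) hrich.negPath (mem_allRules_negPath.2 hτ)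
    have hσ' := randomizedThresholdRules_negPath_subset y hσ
    exact ⟨σ, hσ', map_stoppedAt_eq_of_negPath hY.measurable hσ'.1 hτ hlaw⟩
  · push Not at hU hD
    refine exists_randomizedThresholdRule_of_recurrent hκ (fun a b => ?_) hY hy h0 hrich hτ
    refine le_antisymm (measure_le_one hκ _ _) ?_
    rcases lt_trichotomy a b with h | rfl | h
    · exact hU a b h
    · rw [measure_hit_self hκ]
    · exact hD b a h

theorem thresholdRules_subset_randomizedThresholdRules (y : I) :
    thresholdRules 𝓕 P Y y ⊆ randomizedThresholdRules 𝓕 P Y y := by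
  rintro τ ⟨hτ, p, hp, rfl⟩
  exact ⟨hτ, fun _ => p, measurable_const, fun _ => hp, indepFun_const_left _ _, rfl⟩

theorem randomizedThresholdRules_suffice (hκ : IsRegularDiffusion I κ)
    (hY : IsStrongMarkov 𝓕 P Y κ) {y : I} (hy : (y : ℝ) ∈ interior I)
    (h0 : ∀ᵐ ω ∂P, (Y ω).1 0 = y) (hrich : IsRich 𝓕 P Y) {V : (Ω → WithTop ℝ≥0) → EReal}
    (hV : LawInvariant 𝓕 P Y V) :
    optimalValue V (thresholdRules 𝓕 P Y y) ≤ optimalValue V (randomizedThresholdRules 𝓕 P Y y) ∧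
      optimalValue V (randomizedThresholdRules 𝓕 P Y y) = optimalValue V (allRules 𝓕 P Y) ∧
      ∀ τ ∈ allRules 𝓕 P Y, ∃ σ ∈ randomizedThresholdRules 𝓕 P Y y, V σ = V τ := by
  have hex : ∀ τ ∈ allRules 𝓕 P Y, ∃ σ ∈ randomizedThresholdRules 𝓕 P Y y, V σ = V τ :=
    fun τ hτ => by
      obtain ⟨σ, hσ, h⟩ := exists_randomizedThresholdRule hκ hY hy h0 hrich hτ
      exact ⟨σ, hσ, hV σ hσ.1 τ hτ h⟩
  refine ⟨biSup_mono (thresholdRules_subset_randomizedThresholdRules y), le_antisymm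
    (biSup_mono fun σ hσ => hσ.1) (iSup₂_le fun τ hτ => ?_), hex⟩
  obtain ⟨σ, hσ, h⟩ := hex τ hτ
  rw [← h]
  exact le_biSup V hσ

end Diffusion

/-! ### Mixtures of two rules -/

/-- The mixture is the sum of `1_{Z = j} G_j`. Only independence of `Z` from each `G_j` separately
is needed, not from the pair. -/
theorem integral_mixture {Ω : Type*} {mΩ : MeasurableSpace Ω} {P : Measure Ω}
    [IsProbabilityMeasure P] {Z : Ω → Fin 2} (hZ : Measurable Z) {θ : ℝ} (hθ : 0 ≤ θ)
    (hZθ : P {ω | Z ω = 0} = ENNReal.ofReal θ) {G : Fin 2 → Ω → ℝ}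
    (hG : ∀ j, Integrable (G j) P) (hind : ∀ j, IndepFun Z (G j) P) :
    Integrable (fun ω => G (Z ω) ω) P ∧
      ∫ ω, G (Z ω) ω ∂P = θ * ∫ ω, G 0 ω ∂P + (1 - θ) * ∫ ω, G 1 ω ∂P := by
  set φ : Fin 2 → Fin 2 → ℝ := fun j z => if z = j then 1 else 0 with hφ
  have hφm : ∀ j, Measurable (φ j) := fun j => measurable_of_countable _
  have hφZ : ∀ j, Integrable (fun ω => φ j (Z ω)) P := fun j =>
    Integrable.of_bound ((hφm j).comp hZ).aestronglyMeasurable 1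
      (Eventually.of_forall fun ω => by simp only [hφ]; split_ifs <;> simp)
  have hi : ∀ j, IndepFun (fun ω => φ j (Z ω)) (G j) P := fun j =>
    (hind j).comp (hφm j) measurable_id
  have hint : ∀ j, Integrable (fun ω => φ j (Z ω) * G j ω) P := fun j =>
    (hi j).integrable_mul (hφZ j) (hG j)
  have hval : ∀ j, ∫ ω, φ j (Z ω) * G j ω ∂P = (∫ ω, φ j (Z ω) ∂P) * ∫ ω, G j ω ∂P := fun j =>
    (hi j).integral_fun_mul_eq_mul_integral (hφZ j).1 (hG j).1
  have h0 : ∫ ω, φ 0 (Z ω) ∂P = θ := by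
    have : (fun ω => φ 0 (Z ω)) = {ω | Z ω = 0}.indicator 1 := by
      funext ω
      simp only [hφ, indicator_apply, mem_ofPred_eq, Pi.one_apply]
    have hm : MeasurableSet {ω | Z ω = 0} := hZ (measurableSet_singleton 0)
    rw [this]
    refine (integral_indicator_one hm).trans ?_
    rw [Measure.real, hZθ, ENNReal.toReal_ofReal hθ]
  have h1 : ∫ ω, φ 1 (Z ω) ∂P = 1 - θ := by
    have : (fun ω => φ 1 (Z ω)) = fun ω => 1 - φ 0 (Z ω) := by
      funext ω
      simp only [hφ]
      generalize Z ω = z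
      fin_cases z <;> simp
    rw [this, integral_sub (integrable_const _) (hφZ 0), h0]
    simp
  have hsum : (fun ω => G (Z ω) ω) = fun ω => φ 0 (Z ω) * G 0 ω + φ 1 (Z ω) * G 1 ω := by
    funext ω
    simp only [hφ]
    generalize Z ω = z
    fin_cases z <;> simp
  rw [hsum]
  refine ⟨(hint 0).add (hint 1), ?_⟩
  rw [integral_add (hint 0) (hint 1), hval, hval, h0, h1]

theorem exists_convex_comb_gt {a b c : ℝ} (h1 : b < c) (h2 : c < a) :
    ∃ θ : ℝ, 0 < θ ∧ θ < 1 ∧ c < θ * a + (1 - θ) * b := by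
  have hab : 0 < a - b := by linarith
  -- This weight places the combination at the midpoint of `c` and `a`.
  refine ⟨1 - (a - c) / (2 * (a - b)), ?_, ?_, ?_⟩
  · rw [sub_pos, div_lt_one (by linarith)]; linarith
  · have : 0 < (a - c) / (2 * (a - b)) := div_pos (by linarith) (by linarith)
    linarith
  · have : (a - c) / (2 * (a - b)) * (a - b) = (a - c) / 2 := by field_simp
    nlinarith

section Mixture

variable {I : Set ℝ} {Ω : Type*} {mΩ : MeasurableSpace Ω} {P : Measure Ω}
  {𝓕 : Filtration ℝ≥0 mΩ} {Y : Ω → ContPath I}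

theorem isPreconnected_closedRange (hI : I.OrdConnected) : IsPreconnected (closedRange I) :=
  (hI.isPreconnected.image _ continuous_coe_real_ereal.continuousOn).closure

/-- The mean lies between two values of `u` attained off a null set, and the closure of `I` is
connected. The two points are taken where `u` is finite, as it may be infinite at the ends. -/
theorem certaintyEquivalent_spec [IsProbabilityMeasure P] (hI : I.OrdConnected)
    {u : EReal → EReal} (hu : IsUtility I u) {τ : Ω → WithTop ℝ≥0}
    (hτ : τ ∈ allRules 𝓕 P Y) (h : HasExpectedUtility P Y u τ) :
    certaintyEquivalent P Y u τ ∈ closedRange I ∧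
      u (certaintyEquivalent P Y u τ) = ((∫ ω, (u (stoppedAt Y τ ω)).toReal ∂P : ℝ) : EReal) := by
  have hae := (stoppedAt_mem_closedRange hτ).and h.1
  have hN : P {ω | ¬ (stoppedAt Y τ ω ∈ closedRange I ∧
    u (stoppedAt Y τ ω) ≠ ⊥ ∧ u (stoppedAt Y τ ω) ≠ ⊤)} = 0 := ae_iff.1 hae
  obtain ⟨ω₁, h₁, hle₁⟩ := exists_notMem_null_le_integral h.2 hN
  obtain ⟨ω₂, h₂, hle₂⟩ := exists_notMem_null_integral_le h.2 hN
  simp only [mem_ofPred_eq, not_not] at h₁ h₂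
  obtain ⟨z, hz, hzE⟩ := (isPreconnected_closedRange hI).intermediate_value h₁.1 h₂.1 hu.2
    (show ((∫ ω, (u (stoppedAt Y τ ω)).toReal ∂P : ℝ) : EReal) ∈ _ from
      ⟨by rw [← EReal.coe_toReal h₁.2.2 h₁.2.1]; exact EReal.coe_le_coe_iff.2 hle₁,
        by rw [← EReal.coe_toReal h₂.2.2 h₂.2.1]; exact EReal.coe_le_coe_iff.2 hle₂⟩)
  exact ⟨Function.invFunOn_mem ⟨z, hz, hzE⟩, Function.invFunOn_eq ⟨z, hz, hzE⟩⟩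

theorem cscValue_fin_two (u : Fin 2 → EReal → EReal) (τ : Ω → WithTop ℝ≥0) :
    cscValue P Y u τ = min (certaintyEquivalent P Y (u 0) τ) (certaintyEquivalent P Y (u 1) τ) :=
  le_antisymm (le_min (iInf_le _ 0) (iInf_le _ 1))
    (le_iInf (Fin.forall_fin_two.2 ⟨min_le_left _ _, min_le_right _ _⟩))

theorem mixture_mem_allRules {Z : Ω → Fin 2} (hZ : Measurable[𝓕 0] Z)
    {τ : Fin 2 → Ω → WithTop ℝ≥0} (hτ : ∀ i, τ i ∈ allRules 𝓕 P Y) :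
    mixture Z τ ∈ allRules 𝓕 P Y := by
  refine ⟨fun t => ?_, ?_⟩
  · have : {ω | mixture Z τ ω ≤ t} = ⋃ i, {ω | Z ω = i} ∩ {ω | τ i ω ≤ t} := by
      ext ω
      simp [mixture]
    rw [this]
    exact MeasurableSet.iUnion fun i =>
      (𝓕.mono zero_le _ (hZ (measurableSet_singleton i))).inter ((hτ i).1 t)
  · filter_upwards [ae_all_iff.2 fun i => (hτ i).2] with ω hω using hω (Z ω)

/-- A utility is arbitrary, possibly not measurable, off the closure of `I`; cutting it off there
makes it usable for independence. -/
theorem exists_measurable_eqOn_utility {u : EReal → EReal} (hu : IsUtility I u) :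
    ∃ f : EReal → ℝ, Measurable f ∧ ∀ z ∈ closedRange I, f z = (u z).toReal := by
  classical
  refine ⟨fun z => ((closedRange I).piecewise u (fun _ => 0) z).toReal,
    measurable_ereal_toReal.comp (hu.2.measurable_piecewise continuousOn_const
      isClosed_closure.measurableSet), fun z hz => ?_⟩
  simp only [piecewise_eq_of_mem _ _ _ hz]

theorem hasExpectedUtility_mixture [IsProbabilityMeasure P]
    {u : EReal → EReal} (hu : IsUtility I u) {τ : Fin 2 → Ω → WithTop ℝ≥0}
    (hτ : ∀ i, τ i ∈ allRules 𝓕 P Y) (h : ∀ j, HasExpectedUtility P Y u (τ j)) {Z : Ω → Fin 2}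
    (hZ : Measurable Z) (hind : ∀ j, IndepFun Z (stoppedAt Y (τ j)) P) {θ : ℝ} (hθ : 0 ≤ θ)
    (hZθ : P {ω | Z ω = 0} = ENNReal.ofReal θ) :
    HasExpectedUtility P Y u (mixture Z τ) ∧
      ∫ ω, (u (stoppedAt Y (mixture Z τ) ω)).toReal ∂P =
        θ * ∫ ω, (u (stoppedAt Y (τ 0) ω)).toReal ∂P +
          (1 - θ) * ∫ ω, (u (stoppedAt Y (τ 1) ω)).toReal ∂P := by
  obtain ⟨f, hf, hfu⟩ := exists_measurable_eqOn_utility hu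
  have hind' : ∀ j, IndepFun Z (fun ω => (u (stoppedAt Y (τ j) ω)).toReal) P := fun j =>
    ((hind j).comp measurable_id hf).congr (Eventually.of_forall fun _ => rfl)
      ((stoppedAt_mem_closedRange (hτ j)).mono fun ω hω => hfu _ hω)
  obtain ⟨h1, h2⟩ := integral_mixture hZ hθ hZθ
    (G := fun j ω => (u (stoppedAt Y (τ j) ω)).toReal) (fun j => (h j).2) hind'
  refine ⟨⟨?_, h1⟩, h2⟩
  filter_upwards [ae_all_iff.2 fun j => (h j).1] with ω hω using hω (Z ω)

/-- A mixture whose expected utilities exceed those of given levels is valued above them. -/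
theorem lt_cscValue_of_integral [IsProbabilityMeasure P] (hI : I.OrdConnected)
    {u : Fin 2 → EReal → EReal} (hu : ∀ i, IsUtility I (u i)) {τ : Ω → WithTop ℝ≥0}
    (hτ : τ ∈ allRules 𝓕 P Y) (h : ∀ i, HasExpectedUtility P Y (u i) τ) {x : EReal}
    (hx : x ∈ closedRange I)
    (hlt : ∀ i, u i x < ((∫ ω, (u i (stoppedAt Y τ ω)).toReal ∂P : ℝ) : EReal)) :
    x < cscValue P Y u τ := by
  have key : ∀ i, x < certaintyEquivalent P Y (u i) τ := fun i => by
    obtain ⟨h1, h2⟩ := certaintyEquivalent_spec hI (hu i) hτ (h i)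
    rw [← (hu i).1.lt_iff_lt hx h1, h2]
    exact hlt i
  rw [cscValue_fin_two]
  exact lt_min (key 0) (key 1)

/-- Let `d` be the larger of the two low certainty equivalents. The weight is taken so close to the
opposite rule's favour that the other utility's mean still exceeds its value at the higher level
`c`, while the remaining positive weight lifts the utility attaining `d` strictly above its value
there. -/
theorem exists_mixture_weight [IsProbabilityMeasure P] (hI : I.OrdConnected)
    (u : Fin 2 → EReal → EReal) (τ : Fin 2 → Ω → WithTop ℝ≥0) (c : EReal)
    (hu : ∀ i, IsUtility I (u i)) (hτ : ∀ i, τ i ∈ allRules 𝓕 P Y)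
    (h : ∀ i j, HasExpectedUtility P Y (u i) (τ j))
    (h00 : c < certaintyEquivalent P Y (u 0) (τ 0)) (h10 : certaintyEquivalent P Y (u 1) (τ 0) < c)
    (h01 : certaintyEquivalent P Y (u 0) (τ 1) < c)
    (h11 : c < certaintyEquivalent P Y (u 1) (τ 1)) :
    ∃ θ : ℝ, 0 < θ ∧ θ < 1 ∧
      ∀ Z : Ω → Fin 2, Measurable[𝓕 0] Z → (∀ j, IndepFun Z (stoppedAt Y (τ j)) P) →
        P {ω | Z ω = 0} = ENNReal.ofReal θ →
        mixture Z τ ∈ allRules 𝓕 P Y ∧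
        max (cscValue P Y u (τ 0)) (cscValue P Y u (τ 1)) < cscValue P Y u (mixture Z τ) := by
  set e : Fin 2 → Fin 2 → ℝ := fun i j => ∫ ω, (u i (stoppedAt Y (τ j) ω)).toReal ∂P with he
  have hspec : ∀ i j, certaintyEquivalent P Y (u i) (τ j) ∈ closedRange I ∧
      u i (certaintyEquivalent P Y (u i) (τ j)) = (e i j : EReal) := fun i j =>
    certaintyEquivalent_spec hI (hu i) (hτ j) (h i j)
  have hc : c ∈ closedRange I := (isPreconnected_closedRange hI).ordConnected.out
    (hspec 1 0).1 (hspec 0 0).1 ⟨h10.le, h00.le⟩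
  have u00 : u 0 c < (e 0 0 : EReal) := (hspec 0 0).2 ▸ (hu 0).1 hc (hspec 0 0).1 h00
  have u10 : (e 1 0 : EReal) < u 1 c := (hspec 1 0).2 ▸ (hu 1).1 (hspec 1 0).1 hc h10
  have u01 : (e 0 1 : EReal) < u 0 c := (hspec 0 1).2 ▸ (hu 0).1 (hspec 0 1).1 hc h01
  have u11 : u 1 c < (e 1 1 : EReal) := (hspec 1 1).2 ▸ (hu 1).1 hc (hspec 1 1).1 h11
  obtain ⟨c0, hc0⟩ : ∃ r : ℝ, (r : EReal) = u 0 c :=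
    ⟨_, EReal.coe_toReal u00.ne_top u01.ne_bot⟩
  obtain ⟨c1, hc1⟩ : ∃ r : ℝ, (r : EReal) = u 1 c :=
    ⟨_, EReal.coe_toReal u11.ne_top u10.ne_bot⟩
  rw [← hc0, EReal.coe_lt_coe_iff] at u00 u01
  rw [← hc1, EReal.coe_lt_coe_iff] at u10 u11
  obtain ⟨d, hd, hd0, hd1, θ, hθ0, hθ1, hθ⟩ : ∃ d ∈ closedRange I,
      certaintyEquivalent P Y (u 1) (τ 0) ≤ d ∧ certaintyEquivalent P Y (u 0) (τ 1) ≤ d ∧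
      ∃ θ : ℝ, 0 < θ ∧ θ < 1 ∧ ∀ i, u i d < ((θ * e i 0 + (1 - θ) * e i 1 : ℝ) : EReal) := by
    -- If `d` belongs to rule `0` under `u 1`, the weight keeps the mean of `u 0` above its value at
    -- `c`; the other case exchanges the roles.
    rcases le_total (certaintyEquivalent P Y (u 0) (τ 1))
      (certaintyEquivalent P Y (u 1) (τ 0)) with hle | hle
    · obtain ⟨θ, hθ0, hθ1, hθ⟩ := exists_convex_comb_gt u01 u00
      refine ⟨_, (hspec 1 0).1, le_rfl, hle, θ, hθ0, hθ1, Fin.forall_fin_two.2 ⟨?_, ?_⟩⟩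
      · exact ((hu 0).1 (hspec 1 0).1 hc h10).trans (hc0 ▸ EReal.coe_lt_coe_iff.2 hθ)
      · rw [(hspec 1 0).2, EReal.coe_lt_coe_iff]
        nlinarith
    · obtain ⟨θ, hθ0, hθ1, hθ⟩ := exists_convex_comb_gt u10 u11
      refine ⟨_, (hspec 0 1).1, hle, le_rfl, 1 - θ, by linarith, by linarith,
        Fin.forall_fin_two.2 ⟨?_, ?_⟩⟩
      · rw [(hspec 0 1).2, EReal.coe_lt_coe_iff]
        nlinarith
      · refine ((hu 1).1 (hspec 0 1).1 hc h01).trans (hc1 ▸ EReal.coe_lt_coe_iff.2 ?_)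
        linarith
  refine ⟨θ, hθ0, hθ1, fun Z hZ hind hZθ => ?_⟩
  have hmix := mixture_mem_allRules hZ hτ
  have hEU := fun i => hasExpectedUtility_mixture (hu i) hτ (h i)
    (hZ.mono (𝓕.le 0) le_rfl) hind hθ0.le hZθ
  refine ⟨hmix, lt_of_le_of_lt (max_le ?_ ?_)
    (lt_cscValue_of_integral hI hu hmix (fun i => (hEU i).1) hd fun i => ?_)⟩
  · exact (iInf_le _ 1).trans hd0
  · exact (iInf_le _ 0).trans hd1
  · rw [(hEU i).2]; exact hθ i

theorem IsRich.exists_index [IsProbabilityMeasure P] (h : IsRich 𝓕 P Y) {θ : ℝ} (hθ0 : 0 ≤ θ)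
    (hθ1 : θ ≤ 1) : ∃ Z : Ω → Fin 2, Measurable[𝓕 0] Z ∧ IndepFun Z Y P ∧
      P {ω | Z ω = 0} = ENNReal.ofReal θ := by
  classical
  obtain ⟨V, hV, hlaw, hind⟩ := h.exists_uniform
  set x : unitInterval := ⟨θ, hθ0, hθ1⟩
  have hφ : Measurable fun v : unitInterval => if v ≤ x then (0 : Fin 2) else 1 :=
    Measurable.ite measurableSet_Iic measurable_const measurable_const
  refine ⟨fun ω => if V ω ≤ x then 0 else 1, hφ.comp hV, hind.comp hφ measurable_id, ?_⟩
  have : {ω | (if V ω ≤ x then (0 : Fin 2) else 1) = 0} = V ⁻¹' Iic x := by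
    ext ω
    simp
  rw [this, ← Measure.map_apply (hV.mono (𝓕.le 0) le_rfl) measurableSet_Iic, hlaw,
    unitInterval.volume_Iic]

theorem mixture_mem_randomizedThresholdRules {y : I} {Z : Ω → Fin 2} (hZ : Measurable[𝓕 0] Z)
    (hind : IndepFun Z Y P) {τ : Fin 2 → Ω → WithTop ℝ≥0}
    (hτ : ∀ i, τ i ∈ thresholdRules 𝓕 P Y y) :
    mixture Z τ ∈ randomizedThresholdRules 𝓕 P Y y := by
  choose p hp hτp using fun i => (hτ i).2
  have hpm : Measurable p := measurable_of_countable _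
  refine ⟨mixture_mem_allRules hZ fun i => (hτ i).1, fun ω => p (Z ω), hpm.comp hZ,
    fun ω => hp _, hind.comp hpm measurable_id, ?_⟩
  funext ω
  exact congrFun (hτp (Z ω)) ω

theorem indepFun_stoppedAt_of_mem_thresholdRules {β : Type*} [MeasurableSpace β] {Z : Ω → β}
    (hind : IndepFun Z Y P) {y : I} {τ : Ω → WithTop ℝ≥0} (hτ : τ ∈ thresholdRules 𝓕 P Y y) :
    IndepFun Z (stoppedAt Y τ) P := by
  obtain ⟨⟨-, hconv⟩, p, -, rfl⟩ := hτ
  refine (hind.comp measurable_id (measurable_exitLim_right p)).congr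
    (Eventually.of_forall fun _ => rfl) (hconv.mono fun ω hω => ?_)
  have : ExitConv p (Y ω) := hω
  exact this.exitLim_eq

end Mixture

/-! ### Continuity of the scale function -/

section Diffusion

variable {I : Set ℝ} {κ : Kernel I (ContPath I)}

/-- A path that never reaches `b` can only converge to the lower end, so it is below `v 0` after
some time and its maximum up to then is less than `b`; some `v n` is higher. -/
theorem IsTransientPath.mem_above_of_forall {w : ContPath I} (hw : IsTransientPath w) {a b : I}
    (hab : a < b) {v : ℕ → I} (hvb : Tendsto (fun n => (v n : ℝ)) atTop (𝓝 b))
    (hav : ∀ n, a < v n) (hlt : ∀ n, v n < b) (h : ∀ n, w ∈ above (v n)) : w ∈ above b := by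
  by_contra hn
  have hwb : ∀ t, w.1 t < b := fun t => not_le.1 fun h => hn ⟨t, h⟩
  obtain ⟨l, hl⟩ := hw.conv
  rcases hw.limit_dichotomy hl with h1 | h1
  · have hal : ((a : ℝ) : EReal) < l := (EReal.coe_lt_coe_iff.2 hab).trans_le (h1 b)
    obtain ⟨s, -, hs⟩ := hw.mem_above hl hal b 0
    exact absurd (hwb s) (not_lt.2 hs)
  · have hl0 : l < ((v 0 : ℝ) : EReal) := (h1 a).trans_lt (EReal.coe_lt_coe_iff.2 (hav 0))
    obtain ⟨T, hT⟩ := eventually_atTop.1 (hl.eventually (eventually_lt_nhds hl0))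
    obtain ⟨m, hm, hmax⟩ := (isCompact_Iic_nnreal T).exists_isMaxOn ⟨T, self_mem_Iic⟩
      (continuous_coordR w).continuousOn
    obtain ⟨n, hn'⟩ := (hvb.eventually (eventually_gt_nhds
      (max_lt (show (w.1 m : ℝ) < b from hwb m) (show (v 0 : ℝ) < b from hlt 0)))).exists
    obtain ⟨t, ht⟩ := h n
    rcases le_total t T with htT | htT
    · exact absurd (show (v n : ℝ) ≤ w.1 t from ht)
        (not_le.2 ((hmax htT).trans_lt ((le_max_left _ _).trans_lt hn')))
    · exact absurd (show (v n : ℝ) ≤ w.1 t from ht)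
        (not_le.2 ((EReal.coe_lt_coe_iff.1 (hT t htT)).trans ((le_max_right _ _).trans_lt hn')))

/-- Continuity from the left. If `s ≤ t` below `b`, then `s(a) = s(v) P^a(above v) ≤ t P^a(above v)`
for `v` increasing to `b`, and the probabilities decrease to `P^a(above b)`. Comparison with `s(a) =
s(b) P^a(above b)` gives `s(b) ≤ t`. -/
theorem exists_scaleFun_gt (hκ : IsRegularDiffusion I κ)
    (hT : ∀ a b : I, a < b → κ a (hit b) < 1) {c : I} (hc : (c : ℝ) ∈ interior I) {b : I}
    {t : ℝ≥0∞} (ht : t < scaleFun κ c b) : ∃ v : I, v < b ∧ t < scaleFun κ c v := by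
  have hMk := hκ.isMarkovKernel
  obtain ⟨a', ha'⟩ : ∃ a' : I, a' < b := by
    by_contra! hn
    rw [scaleFun_of_isLeast hκ hc hn] at ht
    exact not_lt_zero ht
  obtain ⟨m, hm1, hm2⟩ := exists_between (show (a' : ℝ) < b from ha')
  obtain ⟨a, ha1, ha2⟩ : ∃ a : I, a' < a ∧ a < b :=
    ⟨⟨m, hκ.ordConnected.out a'.2 b.2 ⟨hm1.le, hm2.le⟩⟩, hm1, hm2⟩
  obtain ⟨x, hx, hxm, hxb⟩ := exists_seq_strictMono_tendsto' (show (a : ℝ) < b from ha2)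
  set v : ℕ → I := fun n => ⟨x n, hκ.ordConnected.out a.2 b.2 (Ioo_subset_Icc_self (hxm n))⟩
  by_contra! hn
  have hle : ∀ n, scaleFun κ c a ≤ t * κ a (above (v n)) := fun n => by
    rw [← min_eq_left (scaleFun_le hκ hc (show a ≤ v n from (hxm n).1.le)),
      ← scaleFun_mul_measure_above hκ hc]
    exact mul_le_mul_left (hn (v n) (hxm n).2) _
  have hlim : Tendsto (fun n => κ a (above (v n))) atTop (𝓝 (κ a (⋂ n, above (v n)))) :=
    tendsto_measure_iInter_atTop (fun n => (measurableSet_above _).nullMeasurableSet)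
      (fun m n hmn w ⟨s, hs⟩ => ⟨s, le_trans (show x m ≤ x n from hx.monotone hmn) hs⟩)
      ⟨0, measure_ne_top _ _⟩
  have hinter : κ a (⋂ n, above (v n)) ≤ κ a (above b) := by
    refine measure_mono_ae ?_
    filter_upwards [hκ.ae_isTransientPath hT a] with w hw hmem
    exact hw.mem_above_of_forall ha2 hxb (fun n => (hxm n).1) (fun n => (hxm n).2)
      (mem_iInter.1 hmem)
  have htt : t ≠ ⊤ := ht.ne_top
  have h1 : scaleFun κ c a ≤ t * κ a (above b) :=
    (ge_of_tendsto' (ENNReal.Tendsto.const_mul hlim (Or.inr htt)) hle).trans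
      (mul_le_mul_right hinter t)
  have h2 := scaleFun_mul_measure_above hκ hc a b
  rw [min_eq_left (scaleFun_le hκ hc ha2.le)] at h2
  have hpos : κ a (above b) ≠ 0 := fun h0 => by
    rw [h0, mul_zero] at h2
    exact scaleFun_ne_zero hκ hc ha1 h2.symm
  rw [← h2] at h1
  exact absurd ((ENNReal.mul_le_mul_iff_left hpos (measure_ne_top _ _)).1 h1) (not_le.2 ht)

theorem exitLim_eq_of_exitTime_eq {p : EReal × EReal} {w : ContPath I} {s : ℝ≥0}
    (h : exitTime p.1 p.2 w = s) : exitLim p w = ((w.1 s : ℝ) : EReal) := by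
  have hc : ExitConv p w := ⟨_, tendsto_stoppedProcess_of_eq_coe (Y := id) h⟩
  rw [hc.exitLim_eq]
  exact stoppedAt_of_eq_coe (Y := id) (τ := exitTime p.1 p.2) h

/-- If a path leaves `(z, v)` at `v`, then so it does with `z` replaced by a close larger level. -/
theorem IsTransientPath.eventually_exitLim_eq {w : ContPath I} (hw : IsTransientPath w) {z : EReal}
    {v y : I} (hzy : z < ((y : ℝ) : EReal)) (hyv : y < v)
    (h : exitLim (z, ((v : ℝ) : EReal)) w = ((v : ℝ) : EReal)) {x : ℕ → EReal}
    (hx : Tendsto x atTop (𝓝 z)) :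
    ∀ᶠ n in atTop, exitLim (x n, ((v : ℝ) : EReal)) w = ((v : ℝ) : EReal) := by
  have hne : exitTime z ((v : ℝ) : EReal) w ≠ ⊤ := fun htop => by
    have hmem := exitTime_eq_top_iff.1 htop
    obtain ⟨l, hl⟩ := hw.conv
    have hlv : l = ((v : ℝ) : EReal) := by
      rw [← h, (ExitConv.of_isTransientPath hw _).exitLim_eq]
      exact (stoppedAt_of_eq_top (Y := id) (τ := exitTime z ((v : ℝ) : EReal)) htop hl).symm
    obtain ⟨s, -, hs⟩ := hw.mem_above hl (a := y) (hlv ▸ EReal.coe_lt_coe_iff.2 hyv) v 0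
    exact absurd (EReal.coe_le_coe_iff.2 (show (v : ℝ) ≤ w.1 s from hs)) (not_le.2 (hmem s).2)
  obtain ⟨s, hs⟩ := WithTop.ne_top_iff_exists.1 hne
  have hsv : ((w.1 s : ℝ) : EReal) = ((v : ℝ) : EReal) := by
    rw [← h, exitLim_eq_of_exitTime_eq (p := (z, ((v : ℝ) : EReal))) hs.symm]
  have hbefore : ∀ r < s, ((w.1 r : ℝ) : EReal) ∈ Ioo z ((v : ℝ) : EReal) := fun r hr => by
    have : (r : WithTop ℝ≥0) < exitTime z ((v : ℝ) : EReal) w := by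
      rw [← hs]; exact WithTop.coe_lt_coe.2 hr
    exact not_not.1 (notMem_of_lt_firstHit this)
  -- The minimum up to the exit is still greater than `z`, so levels `x n` below this minimum are
  -- not met before `v` is.
  obtain ⟨m, hm, hmin⟩ := (isCompact_Iic_nnreal s).exists_isMinOn ⟨s, self_mem_Iic⟩
    (continuous_coordE w).continuousOn
  have hzm : z < ((w.1 m : ℝ) : EReal) := by
    rcases (show m ≤ s from hm).lt_or_eq with hlt | rfl
    · exact (hbefore m hlt).1
    · rw [hsv]; exact hzy.trans (EReal.coe_lt_coe_iff.2 hyv)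
  filter_upwards [hx.eventually (eventually_lt_nhds hzm)] with n hn
  rw [← hsv]
  refine exitLim_eq_of_exitTime_eq (p := (x n, ((w.1 s : ℝ) : EReal))) ?_
  refine le_antisymm (firstHit_le_of_mem fun hmem => lt_irrefl _ hmem.2) (not_lt.1 fun hlt => ?_)
  obtain ⟨r, hr⟩ := WithTop.ne_top_iff_exists.1 hlt.ne_top
  have hr' : exitTime (x n) ((w.1 s : ℝ) : EReal) w = r := hr.symm
  have hrs : r < s := WithTop.coe_lt_coe.1 (hr' ▸ hlt)
  have hmem : ((w.1 r : ℝ) : EReal) ∉ Ioo (x n) ((w.1 s : ℝ) : EReal) :=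
    firstHit_mem (C := (Ioo (x n) ((w.1 s : ℝ) : EReal))ᶜ) isOpen_Ioo.isClosed_compl hr'
  refine hmem ⟨hn.trans_le (hmin hrs.le), ?_⟩
  rw [hsv]
  exact (hbefore r hrs).2

/-- Continuity from the right, including the lower end. Suppose `s ≥ t` everywhere above `z`, and
exit from `(x n, v)` with `x n` decreasing to `z`. The mean of the truncated scale is `s(y)` for
each `n`; Fatou's lemma gives `t p + s(v) q ≤ s(y) = s(z) p + s(v) q`, with `p`, `q` the
probabilities of exit from `(z, v)` at `z`, `v`. As `p > 0`, this contradicts `s(z) < t`. -/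
theorem exists_scaleFun_lt (hκ : IsRegularDiffusion I κ)
    (hT : ∀ a b : I, a < b → κ a (hit b) < 1) {c : I} (hc : (c : ℝ) ∈ interior I) {z z' : EReal}
    (hz : z ∈ closedRange I) (hz' : z' ∈ closedRange I) (hzz : z < z')
    {t : ℝ≥0∞} (ht : scaleE κ c z < t) :
    ∃ v : I, z < ((v : ℝ) : EReal) ∧ scaleFun κ c v < t := by
  have hMk := hκ.isMarkovKernel
  obtain ⟨v, hzv, -⟩ := exists_mem_between_closedRange hκ.ordConnected hz hz' hzz
  obtain ⟨y, hzy, hyv⟩ :=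
    exists_mem_between_closedRange hκ.ordConnected hz (coe_mem_closedRange v) hzv
  obtain ⟨a, hza, hay⟩ :=
    exists_mem_between_closedRange hκ.ordConnected hz (coe_mem_closedRange y) hzy
  rw [EReal.coe_lt_coe_iff] at hyv hay
  have hyv' : y < v := hyv
  have hy : (y : ℝ) ∈ interior I := mem_interior_of_lt hκ.ordConnected hay hyv
  by_contra! hn
  obtain ⟨x, -, hxm, hxz⟩ := exists_seq_strictAnti_tendsto' hza
  have hxΦ : ∀ n, t ≤ scaleE κ c (x n) := fun n => by
    have hxa : x n ∈ closedRange I := (isPreconnected_closedRange hκ.ordConnected).ordConnected.out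
      hz (coe_mem_closedRange a) (Ioo_subset_Icc_self (hxm n))
    obtain ⟨b, hzb, hbx⟩ := exists_mem_between_closedRange hκ.ordConnected hz hxa (hxm n).1
    exact (hn b hzb).trans (scaleFun_le_scaleE hbx.le)
  have hD : (z, ((v : ℝ) : EReal)) ∈ thresholdPairs I y :=
    ⟨⟨hzy.le, hz⟩, ⟨EReal.coe_le_coe_iff.2 hyv.le, coe_mem_closedRange v⟩⟩
  have hlim : ∀ p, ∀ᵐ w ∂κ y, exitLim p w = exitValue p w := fun p =>
    (hκ.ae_isTransientPath hT y).mono fun w hw => (ExitConv.of_isTransientPath hw p).exitLim_eq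
  have hEm : ∀ p : EReal × EReal, Measurable (exitLim p : ContPath I → EReal) :=
    measurable_exitLim_right
  have hval : ∀ᵐ w ∂κ y, exitLim (z, ((v : ℝ) : EReal)) w = z ∨
      exitLim (z, ((v : ℝ) : EReal)) w = ((v : ℝ) : EReal) := by
    filter_upwards [hlim (z, ((v : ℝ) : EReal)), hκ.ae_exitValue hT hD] with w h1 h2
    rwa [h1]
  have hEx : ∀ x, ∫⁻ w, min (scaleE κ c (exitLim (x, ((v : ℝ) : EReal)) w)) (scaleFun κ c v) ∂κ y =
      scaleFun κ c y := fun x => by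
    rw [← lintegral_min_scaleE_exitTime hκ hT (hκ.strongMarkov y) hy (hκ.start y) hc x hyv'.le]
    exact lintegral_congr_ae ((hlim _).mono fun w hw =>
      congrArg (fun q => min (scaleE κ c q) (scaleFun κ c v)) hw)
  have htwo := fun g => lintegral_comp_of_twoPoint (hEm (z, ((v : ℝ) : EReal))) hzv.ne hval g
  have hone := htwo fun _ => 1
  have heq := htwo fun q => min (scaleE κ c q) (scaleFun κ c v)
  have hfat := htwo fun q => if q = z then t else scaleFun κ c v
  simp only [lintegral_const, measure_univ, one_mul] at hone
  rw [hEx z, scaleE_coe hκ hc, min_self,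
    min_eq_left ((scaleE_mono κ c hzv.le).trans (scaleE_coe hκ hc v).le)] at heq
  rw [if_pos rfl, if_neg hzv.ne'] at hfat
  have htv : t ≤ scaleFun κ c v := hn v hzv
  have hF : ∫⁻ w, (if exitLim (z, ((v : ℝ) : EReal)) w = z then t else scaleFun κ c v) ∂κ y ≤
      scaleFun κ c y := by
    have hΦm : Measurable (scaleE κ c) := (scaleE_mono κ c).measurable
    calc ∫⁻ w, (if exitLim (z, ((v : ℝ) : EReal)) w = z then t else scaleFun κ c v) ∂κ y
        ≤ ∫⁻ w, liminf (fun n => min (scaleE κ c (exitLim (x n, ((v : ℝ) : EReal)) w))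
            (scaleFun κ c v)) atTop ∂κ y := by
          refine lintegral_mono_ae ?_
          have hall : ∀ᵐ w ∂κ y, ∀ n, exitLim (x n, ((v : ℝ) : EReal)) w = x n ∨
              exitLim (x n, ((v : ℝ) : EReal)) w = ((v : ℝ) : EReal) := ae_all_iff.2 fun n => by
            have hDn : (x n, ((v : ℝ) : EReal)) ∈ thresholdPairs I y :=
              ⟨⟨((hxm n).2.trans (EReal.coe_lt_coe_iff.2 hay)).le,
                (isPreconnected_closedRange hκ.ordConnected).ordConnected.out
                  hz (coe_mem_closedRange a) (Ioo_subset_Icc_self (hxm n))⟩, hD.2⟩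
            filter_upwards [hlim (x n, ((v : ℝ) : EReal)), hκ.ae_exitValue hT hDn] with w h1 h2
            rwa [h1]
          filter_upwards [hκ.ae_isTransientPath hT y, hval, hall] with w h1 h3 h4
          rcases h3 with h3 | h3
          · rw [if_pos h3]
            refine le_liminf_of_le (by isBoundedDefault) (Eventually.of_forall fun n => ?_)
            refine le_min ?_ htv
            rcases h4 n with h4 | h4
            · rw [h4]; exact hxΦ n
            · rw [h4, scaleE_coe hκ hc]; exact htv
          · rw [if_neg (by rw [h3]; exact hzv.ne')]
            refine le_liminf_of_le (by isBoundedDefault) ?_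
            filter_upwards [h1.eventually_exitLim_eq hzy hyv' h3 hxz]
              with n hn
            rw [hn, scaleE_coe hκ hc, min_self]
      _ ≤ liminf (fun n => ∫⁻ w, min (scaleE κ c (exitLim (x n, ((v : ℝ) : EReal)) w))
            (scaleFun κ c v) ∂κ y) atTop :=
          lintegral_liminf_le fun n => (hΦm.comp (hEm _)).min measurable_const
      _ = scaleFun κ c y := by simp only [hEx, liminf_const]
  rw [hfat, heq] at hF
  -- If the exit were surely at `v`, optional stopping would give `s(v) = s(y)`.
  have hp : κ y (exitLim (z, ((v : ℝ) : EReal)) ⁻¹' {z}) ≠ 0 := fun hp => by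
    rw [hp, zero_add] at hone
    rw [hp, ← hone, mul_zero, zero_add, mul_one] at heq
    exact (scaleFun_lt hκ hT hc hyv').ne heq
  have hfin : scaleFun κ c v * κ y (exitLim (z, ((v : ℝ) : EReal)) ⁻¹' {((v : ℝ) : EReal)}) ≠ ⊤ :=
    ENNReal.mul_ne_top (scaleFun_ne_top hκ hc v) (measure_ne_top _ _)
  exact absurd ((ENNReal.mul_le_mul_iff_left hp (measure_ne_top _ _)).1
    ((ENNReal.add_le_add_iff_right hfin).1 hF)) (not_le.2 ht)

theorem continuousOn_scaleE (hκ : IsRegularDiffusion I κ)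
    (hT : ∀ a b : I, a < b → κ a (hit b) < 1) {c : I} (hc : (c : ℝ) ∈ interior I) :
    ContinuousOn (scaleE κ c) (closedRange I) := by
  intro z hz
  refine tendsto_order.2 ⟨fun t ht => ?_, fun t ht => ?_⟩
  · obtain ⟨b, hbz, hb⟩ : ∃ b : I, ((b : ℝ) : EReal) ≤ z ∧ t < scaleFun κ c b := by
      simpa only [scaleE, lt_iSup_iff, exists_prop] using ht
    obtain ⟨v, hv, htv⟩ := exists_scaleFun_gt hκ hT hc hb
    filter_upwards [nhdsWithin_le_nhds
      (eventually_gt_nhds ((EReal.coe_lt_coe_iff.2 hv).trans_le hbz))] with x hx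
    exact htv.trans_le (scaleFun_le_scaleE hx.le)
  · by_cases hmax : ∀ z' ∈ closedRange I, z' ≤ z
    · filter_upwards [self_mem_nhdsWithin] with x hx
      exact (scaleE_mono κ c (hmax x hx)).trans_lt ht
    · push Not at hmax
      obtain ⟨z', hz', hzz⟩ := hmax
      obtain ⟨v, hzv, hvt⟩ := exists_scaleFun_lt hκ hT hc hz hz' hzz ht
      filter_upwards [nhdsWithin_le_nhds (eventually_lt_nhds hzv)] with x hx
      exact (scaleE_mono κ c hx.le).trans_lt ((scaleE_coe hκ hc v).trans_lt hvt)

end Diffusion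

/-! ### A bounded transform of the scale function -/

/-- The identity on `[0, 1]`, continued by `t ↦ 2 - 1 / t`: a bounded strictly increasing function
below the identity. -/
noncomputable def squash (t : ℝ≥0∞) : ℝ := (min t 1).toReal + (1 - ((max t 1)⁻¹).toReal)

theorem inv_max_le_one (t : ℝ≥0∞) : (max t 1)⁻¹ ≤ 1 := ENNReal.inv_le_one.2 (le_max_right _ _)

theorem squash_strictMono : StrictMono squash := by
  intro t t' h
  have h1 : (min t 1).toReal ≤ (min t' 1).toReal :=
    ENNReal.toReal_mono (by simp) (min_le_min_right _ h.le)
  have h2 : ((max t' 1)⁻¹).toReal ≤ ((max t 1)⁻¹).toReal :=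
    ENNReal.toReal_mono (ne_top_of_le_ne_top ENNReal.one_ne_top (inv_max_le_one _))
      (ENNReal.inv_le_inv.2 (max_le_max_right _ h.le))
  unfold squash
  rcases lt_or_ge t 1 with ht | ht
  · have : (min t 1).toReal < (min t' 1).toReal :=
      ENNReal.toReal_strict_mono (by simp) (by rw [min_eq_left ht.le]; exact lt_min h ht)
    linarith
  · have : ((max t' 1)⁻¹).toReal < ((max t 1)⁻¹).toReal :=
      ENNReal.toReal_strict_mono (ne_top_of_le_ne_top ENNReal.one_ne_top (inv_max_le_one _))
        (ENNReal.inv_lt_inv.2 (by rw [max_eq_left ht]; exact lt_max_of_lt_left h))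
    linarith

theorem squash_of_le_one {t : ℝ≥0∞} (h : t ≤ 1) : squash t = t.toReal := by
  simp [squash, min_eq_left h, max_eq_right h]

theorem squash_nonneg (t : ℝ≥0∞) : 0 ≤ squash t := by
  have h : ((max t 1)⁻¹).toReal ≤ 1 := by
    simpa using ENNReal.toReal_mono ENNReal.one_ne_top (inv_max_le_one t)
  have : 0 ≤ (min t 1).toReal := ENNReal.toReal_nonneg
  unfold squash
  linarith

theorem squash_le_two (t : ℝ≥0∞) : squash t ≤ 2 := by
  have h : (min t 1).toReal ≤ 1 := by
    simpa using ENNReal.toReal_mono ENNReal.one_ne_top (min_le_right t 1)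
  have : 0 ≤ ((max t 1)⁻¹).toReal := ENNReal.toReal_nonneg
  unfold squash
  linarith

/-- Being below the identity, with equality up to `1`, is what keeps the mean at a stopping time at
most the initial value, even for an unbounded scale function. Above `1` the claim `2 - 1 / t ≤ t` is
`(t - 1)² ≥ 0`. -/
theorem ofReal_squash_le (t : ℝ≥0∞) : ENNReal.ofReal (squash t) ≤ t := by
  rcases le_or_gt t 1 with h | h
  · rw [squash_of_le_one h, ENNReal.ofReal_toReal (ne_top_of_le_ne_top ENNReal.one_ne_top h)]
  rcases eq_or_ne t ⊤ with rfl | ht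
  · exact le_top
  rw [← ENNReal.ofReal_toReal ht]
  refine ENNReal.ofReal_le_ofReal ?_
  rw [ENNReal.ofReal_toReal ht, squash, min_eq_right h.le, max_eq_left h.le, ENNReal.toReal_inv]
  have h1 : 1 < t.toReal := by simpa using (ENNReal.toReal_lt_toReal ENNReal.one_ne_top ht).2 h
  have h2 : t.toReal * t.toReal⁻¹ = 1 := mul_inv_cancel₀ (by linarith)
  simp only [ENNReal.toReal_one]
  nlinarith [sq_nonneg (t.toReal - 1), inv_pos.2 (by linarith : 0 < t.toReal)]

theorem continuous_squash : Continuous squash := by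
  have h1 : Continuous fun t : ℝ≥0∞ => (min t 1).toReal :=
    ENNReal.continuousOn_toReal.comp_continuous (continuous_id.min continuous_const)
      fun t => ne_top_of_le_ne_top ENNReal.one_ne_top (min_le_right t 1)
  have h2 : Continuous fun t : ℝ≥0∞ => ((max t 1)⁻¹).toReal :=
    ENNReal.continuousOn_toReal.comp_continuous (continuous_id.max continuous_const).inv
      fun t => ne_top_of_le_ne_top ENNReal.one_ne_top (inv_max_le_one t)
  exact h1.add (continuous_const.sub h2)

section Diffusion

variable {I : Set ℝ} {κ : Kernel I (ContPath I)} {Ω : Type*} {mΩ : MeasurableSpace Ω}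
  {P : Measure Ω} {𝓕 : Filtration ℝ≥0 mΩ} {Y : Ω → ContPath I}

/-- A bounded increasing function `g` on `[-∞, ∞]`, such that `g(Y)` is a supermartingale. -/
noncomputable def boundedScale (κ : Kernel I (ContPath I)) (c : I) (z : EReal) : ℝ :=
  squash (scaleE κ c z)

theorem boundedScale_mono (κ : Kernel I (ContPath I)) (c : I) : Monotone (boundedScale κ c) :=
  squash_strictMono.monotone.comp (scaleE_mono κ c)

theorem boundedScale_strictMonoOn (hκ : IsRegularDiffusion I κ)
    (hT : ∀ a b : I, a < b → κ a (hit b) < 1) {c : I} (hc : (c : ℝ) ∈ interior I) :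
    StrictMonoOn (boundedScale κ c) (closedRange I) := fun _ hx _ hz h =>
  squash_strictMono (scaleE_lt hκ hT hc hx hz h)

theorem isUtility_comp_boundedScale (hκ : IsRegularDiffusion I κ)
    (hT : ∀ a b : I, a < b → κ a (hit b) < 1) {c : I} (hc : (c : ℝ) ∈ interior I) {f : ℝ → ℝ}
    (hf : StrictMono f) (hfc : Continuous f) :
    IsUtility I fun z => ((f (boundedScale κ c z) : ℝ) : EReal) := by
  refine ⟨fun x hx z hz h => ?_, ?_⟩
  · exact EReal.coe_lt_coe_iff.2 (hf (boundedScale_strictMonoOn hκ hT hc hx hz h))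
  · exact continuous_coe_real_ereal.comp_continuousOn
      (hfc.comp_continuousOn (continuous_squash.comp_continuousOn (continuousOn_scaleE hκ hT hc)))

theorem integrable_comp_boundedScale [IsFiniteMeasure P] (κ : Kernel I (ContPath I)) (c : I)
    {f : ℝ → ℝ} (hf : StrictMono f) {X : Ω → EReal} (hX : AEMeasurable X P) :
    Integrable (fun ω => f (boundedScale κ c (X ω))) P := by
  refine Integrable.of_bound (((hf.monotone.comp
    (boundedScale_mono κ c)).measurable.comp_aemeasurable hX).aestronglyMeasurable)
    (max |f 0| |f 2|) (Eventually.of_forall fun ω => ?_)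
  exact abs_le_max_abs_abs (hf.monotone (squash_nonneg _)) (hf.monotone (squash_le_two _))

theorem hasExpectedUtility_comp_boundedScale [IsFiniteMeasure P] (hY : Measurable Y)
    (κ : Kernel I (ContPath I)) (c : I) {f : ℝ → ℝ} (hf : StrictMono f) {τ : Ω → WithTop ℝ≥0}
    (hτ : τ ∈ allRules 𝓕 P Y) :
    HasExpectedUtility P Y (fun z => ((f (boundedScale κ c z) : ℝ) : EReal)) τ :=
  ⟨Eventually.of_forall fun _ => ⟨EReal.coe_ne_bot _, EReal.coe_ne_top _⟩,
    integrable_comp_boundedScale κ c hf (aemeasurable_stoppedAt hY hτ)⟩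

theorem lawInvariant_cscValue (hY : Measurable Y) {ι : Type*} (u : ι → EReal → EReal)
    (hu : ∀ i, Measurable (u i)) : LawInvariant 𝓕 P Y (cscValue P Y u) := by
  intro σ hσ τ hτ h
  have key : ∀ i, ∫ ω, (u i (stoppedAt Y σ ω)).toReal ∂P =
      ∫ ω, (u i (stoppedAt Y τ ω)).toReal ∂P := fun i => by
    have hm : Measurable fun z => (u i z).toReal := measurable_ereal_toReal.comp (hu i)
    rw [← integral_map (f := fun z => (u i z).toReal) (aemeasurable_stoppedAt hY hσ)
      hm.aestronglyMeasurable, h, integral_map (aemeasurable_stoppedAt hY hτ)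
      hm.aestronglyMeasurable]
  simp only [cscValue, certaintyEquivalent, key]

/-- The normalization at `c ≥ y` puts the initial scale in the range where `squash` is the identity;
elsewhere `squash` only lowers the value. -/
theorem integral_boundedScale_le [IsProbabilityMeasure P] (hκ : IsRegularDiffusion I κ)
    (hT : ∀ a b : I, a < b → κ a (hit b) < 1) (hY : IsStrongMarkov 𝓕 P Y κ) {y : I}
    (hy : (y : ℝ) ∈ interior I) (h0 : ∀ᵐ ω ∂P, (Y ω).1 0 = y) {c : I}
    (hc : (c : ℝ) ∈ interior I) (hyc : y ≤ c) {τ : Ω → WithTop ℝ≥0} (hτ : τ ∈ allRules 𝓕 P Y) :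
    ∫ ω, boundedScale κ c (stoppedAt Y τ ω) ∂P ≤ boundedScale κ c ((y : ℝ) : EReal) := by
  have hy1 : scaleE κ c ((y : ℝ) : EReal) ≤ 1 := by
    rw [← scaleFun_self hκ c, ← scaleE_coe hκ hc]
    exact scaleE_mono κ c (EReal.coe_le_coe_iff.2 hyc)
  have hint := integrable_comp_boundedScale (P := P) κ c strictMono_id
    (aemeasurable_stoppedAt hY.measurable hτ)
  rw [boundedScale, squash_of_le_one hy1, scaleE_coe hκ hc,
    integral_eq_lintegral_of_nonneg_ae (f := fun ω => boundedScale κ c (stoppedAt Y τ ω))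
      (Eventually.of_forall fun ω => squash_nonneg _) hint.1]
  refine ENNReal.toReal_mono (scaleFun_ne_top hκ hc y) ?_
  exact (lintegral_mono fun ω => ofReal_squash_le _).trans
    (lintegral_scaleE_le hκ hT hY hy h0 hc hτ.1)

theorem exitTime_mem_thresholdRules (hκ : IsRegularDiffusion I κ)
    (hT : ∀ a b : I, a < b → κ a (hit b) < 1) (hY : IsStrongMarkov 𝓕 P Y κ) {y : I}
    {p : EReal × EReal} (hp : p ∈ thresholdPairs I y) :
    (fun ω => exitTime p.1 p.2 (Y ω)) ∈ thresholdRules 𝓕 P Y y :=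
  ⟨hY.mem_allRules hκ hT (isStoppingTime_exitTime hY.1 measurable_const measurable_const),
    p, hp, rfl⟩

theorem ae_stoppedAt_exitTime (hκ : IsRegularDiffusion I κ)
    (hT : ∀ a b : I, a < b → κ a (hit b) < 1) (hY : IsStrongMarkov 𝓕 P Y κ) {y : I}
    (h0 : ∀ᵐ ω ∂P, (Y ω).1 0 = y) {p : EReal × EReal} (hp : p ∈ thresholdPairs I y) :
    ∀ᵐ ω ∂P, stoppedAt Y (fun ω => exitTime p.1 p.2 (Y ω)) ω = p.1 ∨
      stoppedAt Y (fun ω => exitTime p.1 p.2 (Y ω)) ω = p.2 := by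
  filter_upwards [hY.ae_isTransientPath hκ hT, h0] with ω h1 h2
  exact h1.exitValue_eq h2 hp

/-- Up to the threshold `c` the scale is at most `1`, so `squash` acts as the identity on all exit
values and optional stopping is exact. -/
theorem integral_boundedScale_exitTime [IsProbabilityMeasure P] (hκ : IsRegularDiffusion I κ)
    (hT : ∀ a b : I, a < b → κ a (hit b) < 1) (hY : IsStrongMarkov 𝓕 P Y κ) {y : I}
    (hy : (y : ℝ) ∈ interior I) (h0 : ∀ᵐ ω ∂P, (Y ω).1 0 = y) {c : I}
    (hc : (c : ℝ) ∈ interior I) (hyc : y ≤ c) {a : EReal}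
    (hp : (a, ((c : ℝ) : EReal)) ∈ thresholdPairs I y) :
    ∫ ω, boundedScale κ c (stoppedAt Y (fun ω => exitTime a ((c : ℝ) : EReal) (Y ω)) ω) ∂P =
      boundedScale κ c ((y : ℝ) : EReal) := by
  have hc1 : scaleE κ c ((c : ℝ) : EReal) = 1 := (scaleE_coe hκ hc c).trans (scaleFun_self hκ c)
  have hy1 : scaleE κ c ((y : ℝ) : EReal) ≤ 1 :=
    (scaleE_mono κ c (EReal.coe_le_coe_iff.2 hyc)).trans hc1.le
  have hrule := (exitTime_mem_thresholdRules hκ hT hY hp).1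
  have hXm := aemeasurable_stoppedAt hY.measurable hrule
  have hae : ∀ᵐ ω ∂P,
      scaleE κ c (stoppedAt Y (fun ω => exitTime a ((c : ℝ) : EReal) (Y ω)) ω) ≤ 1 :=
    (ae_stoppedAt_exitTime hκ hT hY h0 hp).mono fun ω hω => by
      rw [← hc1]
      refine scaleE_mono κ c ?_
      rcases hω with hω | hω
      · exact hω.le.trans (hp.1.1.trans hp.2.1)
      · exact hω.le
  have hlint : ∫⁻ ω, min (scaleE κ c (stoppedAt Y (fun ω => exitTime a ((c : ℝ) : EReal) (Y ω)) ω))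
      (scaleFun κ c c) ∂P = scaleFun κ c y :=
    lintegral_min_scaleE_exitTime hκ hT hY hy h0 hc a hyc
  generalize stoppedAt Y (fun ω => exitTime a ((c : ℝ) : EReal) (Y ω)) = X at *
  have hm : AEMeasurable (fun ω => scaleE κ c (X ω)) P :=
    (scaleE_mono κ c).measurable.comp_aemeasurable hXm
  rw [lintegral_congr_ae (g := fun ω => scaleE κ c (X ω)) (hae.mono fun ω hω => ?_)] at hlint
  · rw [boundedScale, squash_of_le_one hy1, scaleE_coe hκ hc, ← hlint,
      ← integral_toReal hm (hae.mono fun ω hω => hω.trans_lt ENNReal.one_lt_top)]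
    exact integral_congr_ae (hae.mono fun ω hω => squash_of_le_one hω)
  · rw [scaleFun_self hκ, min_eq_left hω]

/-- For `f` above the identity, the rule `τ_{a,c}` has expected utility at least that of `y`, with
strict inequality if `f` is strictly above the identity at `a`. -/
theorem le_integral_comp_boundedScale_exitTime [IsProbabilityMeasure P]
    (hκ : IsRegularDiffusion I κ)
    (hT : ∀ a b : I, a < b → κ a (hit b) < 1) (hY : IsStrongMarkov 𝓕 P Y κ) {y : I}
    (hy : (y : ℝ) ∈ interior I) (h0 : ∀ᵐ ω ∂P, (Y ω).1 0 = y) {c : I}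
    (hc : (c : ℝ) ∈ interior I) (hyc : y < c) {a : EReal}
    (hp : (a, ((c : ℝ) : EReal)) ∈ thresholdPairs I y) {f : ℝ → ℝ} (hf : StrictMono f)
    (hle : ∀ t, t ≤ f t) :
    boundedScale κ c ((y : ℝ) : EReal) ≤
        ∫ ω, f (boundedScale κ c (stoppedAt Y (fun ω => exitTime a ((c : ℝ) : EReal) (Y ω)) ω)) ∂P ∧
      (boundedScale κ c a < f (boundedScale κ c a) → boundedScale κ c ((y : ℝ) : EReal) <
        ∫ ω, f (boundedScale κ c
          (stoppedAt Y (fun ω => exitTime a ((c : ℝ) : EReal) (Y ω)) ω)) ∂P) := by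
  have heq := integral_boundedScale_exitTime hκ hT hY hy h0 hc hyc.le hp
  have hrule := (exitTime_mem_thresholdRules hκ hT hY hp).1
  have hXm := aemeasurable_stoppedAt hY.measurable hrule
  have hval := ae_stoppedAt_exitTime hκ hT hY h0 hp
  have hi1 := integrable_comp_boundedScale (P := P) κ c strictMono_id hXm
  have hi2 := integrable_comp_boundedScale (P := P) κ c hf hXm
  generalize stoppedAt Y (fun ω => exitTime a ((c : ℝ) : EReal) (Y ω)) = X at *
  have hge : boundedScale κ c ((y : ℝ) : EReal) ≤ ∫ ω, f (boundedScale κ c (X ω)) ∂P := by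
    rw [← heq]
    exact integral_mono hi1 hi2 fun ω => hle _
  refine ⟨hge, fun ha => hge.lt_of_ne fun h => ?_⟩
  rw [← heq] at h
  have hae := (integral_eq_iff_of_ae_le hi1 hi2 (Eventually.of_forall fun ω => hle _)).1 h
  -- Equality of the means leaves no mass where `f` exceeds the identity, in particular none at `a`;
  -- an exit surely at `c` contradicts the mean of `g` being `g(y) < g(c)`.
  have hXc : ∀ᵐ ω ∂P, boundedScale κ c (X ω) = boundedScale κ c ((c : ℝ) : EReal) := by
    filter_upwards [hae, hval] with ω h1 h2
    rcases h2 with h2 | h2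
    · change boundedScale κ c (X ω) = f (boundedScale κ c (X ω)) at h1
      rw [h2] at h1
      exact absurd h1 ha.ne
    · rw [h2]
  rw [integral_congr_ae hXc, integral_const, probReal_univ, one_smul] at heq
  exact (boundedScale_strictMonoOn hκ hT hc (coe_mem_closedRange y) (coe_mem_closedRange c)
    (EReal.coe_lt_coe_iff.2 hyc)).ne' heq

theorem certaintyEquivalent_le_of_integral_le [IsProbabilityMeasure P] (hI : I.OrdConnected)
    {u : EReal → EReal} (hu : IsUtility I u) {τ : Ω → WithTop ℝ≥0} (hτ : τ ∈ allRules 𝓕 P Y)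
    (h : HasExpectedUtility P Y u τ) {x : EReal} (hx : x ∈ closedRange I)
    (hle : ((∫ ω, (u (stoppedAt Y τ ω)).toReal ∂P : ℝ) : EReal) ≤ u x) :
    certaintyEquivalent P Y u τ ≤ x := by
  obtain ⟨h1, h2⟩ := certaintyEquivalent_spec hI hu hτ h
  rw [← hu.1.le_iff_le h1 hx, h2]
  exact hle

/-! ### Pure threshold rules need not suffice -/

/-- The utilities are increasing functions of `g`, whose mean at a stopping time is at most `x₀ =
g(y)`. Each rewards one kind of lower exit level, and no single level is rewarded by both. -/
theorem exists_utility_mixture_beats_pure [IsProbabilityMeasure P] (hκ : IsRegularDiffusion I κ)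
    (hT : ∀ a b : I, a < b → κ a (hit b) < 1) (hY : IsStrongMarkov 𝓕 P Y κ) {y : I}
    (hy : (y : ℝ) ∈ interior I) (h0 : ∀ᵐ ω ∂P, (Y ω).1 0 = y) (hrich : IsRich 𝓕 P Y) :
    ∃ u : Fin 2 → EReal → EReal,
      (∀ i, IsUtility I (u i) ∧ ∀ z ∈ closedRange I, u i z ≠ ⊥ ∧ u i z ≠ ⊤) ∧
      LawInvariant 𝓕 P Y (cscValue P Y u) ∧
      optimalValue (cscValue P Y u) (thresholdRules 𝓕 P Y y) <
        optimalValue (cscValue P Y u) (randomizedThresholdRules 𝓕 P Y y) ∧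
      ∃ (τ : Fin 2 → Ω → WithTop ℝ≥0) (Z : Ω → Fin 2),
        (∀ i, τ i ∈ thresholdRules 𝓕 P Y y) ∧ Measurable[𝓕 0] Z ∧ IndepFun Z Y P ∧
        mixture Z τ ∈ randomizedThresholdRules 𝓕 P Y y ∧
        optimalValue (cscValue P Y u) (thresholdRules 𝓕 P Y y) <
          cscValue P Y u (mixture Z τ) := by
  have hI := hκ.ordConnected
  obtain ⟨b, hb⟩ := exists_gt_of_mem_interior hy
  obtain ⟨c', hc1, hc2⟩ := exists_between (show (y : ℝ) < b from hb)
  obtain ⟨a₀, ha₀⟩ := exists_lt_of_mem_interior hy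
  obtain ⟨a', ha1, ha2⟩ := exists_between (show (a₀ : ℝ) < y from ha₀)
  obtain ⟨c, hyc, hcb⟩ : ∃ c : I, y < c ∧ c < b :=
    ⟨⟨c', hI.out y.2 b.2 ⟨hc1.le, hc2.le⟩⟩, hc1, hc2⟩
  obtain ⟨a, haa, hay⟩ : ∃ a : I, a₀ < a ∧ a < y :=
    ⟨⟨a', hI.out a₀.2 y.2 ⟨ha1.le, ha2.le⟩⟩, ha1, ha2⟩
  have hc : (c : ℝ) ∈ interior I := mem_interior_of_lt hI hyc hcb
  set g := boundedScale κ c with hg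
  have hgs := boundedScale_strictMonoOn hκ hT hc
  set x₀ := g ((y : ℝ) : EReal) with hx₀
  set x₂ := g ((a : ℝ) : EReal) with hx₂
  -- Any cut with `0 < s < x₂` serves. It separates the value `0` of `g` at the lower end from its
  -- value `x₂` at `a`, which is positive since `a` lies above another point `a₀` of `I`.
  set s := x₂ / 2 with hs
  have hx20 : x₂ < x₀ := hgs (coe_mem_closedRange a) (coe_mem_closedRange y)
    (EReal.coe_lt_coe_iff.2 hay)
  have hx2pos : 0 < x₂ := (squash_nonneg _).trans_lt (hgs (coe_mem_closedRange a₀)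
    (coe_mem_closedRange a) (EReal.coe_lt_coe_iff.2 haa))
  have hs0 : 0 < s := by positivity
  have hs2 : s < x₂ := by rw [hs]; linarith
  -- `f 0` exceeds the identity exactly on values below `s`, and `f 1` exactly on `(s, x₀)`.
  set f : Fin 2 → ℝ → ℝ := ![fun t => max t ((t + s) / 2),
    fun t => max t (min (2 * t - s) ((t + x₀) / 2))] with hf
  have hf0 : ∀ t, f 0 t = max t ((t + s) / 2) := fun _ => rfl
  have hf1 : ∀ t, f 1 t = max t (min (2 * t - s) ((t + x₀) / 2)) := fun _ => rfl
  have hfm : ∀ i, StrictMono (f i) := Fin.forall_fin_two.2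
    ⟨fun t t' h => by rw [hf0, hf0]; exact max_lt_max h (by linarith),
      fun t t' h => by
        rw [hf1, hf1]; exact max_lt_max h (min_lt_min (by linarith) (by linarith))⟩
  have hfc : ∀ i, Continuous (f i) := Fin.forall_fin_two.2
    ⟨by change Continuous fun t : ℝ => max t ((t + s) / 2); fun_prop,
      by change Continuous fun t : ℝ => max t (min (2 * t - s) ((t + x₀) / 2)); fun_prop⟩
  have hfle : ∀ i t, t ≤ f i t := Fin.forall_fin_two.2
    ⟨fun t => le_max_left _ _, fun t => le_max_left _ _⟩
  have hf0s : ∀ t, s ≤ t → f 0 t = t := fun t h => max_eq_left (by linarith)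
  have hf1s : ∀ t, t ≤ s → f 1 t = t := fun t h =>
    max_eq_left ((min_le_left _ _).trans (by linarith))
  have hf1x : ∀ t, x₀ ≤ t → f 1 t = t := fun t h =>
    max_eq_left ((min_le_right _ _).trans (by linarith))
  have hfx : ∀ i, f i x₀ = x₀ := Fin.forall_fin_two.2 ⟨hf0s _ (by linarith), hf1x _ le_rfl⟩
  set u : Fin 2 → EReal → EReal := fun i z => ((f i (g z) : ℝ) : EReal) with hu
  have huU : ∀ i, IsUtility I (u i) := fun i => isUtility_comp_boundedScale hκ hT hc (hfm i) (hfc i)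
  have hEU : ∀ i, ∀ τ ∈ allRules 𝓕 P Y, HasExpectedUtility P Y (u i) τ := fun i τ hτ =>
    hasExpectedUtility_comp_boundedScale hY.measurable κ c (hfm i) hτ
  have hyI : ((y : ℝ) : EReal) ∈ closedRange I := coe_mem_closedRange y
  have hpure : optimalValue (cscValue P Y u) (thresholdRules 𝓕 P Y y) ≤ ((y : ℝ) : EReal) := by
    refine iSup₂_le fun τ hτ => ?_
    obtain ⟨hτa, p, hp, rfl⟩ := hτ
    have hle := integral_boundedScale_le hκ hT hY hy h0 hc hyc.le hτa
    have hval := ae_stoppedAt_exitTime hκ hT hY h0 hp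
    -- The upper exit value is at least `x₀`, where both functions are the identity; the lower one
    -- is on one side of `s`, where one of them is. For this `i` the expected utility is the mean of
    -- `g`, at most `x₀`.
    have key : ∃ i, f i (g p.1) = g p.1 ∧ f i (g p.2) = g p.2 := by
      have hp2 : x₀ ≤ g p.2 := boundedScale_mono κ c hp.2.1
      rcases le_total s (g p.1) with h | h
      · exact ⟨0, hf0s _ h, hf0s _ (by linarith)⟩
      · exact ⟨1, hf1s _ h, hf1x _ hp2⟩
    obtain ⟨i, h1, h2⟩ := key
    refine (iInf_le _ i).trans (certaintyEquivalent_le_of_integral_le hI (huU i) hτa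
      (hEU i _ hτa) hyI ?_)
    simp only [hu, EReal.toReal_coe, EReal.coe_le_coe_iff]
    rw [← hx₀, hfx i]
    refine le_trans (integral_congr_ae (hval.mono fun ω hω => ?_)).le hle
    change f i (g _) = g _
    rcases hω with hω | hω
    · rw [hω, h1]
    · rw [hω, h2]
  have hcpt : IsCompact (closedRange I) := isClosed_closure.isCompact (X := EReal)
  set l := sInf (closedRange I) with hl
  have hlI : l ∈ closedRange I := hcpt.sInf_mem ⟨_, hyI⟩
  have hgl : g l = 0 := by
    have : scaleE κ c l = 0 := scaleE_of_le hκ hc fun v => sInf_le (coe_mem_closedRange v)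
    rw [hg, boundedScale, this, squash_of_le_one zero_le, ENNReal.toReal_zero]
  have hcD : ((c : ℝ) : EReal) ∈ Ici ((y : ℝ) : EReal) ∩ closedRange I :=
    ⟨EReal.coe_le_coe_iff.2 hyc.le, coe_mem_closedRange c⟩
  have hp0 : (l, ((c : ℝ) : EReal)) ∈ thresholdPairs I y := ⟨⟨sInf_le hyI, hlI⟩, hcD⟩
  have hp1 : (((a : ℝ) : EReal), ((c : ℝ) : EReal)) ∈ thresholdPairs I y :=
    ⟨⟨EReal.coe_le_coe_iff.2 hay.le, coe_mem_closedRange a⟩, hcD⟩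
  set τ : Fin 2 → Ω → WithTop ℝ≥0 := ![fun ω => exitTime l ((c : ℝ) : EReal) (Y ω),
    fun ω => exitTime ((a : ℝ) : EReal) ((c : ℝ) : EReal) (Y ω)] with hτ
  have hτT : ∀ i, τ i ∈ thresholdRules 𝓕 P Y y := Fin.forall_fin_two.2
    ⟨exitTime_mem_thresholdRules hκ hT hY hp0, exitTime_mem_thresholdRules hκ hT hY hp1⟩
  -- Any weight strictly between `0` and `1` would do: under each utility one rule has mean greater
  -- than `x₀` and the other at least `x₀`.
  obtain ⟨Z, hZ, hind, hZθ⟩ := hrich.exists_index (θ := 1 / 2) (by norm_num) (by norm_num)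
  have hmixR := mixture_mem_randomizedThresholdRules hZ hind hτT
  have hbeat : ((y : ℝ) : EReal) < cscValue P Y u (mixture Z τ) := by
    have hmix := fun i => hasExpectedUtility_mixture (huU i) (fun j => (hτT j).1)
      (fun j => hEU i _ (hτT j).1) (hZ.mono (𝓕.le 0) le_rfl)
      (fun j => indepFun_stoppedAt_of_mem_thresholdRules hind (hτT j)) (by norm_num) hZθ
    refine lt_cscValue_of_integral hI huU hmixR.1 (fun i => (hmix i).1) hyI fun i => ?_
    rw [(hmix i).2]
    simp only [hu, EReal.toReal_coe, EReal.coe_lt_coe_iff]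
    rw [← hx₀, hfx i]
    have k0 := le_integral_comp_boundedScale_exitTime hκ hT hY hy h0 hc hyc hp0 (hfm i) (hfle i)
    have k1 := le_integral_comp_boundedScale_exitTime hκ hT hY hy h0 hc hyc hp1 (hfm i) (hfle i)
    change x₀ ≤ ∫ ω, f i (g (stoppedAt Y (τ 0) ω)) ∂P ∧
      (g l < f i (g l) → x₀ < ∫ ω, f i (g (stoppedAt Y (τ 0) ω)) ∂P) at k0
    change x₀ ≤ ∫ ω, f i (g (stoppedAt Y (τ 1) ω)) ∂P ∧
      (x₂ < f i x₂ → x₀ < ∫ ω, f i (g (stoppedAt Y (τ 1) ω)) ∂P) at k1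
    fin_cases i
    · have := k0.2 (by
        rw [hgl]
        exact lt_of_lt_of_le (by linarith : (0 : ℝ) < (0 + s) / 2) (le_max_right _ _))
      linarith [k1.1]
    · have := k1.2 (lt_of_lt_of_le (lt_min (by linarith) (by linarith) :
        x₂ < min (2 * x₂ - s) ((x₂ + x₀) / 2)) (le_max_right _ _))
      linarith [k0.1]
  refine ⟨u, fun i => ⟨huU i, fun z _ => ⟨EReal.coe_ne_bot _, EReal.coe_ne_top _⟩⟩,
    lawInvariant_cscValue hY.measurable u fun i => ?_,
    (hpure.trans_lt hbeat).trans_le (le_biSup (cscValue P Y u) hmixR), τ, Z, hτT, hZ, hind, hmixR,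
    hpure.trans_lt hbeat⟩
  exact measurable_coe_real_ereal.comp
    ((hfc i).measurable.comp (boundedScale_mono κ c).measurable)

end Diffusion

end OptStop

open OptStop in
theorem mainTheorem4 {I : Set ℝ} {Ω : Type*} {mΩ : MeasurableSpace Ω}
    (P : Measure Ω) [IsProbabilityMeasure P] (𝓕 : Filtration ℝ≥0 mΩ)
    (κ : Kernel I (ContPath I)) (hκ : IsRegularDiffusion I κ)
    (y : I) (hy : (y : ℝ) ∈ interior I)
    (Y : Ω → ContPath I) (hY0 : ∀ᵐ ω ∂P, (Y ω).1 0 = y) (hY : IsStrongMarkov 𝓕 P Y κ)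
    (hrich : IsRich 𝓕 P Y) :
    -- randomized threshold rules suffice
    (∀ V : (Ω → WithTop ℝ≥0) → EReal, LawInvariant 𝓕 P Y V →
      optimalValue V (thresholdRules 𝓕 P Y y) ≤ optimalValue V (randomizedThresholdRules 𝓕 P Y y) ∧
      optimalValue V (randomizedThresholdRules 𝓕 P Y y) = optimalValue V (allRules 𝓕 P Y) ∧
      ∀ τ ∈ allRules 𝓕 P Y, ∃ σ ∈ randomizedThresholdRules 𝓕 P Y y, V σ = V τ) ∧
    -- pure threshold rules need not suffice: cautious stochastic choice with two utilities
    ((∃ v : I, y < v ∧ P {ω | ∃ t, (Y ω).1 t = v} < 1) →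
      ∃ u : Fin 2 → EReal → EReal,
        (∀ i, IsUtility I (u i) ∧ ∀ z ∈ closedRange I, u i z ≠ ⊥ ∧ u i z ≠ ⊤) ∧
        LawInvariant 𝓕 P Y (cscValue P Y u) ∧
        optimalValue (cscValue P Y u) (thresholdRules 𝓕 P Y y) <
          optimalValue (cscValue P Y u) (randomizedThresholdRules 𝓕 P Y y) ∧
        ∃ (τ : Fin 2 → Ω → WithTop ℝ≥0) (Z : Ω → Fin 2),
          (∀ i, τ i ∈ thresholdRules 𝓕 P Y y) ∧ Measurable[𝓕 0] Z ∧ IndepFun Z Y P ∧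
          mixture Z τ ∈ randomizedThresholdRules 𝓕 P Y y ∧
          optimalValue (cscValue P Y u) (thresholdRules 𝓕 P Y y) < cscValue P Y u (mixture Z τ)) ∧
    -- the mechanism: a mixture of two rules beats both
    (∀ (u : Fin 2 → EReal → EReal) (τ : Fin 2 → Ω → WithTop ℝ≥0) (c : EReal),
      (∀ i, IsUtility I (u i)) → (∀ i, τ i ∈ allRules 𝓕 P Y) →
      (∀ i j, HasExpectedUtility P Y (u i) (τ j)) →
      c < certaintyEquivalent P Y (u 0) (τ 0) → certaintyEquivalent P Y (u 1) (τ 0) < c →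
      certaintyEquivalent P Y (u 0) (τ 1) < c → c < certaintyEquivalent P Y (u 1) (τ 1) →
      ∃ θ : ℝ, 0 < θ ∧ θ < 1 ∧
        (∀ Z : Ω → Fin 2, Measurable[𝓕 0] Z → (∀ j, IndepFun Z (stoppedAt Y (τ j)) P) →
          P {ω | Z ω = 0} = ENNReal.ofReal θ →
          mixture Z τ ∈ allRules 𝓕 P Y ∧
          max (cscValue P Y u (τ 0)) (cscValue P Y u (τ 1)) < cscValue P Y u (mixture Z τ)) ∧
        ((∀ j, τ j ∈ thresholdRules 𝓕 P Y y) →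
          ∃ Z : Ω → Fin 2, Measurable[𝓕 0] Z ∧ IndepFun Z Y P ∧
            P {ω | Z ω = 0} = ENNReal.ofReal θ ∧
            mixture Z τ ∈ randomizedThresholdRules 𝓕 P Y y ∧
            max (cscValue P Y u (τ 0)) (cscValue P Y u (τ 1)) <
              cscValue P Y u (mixture Z τ))) := by
  refine ⟨fun V hV => randomizedThresholdRules_suffice hκ hY hy hY0 hrich hV, ?_,
    fun u τ c hu hτ h h00 h10 h01 h11 => ?_⟩
  · rintro ⟨v, hyv, hv⟩
    refine exists_utility_mixture_beats_pure hκ (fun a b hab => ?_) hY hy hY0 hrich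
    refine measure_hit_lt_one hκ hyv ?_ hab
    -- The assumption on `Y` is a statement about `κ y`, the law of `Y`.
    rw [← hY.map_eq hY0, Measure.map_apply hY.measurable (measurableSet_hit v)]
    exact hv
  · obtain ⟨θ, hθ0, hθ1, hmix⟩ :=
      exists_mixture_weight hκ.ordConnected u τ c hu hτ h h00 h10 h01 h11
    refine ⟨θ, hθ0, hθ1, hmix, fun hT => ?_⟩
    obtain ⟨Z, hZ, hind, hZθ⟩ := hrich.exists_index hθ0.le hθ1.le
    exact ⟨Z, hZ, hind, hZθ, mixture_mem_randomizedThresholdRules hZ hind hT,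
      (hmix Z hZ (fun j => indepFun_stoppedAt_of_mem_thresholdRules hind (hT j)) hZθ).2⟩
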